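/- **Setting.** Let $K,d,T\ge 1$ be integers, $[K]=\{1,\dots,K\}$, $\mathcal P_K$ the probability simplex in $\mathbb R^K$, $\mathcal X$ a measurable space with a probability measure $\mathcal G$, $\mathcal Z,\Theta\subseteq\mathbb R^d$, and $\phi:[K]\times\mathcal X\to\mathcal Z$ a known feature map, each $\phi(a,\cdot)$ being measurable and square-integrable under $\mathcal G$. For $p:\mathcal X\to\mathcal P_K$ measurable put $\Sigma(p)=\mathbb E_{X_0\sim\mathcal G}\big[\sum_{a}p(a\mid X_0)\phi(a,X_0)\phi(a,X_0)^\top\big]$. Let $\lambda>0$ and let $e^*:\mathcal X\to\mathcal P_K$ be measurable, with $\Sigma(e^*)$ invertible and $z^\top\Sigma(e^*)^{-1}z\le 1/\lambda$ for all $z\in\mathcal Z$. In round $t=1,\dots,T$: nature chooses $\theta_t\in\Theta$ as a measurable function of the past observations $\mathcal F_{t-1}=\{(X_s,A_s,\ell_s(A_s,X_s))\}_{s<t}$; a context $X_t\sim\mathcal G$ is drawn independently of $\mathcal F_{t-1}$; the losses are $\ell_t(a,x)=\langle\phi(a,x),\theta_t\rangle+\varepsilon_t(a)$ with $\mathbb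 E[\varepsilon_t(a)\mid X_t,\mathcal F_{t-1}]=0$; given $\mathcal F_{t-1}$, $X_t$ and $(\varepsilon_t(a))_a$, the learner's arm $A_t$ has distribution $\pi_t(\cdot\mid X_t)$; the learner observes $\ell_t(A_t,X_t)$. Assume $|\langle z,\theta\rangle|\le1$ for all $z\in\mathcal Z$, $\theta\in\Theta$, and $|\ell_t(a,x)|\le 1$ almost surely for all $t,a,x$. The regret is $$R_T=\sup_{\rho}\ \mathbb E\Big[\sum_{t=1}^T\big(\ell_t(A_t,X_t)-\ell_t(\rho(X_t),X_t)\big)\Big],$$ over measurable $\rho:\mathcal X\to[K]$. **Finite-support assumption with constant $L$.** $\mathcal X$ is finite (with the discrete $\sigma$-algebra), $L\ge|\mathcal X|$, and $\mathcal G(\{x\})\ge 1/L$ for all $x\in\mathcal X$. **Algorithm ($1/2$-LC-Tsallis-INF).** With $\Sigma_t=\Sigma(\pi_t)$ and $\widehat\theta_t=\Sigma_t^{-1}\phi(A_t,X_t)\,\ell_t(A_t,X_t)$, the learner plays $$\pi_t(x)=(1-\gamma_t)q_t(x)+\gamma_te^*(x),\qquad q_t(x)=\operatorname*{arg\,min}_{q\in\mathcal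 P_K}\Big\{\sum_{s=1}^{t-1}\sum_{a}\langle\widehat\theta_s,\phi(a,x)\rangle q(a)+\frac1{\eta_{t-1}}\psi(q)\Big\},$$ where $\psi(q)=2\big(1-\sum_a\sqrt{q(a)}\big)$. Put $\widetilde\eta_t=K^{1/4}/\sqrt{dt}$ for $t\ge1$. The parameters, for $t\ge 1$, are * finite-support tuning with constant $L$: $\eta_t=\min\{\widetilde\eta_t,\tfrac1{16}\sqrt{\lambda/L}\}$, $\ \gamma_t=128L\eta_t^2/\lambda$; * general tuning: $\eta_t=\min\{\widetilde\eta_t,\lambda/16\}$, $\ \gamma_t=8\eta_t/\lambda$; with $\eta_0:=\eta_1$, so that $q_1$ is the minimizer of $\psi$, that is, the uniform distribution. **Theorem 4.1 (General regret bounds).** There is an absolute constant $C>0$ such that, in every setting as above, $$R_T\le C\left(\mathbb E\left[\sum_{t=1}^T\frac{\sqrt{d\sqrt K\,\omega_t}}{\sqrt t}\right]+\widetilde\kappa\right),\qquad \omega_t=\sup_{x\in\mathcal X}\min_{a\in[K]}\{1-q_t(a\mid x)\},$$ with $$\widetilde\kappa=\sqrt{\frac{KL}{\lambda}}+\frac{\sqrt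 K\,L\log T}{\lambda d}$$ if the finite-support assumption with constant $L$ holds and the finite-support tuning with this $L$ is used, and with $$\widetilde\kappa=\frac1\lambda\left(\sqrt K+\frac{\sqrt{\sqrt K\,T}}{\sqrt d}\right)$$ if the general tuning is used (with no assumption on the support). -/

import Mathlib

open MeasureTheory ProbabilityTheory
open scoped Matrix

noncomputable section

namespace LinContextBandit

/-! ### Tsallis entropy and the regularized leader -/

/-- The `α`-Tsallis regularizer `ψ(q) = (1/α) (1 - ∑ₐ q(a)^α)`. -/
def tsallis {K : ℕ} (α : ℝ) (q : Fin K → ℝ) : ℝ :=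
  (1 / α) * (1 - ∑ a, q a ^ α)

/-- The FTRL objective `⟨ℓ, q⟩ + (1/η) ψ(q)` with the `1/2`-Tsallis regularizer. -/
def ftrlObjective {K : ℕ} (η : ℝ) (ℓ q : Fin K → ℝ) : ℝ :=
  ∑ a, ℓ a * q a + (1 / η) * tsallis (1 / 2) q

theorem exists_ftrl_minimizer {K : ℕ} [NeZero K] (η : ℝ) (ℓ : Fin K → ℝ) :
    ∃ q ∈ stdSimplex ℝ (Fin K), IsMinOn (ftrlObjective η ℓ) (stdSimplex ℝ (Fin K)) q := by
  refine (isCompact_stdSimplex ℝ (Fin K)).exists_isMinOn ⟨_, single_mem_stdSimplex ℝ (0 : Fin K)⟩ ?_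
  have h : Continuous fun x : ℝ => x ^ (1 / 2 : ℝ) := Real.continuous_rpow_const (by norm_num)
  have : Continuous (ftrlObjective η ℓ) := by
    unfold ftrlObjective tsallis
    fun_prop
  exact this.continuousOn

/-- The minimizer over the probability simplex of the FTRL objective
(for `η > 0` the objective is strictly convex there, so the minimizer is unique). -/
def ftrl {K : ℕ} [NeZero K] (η : ℝ) (ℓ : Fin K → ℝ) : Fin K → ℝ :=
  Classical.choose (exists_ftrl_minimizer η ℓ)

theorem ftrl_mem {K : ℕ} [NeZero K] (η : ℝ) (ℓ : Fin K → ℝ) :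
    ftrl η ℓ ∈ stdSimplex ℝ (Fin K) :=
  (Classical.choose_spec (exists_ftrl_minimizer η ℓ)).1

theorem ftrl_isMinOn {K : ℕ} [NeZero K] (η : ℝ) (ℓ : Fin K → ℝ) :
    IsMinOn (ftrlObjective η ℓ) (stdSimplex ℝ (Fin K)) (ftrl η ℓ) :=
  (Classical.choose_spec (exists_ftrl_minimizer η ℓ)).2

/-! ### The algorithm, as a function of the observed data -/

/-- `Σ(p) = E_{X₀ ∼ G, a ∼ p(X₀)} [φ(a, X₀) φ(a, X₀)ᵀ]`. -/
def secondMoment {𝒳 : Type*} [MeasurableSpace 𝒳] {K d : ℕ} (G : Measure 𝒳)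
    (φ : Fin K → 𝒳 → Fin d → ℝ) (p : 𝒳 → Fin K → ℝ) : Matrix (Fin d) (Fin d) ℝ :=
  Matrix.of fun i j => ∫ x, ∑ a, p x a * (φ a x i * φ a x j) ∂G

/-- Everything the learner is given: the context distribution, the feature map, the
exploration policy, the learning rates and the exploration rates. -/
structure Learner (𝒳 : Type*) [MeasurableSpace 𝒳] (K d : ℕ) where
  G : Measure 𝒳
  φ : Fin K → 𝒳 → Fin d → ℝ
  eStar : 𝒳 → Fin K → ℝ
  η : ℕ → ℝ
  γ : ℕ → ℝ

namespace Learner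

variable {𝒳 : Type*} [MeasurableSpace 𝒳] {K d : ℕ} [NeZero K] (𝒜 : Learner 𝒳 K d)

/-- `q_t(x)` when the estimates of the rounds before `t` add up to `S`. -/
def qOf (t : ℕ) (S : Fin d → ℝ) (x : 𝒳) : Fin K → ℝ :=
  ftrl (𝒜.η (t - 1)) fun a => S ⬝ᵥ 𝒜.φ a x

/-- `π_t(x) = (1 - γ_t) q_t(x) + γ_t e*(x)`, with `q_t(x)` as in `qOf`. -/
def piOf (t : ℕ) (S : Fin d → ℝ) (x : 𝒳) (a : Fin K) : ℝ :=
  (1 - 𝒜.γ t) * 𝒜.qOf t S x a + 𝒜.γ t * 𝒜.eStar x a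

/-- The estimate `Σ_t⁻¹ φ(a, x) y` formed in round `t` from the observation `(x, a, y)`,
where `Σ_t = Σ(π_t)`. -/
def estimateOf (t : ℕ) (S : Fin d → ℝ) (o : 𝒳 × Fin K × ℝ) : Fin d → ℝ :=
  o.2.2 • ((secondMoment 𝒜.G 𝒜.φ (𝒜.piOf t S))⁻¹ *ᵥ 𝒜.φ o.2.1 o.1)

/-- The sum of the estimates of the rounds `1, …, t`, when `h s = (X_s, A_s, ℓ_s(A_s, X_s))`
is the observation of round `s`. -/
def cumEst (h : ℕ → 𝒳 × Fin K × ℝ) : ℕ → Fin d → ℝ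
  | 0 => 0
  | t + 1 => cumEst h t + 𝒜.estimateOf (t + 1) (cumEst h t) (h (t + 1))

/-- `θ̂_t`. -/
def thetaHat (h : ℕ → 𝒳 × Fin K × ℝ) (t : ℕ) : Fin d → ℝ :=
  𝒜.estimateOf t (𝒜.cumEst h (t - 1)) (h t)

/-- `q_t(x)`. -/
def q (h : ℕ → 𝒳 × Fin K × ℝ) (t : ℕ) (x : 𝒳) : Fin K → ℝ :=
  𝒜.qOf t (𝒜.cumEst h (t - 1)) x

/-- `π_t(x)`, the distribution of the arm pulled in round `t` if the context is `x`. -/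
def policy (h : ℕ → 𝒳 × Fin K × ℝ) (t : ℕ) (x : 𝒳) : Fin K → ℝ :=
  𝒜.piOf t (𝒜.cumEst h (t - 1)) x

/-- `ω_t = max_x min_a (1 - q_t(a | x))`. -/
def omega (h : ℕ → 𝒳 × Fin K × ℝ) (t : ℕ) : ℝ :=
  ⨆ x, ⨅ a, (1 - 𝒜.q h t x a)

theorem cumEst_eq_sum (h : ℕ → 𝒳 × Fin K × ℝ) (t : ℕ) :
    𝒜.cumEst h t = ∑ s ∈ Finset.Icc 1 t, 𝒜.thetaHat h s := by
  induction t with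
  | zero => simp [cumEst]
  | succ t ih =>
    rw [Finset.sum_Icc_succ_top (by omega), ← ih]
    simp [cumEst, thetaHat]

/-- `q_t(x)` minimizes `∑_{s<t} ⟨ℓ̂_s(x), q⟩ + ψ(q) / η_{t-1}` over the simplex,
where `ℓ̂_s(a, x) = ⟨θ̂_s, φ(a, x)⟩`. -/
theorem q_isMinOn (h : ℕ → 𝒳 × Fin K × ℝ) (t : ℕ) (x : 𝒳) :
    IsMinOn (fun q : Fin K → ℝ =>
        ∑ s ∈ Finset.Icc 1 (t - 1), ∑ a, (𝒜.thetaHat h s ⬝ᵥ 𝒜.φ a x) * q a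
          + (1 / 𝒜.η (t - 1)) * tsallis (1 / 2) q)
      (stdSimplex ℝ (Fin K)) (𝒜.q h t x) := by
  have e : (fun q : Fin K → ℝ =>
        ∑ s ∈ Finset.Icc 1 (t - 1), ∑ a, (𝒜.thetaHat h s ⬝ᵥ 𝒜.φ a x) * q a
          + (1 / 𝒜.η (t - 1)) * tsallis (1 / 2) q)
      = ftrlObjective (𝒜.η (t - 1)) (fun a => 𝒜.cumEst h (t - 1) ⬝ᵥ 𝒜.φ a x) := by
    funext q
    simp only [ftrlObjective, cumEst_eq_sum, sum_dotProduct, Finset.sum_mul]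
    rw [Finset.sum_comm]
  rw [e]
  exact ftrl_isMinOn _ _

end Learner

/-! ### Parameters -/

/-- `η̃_t = K^{1/4} / √(d t)`. -/
def etaTilde (K d t : ℕ) : ℝ := (K : ℝ) ^ (1 / 4 : ℝ) / √((d : ℝ) * t)

/-- `η_t` for contexts with finite support. The value at `t = 0` only enters `q_1`, which is the
minimizer of `ψ` (the uniform distribution) for every positive `η_0`; we put `η_0 = η_1`. -/
def etaFinite (K d : ℕ) (lam L : ℝ) (t : ℕ) : ℝ :=
  min (etaTilde K d (max t 1)) (1 / 16 * √(lam / L))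

/-- `γ_t` for contexts with finite support. -/
def gammaFinite (K d : ℕ) (lam L : ℝ) (t : ℕ) : ℝ :=
  128 * L * etaFinite K d lam L t ^ 2 / lam

/-- `η_t` for general contexts, again with `η_0 = η_1`. -/
def etaGeneral (K d : ℕ) (lam : ℝ) (t : ℕ) : ℝ :=
  min (etaTilde K d (max t 1)) (lam / 16)

/-- `γ_t` for general contexts. -/
def gammaGeneral (K d : ℕ) (lam : ℝ) (t : ℕ) : ℝ :=
  8 * etaGeneral K d lam t / lam

/-- The `1/2`-LC-Tsallis-INF learner tuned for contexts with finite support. -/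
def learnerFinite {𝒳 : Type*} [MeasurableSpace 𝒳] {K d : ℕ} (G : Measure 𝒳)
    (φ : Fin K → 𝒳 → Fin d → ℝ) (eStar : 𝒳 → Fin K → ℝ) (lam L : ℝ) : Learner 𝒳 K d :=
  ⟨G, φ, eStar, etaFinite K d lam L, gammaFinite K d lam L⟩

/-- The `1/2`-LC-Tsallis-INF learner tuned for general contexts. -/
def learnerGeneral {𝒳 : Type*} [MeasurableSpace 𝒳] {K d : ℕ} (G : Measure 𝒳)
    (φ : Fin K → 𝒳 → Fin d → ℝ) (eStar : 𝒳 → Fin K → ℝ) (lam : ℝ) : Learner 𝒳 K d :=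
  ⟨G, φ, eStar, etaGeneral K d lam, gammaGeneral K d lam⟩

/-! ### Assumptions on contexts and exploration -/

/-- A known measurable feature map into `𝒵`, for which `Σ(p)` is well defined for every policy. -/
structure FeatureMap {𝒳 : Type*} [MeasurableSpace 𝒳] {K d : ℕ} (G : Measure 𝒳)
    (φ : Fin K → 𝒳 → Fin d → ℝ) (𝒵 : Set (Fin d → ℝ)) : Prop where
  measurable : ∀ a, Measurable (φ a)
  mem : ∀ a x, φ a x ∈ 𝒵
  memLp : ∀ a i, MemLp (fun x => φ a x i) 2 G

/-- `e*` is an exploration policy with constant `λ`: the matrix `Σ(e*)` is invertible and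
`zᵀ Σ(e*)⁻¹ z ≤ 1/λ` on `𝒵`. -/
structure ExplorationPolicy {𝒳 : Type*} [MeasurableSpace 𝒳] {K d : ℕ} (G : Measure 𝒳)
    (φ : Fin K → 𝒳 → Fin d → ℝ) (𝒵 : Set (Fin d → ℝ)) (eStar : 𝒳 → Fin K → ℝ)
    (lam : ℝ) : Prop where
  measurable : Measurable eStar
  mem_simplex : ∀ x, eStar x ∈ stdSimplex ℝ (Fin K)
  pos : 0 < lam
  isUnit : IsUnit (secondMoment G φ eStar)
  le : ∀ z ∈ 𝒵, z ⬝ᵥ ((secondMoment G φ eStar)⁻¹ *ᵥ z) ≤ 1 / lam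

/-- The context space is finite (with all singletons measurable), `L ≥ |𝒳|`, and every context
has probability at least `1 / L`. -/
structure FiniteSupport {𝒳 : Type*} [MeasurableSpace 𝒳] (G : Measure 𝒳) (L : ℝ) : Prop where
  finite : Finite 𝒳
  measurableSet_singleton : ∀ x : 𝒳, MeasurableSet ({x} : Set 𝒳)
  card_le : (Nat.card 𝒳 : ℝ) ≤ L
  le_prob : ∀ x : 𝒳, 1 / L ≤ G.real {x}

/-! ### The interaction between nature and the learner -/

/-- The random variables of a bandit problem: contexts `X_t`, arms `A_t`, parameters `θ_t` and
noises `ε_t(a)`, for the rounds `t = 1, 2, …` (the index `0` is not used). -/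
structure Rounds (Ω 𝒳 : Type*) (K d : ℕ) where
  X : ℕ → Ω → 𝒳
  A : ℕ → Ω → Fin K
  θ : ℕ → Ω → Fin d → ℝ
  ε : ℕ → Fin K → Ω → ℝ

namespace Rounds

variable {Ω 𝒳 : Type*} [MeasurableSpace 𝒳] {K d : ℕ} (P : Rounds Ω 𝒳 K d)

/-- The linear loss `ℓ_t(a, x) = ⟨φ(a, x), θ_t⟩ + ε_t(a)`. -/
def loss (φ : Fin K → 𝒳 → Fin d → ℝ) (t : ℕ) (a : Fin K) (x : 𝒳) (w : Ω) : ℝ :=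
  φ a x ⬝ᵥ P.θ t w + P.ε t a w

/-- The observation `(X_t, A_t, ℓ_t(A_t, X_t))`. -/
def obs (φ : Fin K → 𝒳 → Fin d → ℝ) (w : Ω) (t : ℕ) : 𝒳 × Fin K × ℝ :=
  (P.X t w, P.A t w, P.loss φ t (P.A t w) (P.X t w) w)

/-- The `σ`-algebra `ℱ_{t-1}` generated by the observations of the rounds `1, …, t - 1`. -/
abbrev past (φ : Fin K → 𝒳 → Fin d → ℝ) (t : ℕ) : MeasurableSpace Ω :=
  ⨆ s ∈ Finset.Ico 1 t, MeasurableSpace.comap (fun w => P.obs φ w s) inferInstance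

/-- The `σ`-algebra generated by `ℱ_{t-1}` and `X_t`. -/
abbrev pastContext (φ : Fin K → 𝒳 → Fin d → ℝ) (t : ℕ) : MeasurableSpace Ω :=
  P.past φ t ⊔ MeasurableSpace.comap (P.X t) inferInstance

/-- The `σ`-algebra generated by `ℱ_{t-1}`, `X_t` and all the noises of round `t`. -/
abbrev pastContextNoise (φ : Fin K → 𝒳 → Fin d → ℝ) (t : ℕ) : MeasurableSpace Ω :=
  P.pastContext φ t ⊔ ⨆ a, MeasurableSpace.comap (P.ε t a) inferInstance

/-- `T` rounds of the learner `𝒜` against an arbitrary adaptive nature: in each round nature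
chooses `θ_t` from the past observations, the context is drawn from `G` independently of the
past, the noise is centred given the past and the context, and the arm is drawn from
`π_t(X_t)`. -/
structure IsPlayedBy [MeasurableSpace Ω] [NeZero K] (μ : Measure Ω) (𝒜 : Learner 𝒳 K d)
    (T : ℕ) : Prop where
  measurable_context : ∀ t ∈ Finset.Icc 1 T, Measurable (P.X t)
  measurable_arm : ∀ t ∈ Finset.Icc 1 T, Measurable (P.A t)
  measurable_noise : ∀ t ∈ Finset.Icc 1 T, ∀ a, Measurable (P.ε t a)
  nature : ∀ t ∈ Finset.Icc 1 T, Measurable[P.past 𝒜.φ t] (P.θ t)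
  context_law : ∀ t ∈ Finset.Icc 1 T, μ.map (P.X t) = 𝒜.G
  context_indep : ∀ t ∈ Finset.Icc 1 T,
    Indep (P.past 𝒜.φ t) (MeasurableSpace.comap (P.X t) inferInstance) μ
  noise_centred : ∀ t ∈ Finset.Icc 1 T, ∀ a, μ[P.ε t a | P.pastContext 𝒜.φ t] =ᵐ[μ] 0
  arm_law : ∀ t ∈ Finset.Icc 1 T, ∀ a,
    μ[Set.indicator {w | P.A t w = a} (fun _ => (1 : ℝ)) | P.pastContextNoise 𝒜.φ t]
      =ᵐ[μ] fun w => 𝒜.policy (P.obs 𝒜.φ w) t (P.X t w) a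

/-- `θ_t ∈ Θ`, `|⟨z, θ⟩| ≤ 1` on `𝒵 × Θ`, and all losses lie in `[-1, 1]`. -/
structure Bounded [MeasurableSpace Ω] (μ : Measure Ω) (φ : Fin K → 𝒳 → Fin d → ℝ)
    (𝒵 Θ : Set (Fin d → ℝ)) (T : ℕ) : Prop where
  mem : ∀ t ∈ Finset.Icc 1 T, ∀ w, P.θ t w ∈ Θ
  inner_le : ∀ z ∈ 𝒵, ∀ v ∈ Θ, |z ⬝ᵥ v| ≤ 1
  loss_le : ∀ᵐ w ∂μ, ∀ t ∈ Finset.Icc 1 T, ∀ a x, |P.loss φ t a x w| ≤ 1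

/-- The regret `R_T = max_ρ E[∑_{t=1}^T (ℓ_t(A_t, X_t) - ℓ_t(ρ(X_t), X_t))]`, over measurable
`ρ : 𝒳 → [K]`. (All these expectations are at most `2T` when the losses are in `[-1, 1]`.) -/
def regret [MeasurableSpace Ω] (μ : Measure Ω) (φ : Fin K → 𝒳 → Fin d → ℝ) (T : ℕ) : ℝ :=
  ⨆ ρ : {ρ : 𝒳 → Fin K // Measurable ρ},
    ∫ w, ∑ t ∈ Finset.Icc 1 T,
      (P.loss φ t (P.A t w) (P.X t w) w - P.loss φ t (ρ.1 (P.X t w)) (P.X t w) w) ∂μ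

/-- `E[∑_{t=1}^T √(d √K ω_t) / √t]`. -/
def omegaSum [MeasurableSpace Ω] [NeZero K] (μ : Measure Ω) (𝒜 : Learner 𝒳 K d) (T : ℕ) : ℝ :=
  ∫ w, ∑ t ∈ Finset.Icc 1 T, √(d * √(K : ℝ) * 𝒜.omega (P.obs 𝒜.φ w) t) / √(t : ℝ) ∂μ

end Rounds

end LinContextBandit

end

noncomputable section

namespace LinContextBandit

set_option linter.unusedSectionVars false

/-! ### Follow the regularized leader with the `1/2`-Tsallis entropy -/

/-! For a fixed context `x`, the vectors q_t(x) are iterates of a regularized leader fed with the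
estimated losses ⟨θ̂_t, φ(a, x)⟩. Its regret against the vertex ρ(x) can therefore be bounded
pathwise for each `x`, with the same estimates for every `x`, and then integrated over a fresh
context X₀ ∼ G. Given the past, the mean of θ̂_t is Σ_t⁻¹ Σ_t θ_t = θ_t, so this integrated regret
has the same expectation as the true regret of q_t (`integral_direction_dotProduct_thetaHat`).
Playing π_t instead of q_t costs at most 2γ_t per round (`integral_regret_le`).

The pathwise bound `ftrl_regret_le` is a sum of stability and penalty terms, and both shrink when
q_t(x) concentrates on one arm. The penalty does because the entropy is at most 2√(K(1 - max q))
(`neg_tsallis_le`). The stability does because losses may be shifted by the loss of the likeliest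
arm (`stability`). Integrated over X₀, the stability term contains θ̂ᵀΣ(q_t)θ̂ ≤ 2 θ̂ᵀΣ_tθ̂ ≤ 2
φᵀΣ_t⁻¹φ at the observed point, and the conditional mean of φᵀΣ_t⁻¹φ is tr(Σ_t⁻¹Σ_t) = d. A round
thus costs about η_t d√ω_t plus the increment of 1/η_t times √(Kω_t). Rates of order K^{1/4}/√(dt)
balance the two (`regret_le`).

Stability requires η_t √q |⟨φ, Σ_t⁻¹φ'⟩| ≤ 1/4, and this dictates the exploration rate. In general,
Σ_t ≥ γ_t Σ(e*) gives |⟨φ, Σ_t⁻¹φ'⟩| ≤ 1/(λγ_t), so γ_t of order η_t/λ suffices. When every context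
is an atom of mass at least 1/L, the factor √q becomes usable: q φᵀΣ_t⁻¹φ ≤ 2L, so γ_t of order
Lη_t²/λ suffices, and its sum is only logarithmic in T. The caps on η_t keep γ_t ≤ 1/2 and enter the
penalty once, in the first round. -/

theorem tsallis_half {K : ℕ} (q : Fin K → ℝ) : tsallis (1 / 2) q = 2 * (1 - ∑ a, √(q a)) := by
  simp only [tsallis, Real.sqrt_eq_rpow]
  norm_num

theorem ftrlObjective_eq {K : ℕ} (η : ℝ) (ℓ q : Fin K → ℝ) :
    ftrlObjective η ℓ q = ∑ a, ℓ a * q a + (1 / η) * (2 * (1 - ∑ a, √(q a))) := by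
  rw [ftrlObjective, tsallis_half]

theorem le_one_of_mem_stdSimplex {K : ℕ} {q : Fin K → ℝ} (hq : q ∈ stdSimplex ℝ (Fin K))
    (a : Fin K) : q a ≤ 1 := by
  rw [← hq.2]
  exact Finset.single_le_sum (fun i _ => hq.1 i) (Finset.mem_univ a)

/-- The infimum of `1 - q a` is attained at a most likely arm. -/
theorem exists_iInf_one_sub_eq {K : ℕ} [NeZero K] (q : Fin K → ℝ) :
    ∃ b, ⨅ a, (1 - q a) = 1 - q b ∧ ∀ a, q a ≤ q b := by
  obtain ⟨b, hb⟩ := exists_eq_ciInf_of_finite (f := fun a => 1 - q a)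
  refine ⟨b, hb.symm, fun a => ?_⟩
  have := ciInf_le (Set.finite_range fun a => 1 - q a).bddBelow a
  linarith

theorem iInf_one_sub_mem_Icc {K : ℕ} [NeZero K] {q : Fin K → ℝ}
    (hq : q ∈ stdSimplex ℝ (Fin K)) : ⨅ a, (1 - q a) ∈ Set.Icc (0 : ℝ) 1 := by
  obtain ⟨b, hb, -⟩ := exists_iInf_one_sub_eq q
  rw [hb]
  have h1 := le_one_of_mem_stdSimplex hq b
  have h2 := hq.1 b
  constructor <;> linarith

theorem neg_tsallis_nonneg {K : ℕ} {q : Fin K → ℝ} (hq : q ∈ stdSimplex ℝ (Fin K)) :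
    0 ≤ -tsallis (1 / 2) q := by
  have : ∑ a, q a ≤ ∑ a, √(q a) := Finset.sum_le_sum fun a _ =>
    Real.le_sqrt_of_sq_le (by nlinarith [hq.1 a, le_one_of_mem_stdSimplex hq a])
  rw [hq.2] at this
  rw [tsallis_half]
  linarith

/-- The square root at a likeliest arm is at most 1 and cancels the constant of the entropy.
Cauchy–Schwarz on the other arms, whose total mass is 1 - max q, does the rest. This is how ω_t
enters the penalty terms. -/
theorem neg_tsallis_le {K : ℕ} [NeZero K] {q : Fin K → ℝ} (hq : q ∈ stdSimplex ℝ (Fin K)) :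
    -tsallis (1 / 2) q ≤ 2 * √(K * ⨅ a, (1 - q a)) := by
  obtain ⟨b, hb, -⟩ := exists_iInf_one_sub_eq q
  have h1 : √(q b) ≤ 1 := Real.sqrt_le_one.2 (le_one_of_mem_stdSimplex hq b)
  have h2 : (∑ a ∈ Finset.univ.erase b, √(q a)) ≤ √(K * (1 - q b)) := by
    apply Real.le_sqrt_of_sq_le
    refine sq_sum_le_card_mul_sum_sq.trans ?_
    have e : ∑ a ∈ Finset.univ.erase b, √(q a) ^ 2 = 1 - q b := by
      rw [← hq.2, ← Finset.add_sum_erase _ _ (Finset.mem_univ b)]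
      simp [Real.sq_sqrt (hq.1 _)]
    rw [e]
    have h3 : (0 : ℝ) ≤ 1 - q b := by linarith [le_one_of_mem_stdSimplex hq b]
    gcongr
    exact (Finset.card_le_univ _).trans (by simp)
  rw [tsallis_half, hb, ← Finset.add_sum_erase _ _ (Finset.mem_univ b)]
  linarith

theorem lineMap_single_mem_stdSimplex {K : ℕ} {q q' : Fin K → ℝ}
    (hq : q ∈ stdSimplex ℝ (Fin K)) (hq' : q' ∈ stdSimplex ℝ (Fin K)) {s : ℝ} (h0 : 0 ≤ s)
    (h1 : s ≤ 1) : (fun a => (1 - s) * q a + s * q' a) ∈ stdSimplex ℝ (Fin K) :=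
  convex_stdSimplex ℝ (Fin K) hq hq' (by linarith) h0 (by ring)

/-- The square root has infinite slope at 0: moving mass r² onto an empty arm lowers the regularizer
by order r and changes everything else only by order r². -/
theorem ftrl_pos {K : ℕ} [NeZero K] {η : ℝ} (hη : 0 < η) (ℓ : Fin K → ℝ) (a : Fin K) :
    0 < ftrl η ℓ a := by
  have hq := ftrl_mem η ℓ
  have hmin := ftrl_isMinOn η ℓ
  set q := ftrl η ℓ
  by_contra hcon
  have ha : q a = 0 := le_antisymm (not_lt.1 hcon) (hq.1 a)
  set u : Fin K → ℝ := Pi.single a 1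
  set c : ℝ := |∑ b, ℓ b * (u b - q b) + (2 / η) * ∑ b, √(q b)|
  have hc : 0 ≤ c := abs_nonneg _
  -- Optimality of `q` will force r · (2/η) ≤ r² · c, which this `r` violates.
  obtain ⟨r, hr0, hr1, hrc⟩ : ∃ r : ℝ, 0 < r ∧ r ≤ 1 ∧ r * c < 2 / η := by
    refine ⟨min 1 (2 / η / (c + 1)), by positivity, min_le_left _ _, ?_⟩
    have h1 : min 1 (2 / η / (c + 1)) * c ≤ 2 / η / (c + 1) * c := by
      gcongr
      exact min_le_right _ _
    have h2 : 2 / η / (c + 1) * c < 2 / η / (c + 1) * (c + 1) := by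
      gcongr
      linarith
    rw [div_mul_cancel₀ _ (by positivity)] at h2
    linarith
  have hs1 : r ^ 2 ≤ 1 := by nlinarith
  have hmem := lineMap_single_mem_stdSimplex hq (single_mem_stdSimplex ℝ a) (sq_nonneg r) hs1
  have h := isMinOn_iff.1 hmin _ hmem
  rw [ftrlObjective_eq, ftrlObjective_eq] at h
  have hsum : ∑ b, ((1 - r ^ 2) * √(q b) + r * u b)
      ≤ ∑ b, √((1 - r ^ 2) * q b + r ^ 2 * u b) := by
    refine Finset.sum_le_sum fun b _ => ?_
    by_cases hb : b = a
    · subst hb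
      simp [ha, u, Real.sqrt_sq hr0.le]
    · have : u b = 0 := by simp [u, hb]
      rw [this, mul_zero, mul_zero, add_zero, add_zero]
      apply Real.le_sqrt_of_sq_le
      rw [mul_pow, Real.sq_sqrt (hq.1 b)]
      have := hq.1 b
      have : (1 - r ^ 2) ^ 2 ≤ 1 - r ^ 2 := by nlinarith [sq_nonneg r]
      gcongr
  have hu : ∑ b, u b = 1 := by simp [u]
  rw [Finset.sum_add_distrib, ← Finset.mul_sum, ← Finset.mul_sum, hu] at hsum
  have hlin : ∑ b, ℓ b * ((1 - r ^ 2) * q b + r ^ 2 * u b)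
      = ∑ b, ℓ b * q b + r ^ 2 * ∑ b, ℓ b * (u b - q b) := by
    rw [Finset.mul_sum, ← Finset.sum_add_distrib]
    exact Finset.sum_congr rfl fun b _ => by ring
  change _ ≤ ∑ b, ℓ b * ((1 - r ^ 2) * q b + r ^ 2 * u b)
    + 1 / η * (2 * (1 - ∑ b, √((1 - r ^ 2) * q b + r ^ 2 * u b))) at h
  rw [hlin] at h
  have h2 : (2 / η) * ((1 - r ^ 2) * ∑ b, √(q b) + r * 1)
      ≤ (2 / η) * ∑ b, √((1 - r ^ 2) * q b + r ^ 2 * u b) := by gcongr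
  have h3 : r * (2 / η) ≤ r ^ 2 * c := by
    have h4 : r ^ 2 * (∑ b, ℓ b * (u b - q b) + (2 / η) * ∑ b, √(q b)) ≤ r ^ 2 * c := by
      gcongr
      exact le_abs_self _
    have e1 : 1 / η * (2 * (1 - ∑ b, √(q b))) = 2 / η - 2 / η * ∑ b, √(q b) := by ring
    have e2 : 1 / η * (2 * (1 - ∑ b, √((1 - r ^ 2) * q b + r ^ 2 * u b)))
      = 2 / η - 2 / η * ∑ b, √((1 - r ^ 2) * q b + r ^ 2 * u b) := by ring
    rw [e1, e2] at h
    nlinarith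
  have h4 : r * (r * c) < r * (2 / η) := by gcongr
  nlinarith

/-- The Bregman divergence of the negative `1/2`-Tsallis entropy. -/
def tsallisDiv {K : ℕ} (p q : Fin K → ℝ) : ℝ := ∑ a, (√(p a) - √(q a)) ^ 2 / √(q a)

/-- An exact expansion around `q`: the gradient of ψ/η has coordinates -(1/η)/√(q a), and the
remainder is the Bregman divergence, as the linear part contributes none. -/
theorem ftrlObjective_sub {K : ℕ} (η : ℝ) (ℓ : Fin K → ℝ) {p q : Fin K → ℝ}
    (hp : ∀ a, 0 ≤ p a) (hq : ∀ a, 0 < q a) :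
    ftrlObjective η ℓ p - ftrlObjective η ℓ q
      = ∑ a, (ℓ a - (1 / η) / √(q a)) * (p a - q a) + (1 / η) * tsallisDiv p q := by
  rw [ftrlObjective_eq, ftrlObjective_eq, tsallisDiv]
  have : ∀ x y z w : ℝ, x + 1 / η * (2 * (1 - y)) - (z + 1 / η * (2 * (1 - w)))
      = x - z + (1 / η) * (2 * w - 2 * y) := fun x y z w => by ring
  rw [this]
  simp only [Finset.mul_sum, ← Finset.sum_sub_distrib, ← Finset.sum_add_distrib]
  refine Finset.sum_congr rfl fun a _ => ?_
  have h1 := Real.sqrt_pos.2 (hq a)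
  have h2 := Real.sq_sqrt (hq a).le
  have h3 := Real.sq_sqrt (hp a)
  generalize √(q a) = s at *
  generalize √(p a) = r at *
  rw [← h2, ← h3]
  field_simp
  ring

theorem tsallisDiv_nonneg {K : ℕ} (p q : Fin K → ℝ) : 0 ≤ tsallisDiv p q :=
  Finset.sum_nonneg fun _ _ => by positivity

/-- Since (p - q)² = (√p - √q)²(√p + √q)² ≥ (√p - √q)² q. The bound shows that the divergence is of
second order along a segment leaving `q`. -/
theorem tsallisDiv_le {K : ℕ} {p q : Fin K → ℝ} (hp : ∀ a, 0 ≤ p a) (hq : ∀ a, 0 < q a) :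
    tsallisDiv p q ≤ ∑ a, (p a - q a) ^ 2 / (q a * √(q a)) := by
  refine Finset.sum_le_sum fun a _ => ?_
  have h1 := Real.sqrt_pos.2 (hq a)
  have h2 := Real.sq_sqrt (hq a).le
  have h3 := Real.sq_sqrt (hp a)
  have h4 := Real.sqrt_nonneg (p a)
  generalize √(q a) = s at *
  generalize √(p a) = r at *
  rw [← h2, ← h3, div_le_div_iff₀ h1 (by positivity)]
  have e : (r ^ 2 - s ^ 2) ^ 2 * s - (r - s) ^ 2 * (s ^ 2 * s)
      = (r - s) ^ 2 * s * ((r + s) ^ 2 - s ^ 2) := by ring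
  have : 0 ≤ (r - s) ^ 2 * s * ((r + s) ^ 2 - s ^ 2) :=
    mul_nonneg (by positivity) (by nlinarith)
  linarith

/-- First-order optimality: the directional derivative `g` from the minimizer towards `p` is
nonnegative, so only the divergence is left in the expansion. That `g ≥ 0` is read off the objective
along the segment, which changes by at most s·g + s²·B. -/
theorem tsallisDiv_le_ftrlObjective_sub {K : ℕ} [NeZero K] {η : ℝ} (hη : 0 < η)
    (ℓ : Fin K → ℝ) {p : Fin K → ℝ} (hp : p ∈ stdSimplex ℝ (Fin K)) :
    (1 / η) * tsallisDiv p (ftrl η ℓ)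
      ≤ ftrlObjective η ℓ p - ftrlObjective η ℓ (ftrl η ℓ) := by
  have hq := ftrl_mem η ℓ
  have hmin := ftrl_isMinOn η ℓ
  have hpos := ftrl_pos hη ℓ
  set q := ftrl η ℓ
  rw [ftrlObjective_sub η ℓ hp.1 hpos]
  set g := ∑ a, (ℓ a - (1 / η) / √(q a)) * (p a - q a)
  suffices 0 ≤ g by linarith
  set B := (1 / η) * ∑ a, (p a - q a) ^ 2 / (q a * √(q a))
  have hB : 0 ≤ B := mul_nonneg (by positivity)
    (Finset.sum_nonneg fun a _ => div_nonneg (sq_nonneg _) (mul_nonneg (hq.1 a) (by positivity)))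
  have key : ∀ s : ℝ, 0 < s → s ≤ 1 → 0 ≤ g + s * B := by
    intro s hs0 hs1
    have hmem := lineMap_single_mem_stdSimplex hq hp hs0.le hs1
    have h := isMinOn_iff.1 hmin _ hmem
    have h1 := ftrlObjective_sub η ℓ hmem.1 hpos
    have h2 := tsallisDiv_le hmem.1 hpos
    have e1 : ∑ a, (ℓ a - (1 / η) / √(q a)) * ((1 - s) * q a + s * p a - q a) = s * g := by
      rw [Finset.mul_sum]
      exact Finset.sum_congr rfl fun a _ => by ring
    have e2 : ∑ a, ((1 - s) * q a + s * p a - q a) ^ 2 / (q a * √(q a))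
        = s ^ 2 * ∑ a, (p a - q a) ^ 2 / (q a * √(q a)) := by
      rw [Finset.mul_sum]
      exact Finset.sum_congr rfl fun a _ => by ring
    rw [e1] at h1
    rw [e2] at h2
    have h3 := mul_le_mul_of_nonneg_left h2 (by positivity : 0 ≤ 1 / η)
    have h4 : 0 ≤ s * (g + s * B) := by
      have : s * (g + s * B)
        = s * g + 1 / η * (s ^ 2 * ∑ a, (p a - q a) ^ 2 / (q a * √(q a))) := by ring
      rw [this]
      linarith
    exact nonneg_of_mul_nonneg_right h4 hs0
  by_contra hg
  have hg : g < 0 := not_le.1 hg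
  -- With this `s`, s·B ≤ -g/2, so g + s·B < 0; the `+ 1` avoids a division by zero when `B = 0`.
  set s := min 1 (-g / (2 * (B + 1)))
  have hs0 : 0 < s := lt_min one_pos (div_pos (by linarith) (by positivity))
  have h1 : s * B ≤ s * (2 * (B + 1)) / 2 := by nlinarith
  have h2 : s * (2 * (B + 1)) ≤ -g :=
    (le_div_iff₀ (by positivity)).1 (min_le_right 1 (-g / (2 * (B + 1))))
  linarith [key s hs0 (min_le_left _ _)]

theorem sq_sub_le_sq_sqrt_sub {x y : ℝ} (hx0 : 0 ≤ x) (hy0 : 0 ≤ y) (hx : x ≤ 1) (hy : y ≤ 1) :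
    (x - y) ^ 2 ≤ 4 * (√x - √y) ^ 2 := by
  have h1 : √x ≤ 1 := Real.sqrt_le_one.2 hx
  have h2 : √y ≤ 1 := Real.sqrt_le_one.2 hy
  have h3 := Real.sq_sqrt hx0
  have h4 := Real.sq_sqrt hy0
  have h5 := Real.sqrt_nonneg x
  have h6 := Real.sqrt_nonneg y
  generalize √x = r at *
  generalize √y = s at *
  rw [← h3, ← h4]
  have : (r ^ 2 - s ^ 2) ^ 2 = (r - s) ^ 2 * (r + s) ^ 2 := by ring
  rw [this]
  have : (r + s) ^ 2 ≤ 4 := by nlinarith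
  nlinarith [sq_nonneg (r - s)]

theorem sq_sub_le_tsallisDiv {K : ℕ} {p q : Fin K → ℝ} (hp : p ∈ stdSimplex ℝ (Fin K))
    (hq : q ∈ stdSimplex ℝ (Fin K)) (hpos : ∀ a, 0 < q a) (a : Fin K) :
    (p a - q a) ^ 2 ≤ 4 * tsallisDiv p q := by
  refine (sq_sub_le_sq_sqrt_sub (hp.1 a) (hq.1 a) (le_one_of_mem_stdSimplex hp a)
    (le_one_of_mem_stdSimplex hq a)).trans ?_
  gcongr
  have h1 : (√(p a) - √(q a)) ^ 2 ≤ (√(p a) - √(q a)) ^ 2 / √(q a) := by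
    apply le_div_self (sq_nonneg _) (Real.sqrt_pos.2 (hpos a))
    exact Real.sqrt_le_one.2 (le_one_of_mem_stdSimplex hq a)
  exact h1.trans (Finset.single_le_sum
    (f := fun a => (√(p a) - √(q a)) ^ 2 / √(q a)) (fun _ _ => by positivity)
    (Finset.mem_univ a))

/-- Adding the optimality gaps of the two minimizers, each tested at the other, cancels the
regularizer and leaves ⟨ℓ - ℓ', q' - q⟩. -/
theorem sq_ftrl_sub_ftrl_le {K : ℕ} [NeZero K] {η : ℝ} (hη : 0 < η) (ℓ ℓ' : Fin K → ℝ)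
    (a : Fin K) : (ftrl η ℓ' a - ftrl η ℓ a) ^ 2 ≤ 4 * η * ∑ b, |ℓ b - ℓ' b| := by
  have hq := ftrl_mem η ℓ
  have hq' := ftrl_mem η ℓ'
  have h1 := tsallisDiv_le_ftrlObjective_sub hη ℓ hq'
  have h2 := tsallisDiv_le_ftrlObjective_sub hη ℓ' hq
  have h3 := sq_sub_le_tsallisDiv hq' hq (ftrl_pos hη ℓ) a
  have h4 := tsallisDiv_nonneg (ftrl η ℓ) (ftrl η ℓ')
  set q := ftrl η ℓ
  set q' := ftrl η ℓ'
  have h5 : ftrlObjective η ℓ q' - ftrlObjective η ℓ q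
      + (ftrlObjective η ℓ' q - ftrlObjective η ℓ' q') ≤ ∑ b, |ℓ b - ℓ' b| := by
    have : ftrlObjective η ℓ q' - ftrlObjective η ℓ q
      + (ftrlObjective η ℓ' q - ftrlObjective η ℓ' q') = ∑ b, (ℓ b - ℓ' b) * (q' b - q b) := by
      simp only [ftrlObjective]
      have : ∀ b, (ℓ b - ℓ' b) * (q' b - q b)
        = ℓ b * q' b - ℓ b * q b + (ℓ' b * q b - ℓ' b * q' b) := fun b => by ring
      simp only [this, Finset.sum_add_distrib, Finset.sum_sub_distrib]
      ring
    rw [this]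
    refine Finset.sum_le_sum fun b _ => (le_abs_self _).trans ?_
    rw [abs_mul]
    refine mul_le_of_le_one_right (abs_nonneg _) (abs_le.2 ⟨?_, ?_⟩) <;>
    linarith [hq.1 b, hq'.1 b, le_one_of_mem_stdSimplex hq b, le_one_of_mem_stdSimplex hq' b]
  have h6 : (1 / η) * tsallisDiv q' q ≤ ∑ b, |ℓ b - ℓ' b| := by
    have : 0 ≤ (1 / η) * tsallisDiv q q' := by positivity
    linarith
  have h7 : tsallisDiv q' q ≤ η * ∑ b, |ℓ b - ℓ' b| := by
    rw [one_div, inv_mul_le_iff₀ hη] at h6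
    exact h6
  linarith

/-- The minimizer is obtained by choice, so continuity in the losses is what makes the algorithm
measurable. -/
theorem continuous_ftrl {K : ℕ} [NeZero K] {η : ℝ} (hη : 0 < η) :
    Continuous (ftrl (K := K) η) := by
  refine continuous_pi fun a => continuous_iff_continuousAt.2 fun ℓ => ?_
  rw [ContinuousAt, tendsto_iff_dist_tendsto_zero]
  have h1 : Filter.Tendsto (fun ℓ' : Fin K → ℝ => √(4 * η * ∑ b, |ℓ b - ℓ' b|)) (nhds ℓ)
      (nhds 0) := by
    have : Continuous fun ℓ' : Fin K → ℝ => √(4 * η * ∑ b, |ℓ b - ℓ' b|) := by fun_prop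
    simpa using this.tendsto ℓ
  refine squeeze_zero (fun _ => dist_nonneg) (fun ℓ' => ?_) h1
  rw [Real.dist_eq]
  exact Real.abs_le_sqrt (sq_ftrl_sub_ftrl_le hη ℓ ℓ' a)

/-! ### Stability of one step and the regret of the regularized leader -/

theorem mul_sub_sub_sq_le {η u s x : ℝ} (hη : 0 < η) (hu : 0 < u) (hx : -(1 / 2) ≤ η * u * x) :
    x * (u ^ 2 - s ^ 2) - (1 / η) * ((s - u) ^ 2 / u) ≤ 2 * η * (u ^ 2 * u * x ^ 2) := by
  have hc : 0 < η * u := by positivity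
  have e : 2 * η * (u ^ 2 * u * x ^ 2) - (x * (u ^ 2 - s ^ 2) - (1 / η) * ((s - u) ^ 2 / u))
      = (2 * (η * u) ^ 2 * (u * x) ^ 2 + (η * u * x) * (s ^ 2 - u ^ 2) + (s - u) ^ 2)
        / (η * u) := by
    field_simp
    ring
  have h : 0 ≤ 2 * (η * u) ^ 2 * (u * x) ^ 2 + (η * u * x) * (s ^ 2 - u ^ 2) + (s - u) ^ 2 := by
    have e : 2 * (η * u) ^ 2 * (u * x) ^ 2 + (η * u * x) * (s ^ 2 - u ^ 2) + (s - u) ^ 2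
        = (s - u) ^ 2 * (1 / 2 + η * u * x) + (1 / 2) * ((s - u) + 2 * (u * (η * u * x))) ^ 2 := by
      ring
    rw [e]
    have : 0 ≤ 1 / 2 + η * u * x := by linarith
    positivity
  have := div_nonneg h hc.le
  linarith

/-- Both `p` and `q` have total mass 1, so a constant may be subtracted from all losses; the rest is
a coordinatewise quadratic inequality in √(p a) and √(q a). -/
theorem stability_shift {K : ℕ} {η : ℝ} (hη : 0 < η) {p q ℓ : Fin K → ℝ} {c : ℝ}
    (hp : p ∈ stdSimplex ℝ (Fin K)) (hq : q ∈ stdSimplex ℝ (Fin K)) (hpos : ∀ a, 0 < q a)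
    (hℓ : ∀ a, -(1 / 2) ≤ η * √(q a) * (ℓ a - c)) :
    ∑ a, ℓ a * (q a - p a) - (1 / η) * tsallisDiv p q
      ≤ 2 * η * ∑ a, q a * √(q a) * (ℓ a - c) ^ 2 := by
  have e : ∑ a, ℓ a * (q a - p a) = ∑ a, (ℓ a - c) * (q a - p a) := by
    simp only [sub_mul, Finset.sum_sub_distrib, ← Finset.mul_sum, hq.2, hp.2]
    ring
  rw [e, tsallisDiv, Finset.mul_sum, Finset.mul_sum, ← Finset.sum_sub_distrib]
  refine Finset.sum_le_sum fun a _ => ?_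
  have := mul_sub_sub_sq_le (s := √(p a)) hη (Real.sqrt_pos.2 (hpos a)) (hℓ a)
  rwa [Real.sq_sqrt (hpos a).le, Real.sq_sqrt (hp.1 a)] at this

/-- One step of the follow-the-regularized-leader analysis: the stability term is small when most
of the mass sits on one arm. -/
theorem stability {K : ℕ} [NeZero K] {η : ℝ} (hη : 0 < η) {p q ℓ : Fin K → ℝ}
    (hp : p ∈ stdSimplex ℝ (Fin K)) (hq : q ∈ stdSimplex ℝ (Fin K)) (hpos : ∀ a, 0 < q a)
    (hℓ : ∀ a, η * √(q a) * |ℓ a| ≤ 1 / 4) :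
    ∑ a, ℓ a * (q a - p a) - (1 / η) * tsallisDiv p q
      ≤ 4 * η * √(⨅ a, (1 - q a)) * ∑ a, q a * ℓ a ^ 2 := by
  obtain ⟨b, hb, hmax⟩ := exists_iInf_one_sub_eq q
  have hqb := le_one_of_mem_stdSimplex hq b
  rw [hb]
  have habs : ∀ a, -(1 / 4) ≤ η * √(q a) * ℓ a ∧ η * √(q a) * ℓ a ≤ 1 / 4 := fun a => by
    rw [← abs_le, abs_mul, abs_of_nonneg (by positivity)]
    exact hℓ a
  have hV : 0 ≤ ∑ a, q a * ℓ a ^ 2 := Finset.sum_nonneg fun a _ =>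
    mul_nonneg (hq.1 a) (sq_nonneg _)
  -- If arm `b` has at least half of the mass, shifting by `ℓ b` removes its own term, and the other
  -- arms satisfy √(q a) ≤ √(1 - q b). The shift keeps the lower bound -1/2 because two terms of
  -- size at most 1/4 add up, by maximality of `q b`. Otherwise √(1 - q b) ≥ 1/2 and no shift is
  -- needed.
  rcases le_or_gt (1 / 2) (q b) with hhalf | hhalf
  · refine (stability_shift (c := ℓ b) hη hp hq hpos fun a => ?_).trans ?_
    · have h1 := (habs a).1
      have h2 : η * √(q a) * |ℓ b| ≤ η * √(q b) * |ℓ b| := by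
        gcongr
        exact hmax a
      have h3 : η * √(q a) * ℓ b ≤ η * √(q a) * |ℓ b| := by
        gcongr
        exact le_abs_self _
      rw [mul_sub]
      linarith [hℓ b]
    · have h1 : ∑ a, q a * √(q a) * (ℓ a - ℓ b) ^ 2 ≤ √(1 - q b) * (2 * ∑ a, q a * ℓ a ^ 2) := by
        rw [← Finset.add_sum_erase _ _ (Finset.mem_univ b)]
        have h2 : ∀ a ∈ Finset.univ.erase b, q a * √(q a) * (ℓ a - ℓ b) ^ 2
            ≤ √(1 - q b) * (2 * (q a * ℓ a ^ 2) + 2 * ℓ b ^ 2 * q a) := by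
          intro a ha
          have h3 : q a ≤ 1 - q b := by
            have : q a ≤ ∑ a ∈ Finset.univ.erase b, q a :=
              Finset.single_le_sum (fun i _ => hq.1 i) ha
            have e := Finset.add_sum_erase Finset.univ q (Finset.mem_univ b)
            rw [hq.2] at e
            linarith
          have h4 : √(q a) ≤ √(1 - q b) := Real.sqrt_le_sqrt h3
          have h5 : q a * (ℓ a - ℓ b) ^ 2 ≤ 2 * (q a * ℓ a ^ 2) + 2 * ℓ b ^ 2 * q a := by
            nlinarith [mul_nonneg (hq.1 a) (sq_nonneg (ℓ a + ℓ b))]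
          calc q a * √(q a) * (ℓ a - ℓ b) ^ 2 = √(q a) * (q a * (ℓ a - ℓ b) ^ 2) := by ring
            _ ≤ _ := mul_le_mul h4 h5 (mul_nonneg (hq.1 a) (sq_nonneg _)) (Real.sqrt_nonneg _)
        have h3 := Finset.sum_le_sum h2
        rw [← Finset.mul_sum, Finset.sum_add_distrib, ← Finset.mul_sum, ← Finset.mul_sum] at h3
        have e := Finset.add_sum_erase Finset.univ q (Finset.mem_univ b)
        rw [hq.2] at e
        have e' : ∑ a ∈ Finset.univ.erase b, q a = 1 - q b := by linarith
        rw [e'] at h3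
        rw [sub_self]
        -- As `q b ≥ 1/2`, the shift by `ℓ b` is paid for by the term of arm `b` in the sum on the
        -- right.
        have h4 : 2 * ℓ b ^ 2 * (1 - q b) ≤ 2 * (q b * ℓ b ^ 2) := by
          nlinarith [sq_nonneg (ℓ b)]
        rw [← Finset.add_sum_erase Finset.univ (fun a => q a * ℓ a ^ 2) (Finset.mem_univ b)]
        have h5 := mul_le_mul_of_nonneg_left h4 (Real.sqrt_nonneg (1 - q b))
        nlinarith
      calc _ ≤ 2 * η * (√(1 - q b) * (2 * ∑ a, q a * ℓ a ^ 2)) := by gcongr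
        _ = _ := by ring
  · refine (stability_shift (c := 0) hη hp hq hpos fun a => ?_).trans ?_
    · rw [sub_zero]
      linarith [(habs a).1]
    · have h1 : 1 / 2 ≤ √(1 - q b) := Real.le_sqrt_of_sq_le (by linarith)
      have h2 : ∑ a, q a * √(q a) * (ℓ a - 0) ^ 2 ≤ ∑ a, q a * ℓ a ^ 2 := by
        refine Finset.sum_le_sum fun a _ => ?_
        rw [sub_zero]
        have := hq.1 a
        gcongr
        exact mul_le_of_le_one_right this (Real.sqrt_le_one.2 (le_one_of_mem_stdSimplex hq a))
      calc _ ≤ 2 * η * ∑ a, q a * ℓ a ^ 2 := by gcongr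
        _ = 4 * η * (1 / 2) * ∑ a, q a * ℓ a ^ 2 := by ring
        _ ≤ _ := by gcongr

/-- The factor in front of the entropy of the `t`-th iterate in the regret of the regularized
leader. -/
def penaltyFactor (η : ℕ → ℝ) : ℕ → ℝ
  | 0 => 1 / η 0
  | t + 1 => 1 / η (t + 1) - 1 / η t

/-- Each round is compared with the next iterate; the divergence in `stability` is absorbed by the
optimality gap of the current iterate, and the objectives telescope. What does not telescope is the
change of 1/η in front of the entropy. -/
theorem ftrl_regret_le {K : ℕ} [NeZero K] {η : ℕ → ℝ} (hη : ∀ t, 0 < η t)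
    (cum : ℕ → Fin K → ℝ) (h0 : cum 0 = 0) (T : ℕ)
    (hsmall : ∀ t < T, ∀ a,
      η t * √(ftrl (η t) (cum t) a) * |cum (t + 1) a - cum t a| ≤ 1 / 4) (b : Fin K) :
    ∑ t ∈ Finset.range T, ∑ a, (cum (t + 1) a - cum t a)
        * (ftrl (η t) (cum t) a - Pi.single (M := fun _ => ℝ) b 1 a)
      ≤ ∑ t ∈ Finset.range T, (4 * η t * √(⨅ a, (1 - ftrl (η t) (cum t) a))
          * ∑ a, ftrl (η t) (cum t) a * (cum (t + 1) a - cum t a) ^ 2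
        + penaltyFactor η t * -tsallis (1 / 2) (ftrl (η t) (cum t))) := by
  set q : ℕ → Fin K → ℝ := fun t => ftrl (η t) (cum t) with hqdef
  change ∀ t < T, ∀ a, η t * √(q t a) * |cum (t + 1) a - cum t a| ≤ 1 / 4 at hsmall
  change ∑ t ∈ Finset.range T, ∑ a, (cum (t + 1) a - cum t a)
        * (q t a - Pi.single (M := fun _ => ℝ) b 1 a)
      ≤ ∑ t ∈ Finset.range T, (4 * η t * √(⨅ a, (1 - q t a))
          * ∑ a, q t a * (cum (t + 1) a - cum t a) ^ 2
        + penaltyFactor η t * -tsallis (1 / 2) (q t))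
  set stab : ℕ → ℝ := fun t => 4 * η t * √(⨅ a, (1 - q t a))
          * ∑ a, q t a * (cum (t + 1) a - cum t a) ^ 2 with hstab
  have step : ∀ t < T, ∀ p ∈ stdSimplex ℝ (Fin K),
      ∑ a, (cum (t + 1) a - cum t a) * (q t a - p a)
        ≤ stab t + (ftrlObjective (η t) (cum t) p - ftrlObjective (η t) (cum t) (q t)) := by
    intro t ht p hp
    have h1 := stability (hη t) hp (ftrl_mem (η t) (cum t)) (ftrl_pos (hη t) (cum t))
      (ℓ := fun a => cum (t + 1) a - cum t a) (hsmall t ht)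
    have h2 := tsallisDiv_le_ftrlObjective_sub (hη t) (cum t) hp
    simp only [hstab, hqdef]
    linarith
  -- The induction stops before the last round, which is compared directly with the vertex `b`. This
  -- way 1/η T never enters.
  have main : ∀ n < T, ∑ t ∈ Finset.range n, ∑ a, (cum (t + 1) a - cum t a) * q t a
      ≤ ftrlObjective (η n) (cum n) (q n) + ∑ t ∈ Finset.range n, stab t
        + ∑ t ∈ Finset.range (n + 1), penaltyFactor η t * -tsallis (1 / 2) (q t) := by
    intro n
    induction n with
    | zero =>
      intro _
      simp [ftrlObjective, h0, penaltyFactor]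
    | succ n ih =>
      intro hn
      have h1 := ih (by omega)
      have h2 := step n (by omega) (q (n + 1)) (ftrl_mem _ _)
      rw [Finset.sum_range_succ, Finset.sum_range_succ stab,
        Finset.sum_range_succ (fun t => penaltyFactor η t * -tsallis (1 / 2) (q t)) (n + 1)]
      simp only [mul_sub, Finset.sum_sub_distrib] at h2
      have e : ftrlObjective (η (n + 1)) (cum (n + 1)) (q (n + 1))
          + penaltyFactor η (n + 1) * -tsallis (1 / 2) (q (n + 1))
          = ftrlObjective (η n) (cum n) (q (n + 1))
            + ∑ a, (cum (n + 1) a - cum n a) * q (n + 1) a := by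
        simp only [ftrlObjective, penaltyFactor, sub_mul, Finset.sum_sub_distrib]
        ring
      linarith
  rw [Finset.sum_add_distrib]
  cases T with
  | zero => simp
  | succ n =>
    have h1 := main n (by omega)
    have h2 := step n (by omega) _ (single_mem_stdSimplex ℝ b)
    -- The regularizer vanishes at a vertex, so the comparator pays no entropy.
    have e : ftrlObjective (η n) (cum n) (Pi.single b 1) = cum n b := by
      rw [ftrlObjective_eq]
      have : ∀ a, √((Pi.single b 1 : Fin K → ℝ) a) = (Pi.single b 1 : Fin K → ℝ) a := by
        intro a
        by_cases h : a = b
        · subst h; simp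
        · simp [h]
      rw [Finset.sum_congr rfl fun a _ => this a]
      simp [Pi.single_apply]
    have e2 : ∀ t, ∑ a, (cum (t + 1) a - cum t a) * (Pi.single b 1 : Fin K → ℝ) a
        = cum (t + 1) b - cum t b := fun t => by simp [Pi.single_apply]
    have e3 : ∀ t, ∑ a, (cum (t + 1) a - cum t a) * (q t a - (Pi.single b 1 : Fin K → ℝ) a)
        = ∑ a, (cum (t + 1) a - cum t a) * q t a - (cum (t + 1) b - cum t b) := fun t => by
      simp only [mul_sub, Finset.sum_sub_distrib, e2]
    rw [e3, e] at h2
    rw [Finset.sum_congr rfl fun t _ => e3 t, Finset.sum_sub_distrib,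
      Finset.sum_range_sub (fun t => cum t b), h0, Finset.sum_range_succ,
      Finset.sum_range_succ stab]
    simp only [Pi.zero_apply, sub_zero]
    linarith

/-! ### Quadratic forms -/

theorem sq_dotProduct_mulVec_le {d : ℕ} {M : Matrix (Fin d) (Fin d) ℝ} (hsymm : Mᵀ = M)
    (hpos : ∀ u, 0 ≤ u ⬝ᵥ M *ᵥ u) (u v : Fin d → ℝ) :
    (u ⬝ᵥ M *ᵥ v) ^ 2 ≤ (u ⬝ᵥ M *ᵥ u) * (v ⬝ᵥ M *ᵥ v) := by
  have h := LinearMap.BilinForm.apply_mul_apply_le_of_forall_zero_le (Matrix.toBilin' M)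
    (fun u => by simpa [Matrix.toBilin'_apply'] using hpos u) u v
  simp only [Matrix.toBilin'_apply'] at h
  have e : v ⬝ᵥ M *ᵥ u = u ⬝ᵥ M *ᵥ v := by
    conv_lhs => rw [← hsymm]
    rw [Matrix.mulVec_transpose, dotProduct_comm, Matrix.dotProduct_mulVec]
  rwa [e, ← sq] at h

theorem mulVec_inv_mulVec {d : ℕ} {M : Matrix (Fin d) (Fin d) ℝ} (hM : IsUnit M)
    (z : Fin d → ℝ) : M *ᵥ (M⁻¹ *ᵥ z) = z := by
  rw [Matrix.mulVec_mulVec, Matrix.mul_nonsing_inv _ ((Matrix.isUnit_iff_isUnit_det _).1 hM),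
    Matrix.one_mulVec]

theorem dotProduct_inv_mulVec_eq {d : ℕ} {M : Matrix (Fin d) (Fin d) ℝ} (hM : IsUnit M)
    (hsymm : Mᵀ = M) (z y : Fin d → ℝ) :
    z ⬝ᵥ M⁻¹ *ᵥ y = (M⁻¹ *ᵥ z) ⬝ᵥ M *ᵥ (M⁻¹ *ᵥ y) := by
  rw [mulVec_inv_mulVec hM, Matrix.dotProduct_mulVec, ← Matrix.mulVec_transpose,
    Matrix.transpose_nonsing_inv, hsymm]

theorem dotProduct_inv_mulVec_nonneg {d : ℕ} {M : Matrix (Fin d) (Fin d) ℝ} (hM : IsUnit M)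
    (hsymm : Mᵀ = M) (hpos : ∀ u, 0 ≤ u ⬝ᵥ M *ᵥ u) (z : Fin d → ℝ) :
    0 ≤ z ⬝ᵥ M⁻¹ *ᵥ z := by
  rw [dotProduct_inv_mulVec_eq hM hsymm]
  exact hpos _

theorem sq_dotProduct_inv_mulVec_le {d : ℕ} {M : Matrix (Fin d) (Fin d) ℝ} (hM : IsUnit M)
    (hsymm : Mᵀ = M) (hpos : ∀ u, 0 ≤ u ⬝ᵥ M *ᵥ u) (z y : Fin d → ℝ) :
    (z ⬝ᵥ M⁻¹ *ᵥ y) ^ 2 ≤ (z ⬝ᵥ M⁻¹ *ᵥ z) * (y ⬝ᵥ M⁻¹ *ᵥ y) := by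
  simp only [dotProduct_inv_mulVec_eq hM hsymm]
  exact sq_dotProduct_mulVec_le hsymm hpos _ _

/-- Cauchy–Schwarz for the form of `M`, applied to `u` and `M⁻¹ z`. -/
theorem sq_dotProduct_le_inv_mul {d : ℕ} {M : Matrix (Fin d) (Fin d) ℝ} (hM : IsUnit M)
    (hsymm : Mᵀ = M) (hpos : ∀ u, 0 ≤ u ⬝ᵥ M *ᵥ u) (z u : Fin d → ℝ) :
    (z ⬝ᵥ u) ^ 2 ≤ (z ⬝ᵥ M⁻¹ *ᵥ z) * (u ⬝ᵥ M *ᵥ u) := by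
  have h := sq_dotProduct_mulVec_le hsymm hpos u (M⁻¹ *ᵥ z)
  rwa [mulVec_inv_mulVec hM, dotProduct_comm u z, dotProduct_comm (M⁻¹ *ᵥ z) z, mul_comm] at h

/-- A vector in the kernel of `M` is isotropic for `E`, hence zero, since `E` is invertible and
nonnegative. -/
theorem isUnit_of_mul_le {d : ℕ} {E M : Matrix (Fin d) (Fin d) ℝ} (hE : IsUnit E)
    (hEsymm : Eᵀ = E) (hEpos : ∀ u, 0 ≤ u ⬝ᵥ E *ᵥ u) {γ : ℝ} (hγ : 0 < γ)
    (h : ∀ u, γ * (u ⬝ᵥ E *ᵥ u) ≤ u ⬝ᵥ M *ᵥ u) : IsUnit M := by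
  rw [← Matrix.mulVec_injective_iff_isUnit]
  refine (injective_iff_map_eq_zero (Matrix.mulVecLin M)).2 fun u hu => ?_
  have h1 : M *ᵥ u = 0 := hu
  have h2 := h u
  rw [h1, dotProduct_zero] at h2
  have h3 : u ⬝ᵥ E *ᵥ u = 0 := le_antisymm (nonpos_of_mul_nonpos_right h2 hγ) (hEpos u)
  have h4 := sq_dotProduct_le_inv_mul hE hEsymm hEpos u u
  rw [h3, mul_zero] at h4
  exact dotProduct_self_eq_zero.1 (pow_eq_zero_iff two_ne_zero |>.1 (le_antisymm h4 (sq_nonneg _)))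

/-- Inversion reverses the order of matrices. With v = M⁻¹z and m = zᵀM⁻¹z, one has m² = (z·v)² ≤ b
· vᵀEv and γ · vᵀEv ≤ m; cancelling `m` gives the bound. -/
theorem dotProduct_inv_mulVec_le {d : ℕ} {E M : Matrix (Fin d) (Fin d) ℝ} (hE : IsUnit E)
    (hEsymm : Eᵀ = E) (hEpos : ∀ u, 0 ≤ u ⬝ᵥ E *ᵥ u) (hMsymm : Mᵀ = M) {γ b : ℝ} (hγ : 0 < γ)
    (h : ∀ u, γ * (u ⬝ᵥ E *ᵥ u) ≤ u ⬝ᵥ M *ᵥ u) (z : Fin d → ℝ) (hz : z ⬝ᵥ E⁻¹ *ᵥ z ≤ b) :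
    z ⬝ᵥ M⁻¹ *ᵥ z ≤ b / γ := by
  have hM := isUnit_of_mul_le hE hEsymm hEpos hγ h
  have h1 := h (M⁻¹ *ᵥ z)
  rw [← dotProduct_inv_mulVec_eq hM hMsymm] at h1
  have h2 := sq_dotProduct_le_inv_mul hE hEsymm hEpos z (M⁻¹ *ᵥ z)
  have h3 := dotProduct_inv_mulVec_nonneg hE hEsymm hEpos z
  have h4 := hEpos (M⁻¹ *ᵥ z)
  generalize z ⬝ᵥ M⁻¹ *ᵥ z = m at *
  generalize M⁻¹ *ᵥ z ⬝ᵥ E *ᵥ (M⁻¹ *ᵥ z) = s at *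
  rw [le_div_iff₀ hγ]
  rcases le_or_gt m 0 with hm | hm
  · nlinarith
  · have : m * (m * γ) ≤ m * b := by nlinarith
    exact le_of_mul_le_mul_left this hm

/-- If `M` dominates the rank-one form of `z` with weight `c`, testing at M⁻¹z gives c·m² ≤ m for m
= zᵀM⁻¹z. -/
theorem mul_dotProduct_inv_mulVec_le_one {d : ℕ} {M : Matrix (Fin d) (Fin d) ℝ} (hM : IsUnit M)
    (hMsymm : Mᵀ = M) (hpos : ∀ u, 0 ≤ u ⬝ᵥ M *ᵥ u) {c : ℝ} (z : Fin d → ℝ)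
    (h : ∀ u, c * (z ⬝ᵥ u) ^ 2 ≤ u ⬝ᵥ M *ᵥ u) : c * (z ⬝ᵥ M⁻¹ *ᵥ z) ≤ 1 := by
  have h1 := h (M⁻¹ *ᵥ z)
  rw [← dotProduct_inv_mulVec_eq hM hMsymm] at h1
  have h2 := dotProduct_inv_mulVec_nonneg hM hMsymm hpos z
  rcases h2.eq_or_lt with h3 | h3
  · rw [← h3]; simp
  · have : (z ⬝ᵥ M⁻¹ *ᵥ z) * (c * (z ⬝ᵥ M⁻¹ *ᵥ z)) ≤ (z ⬝ᵥ M⁻¹ *ᵥ z) * 1 := by nlinarith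
    exact le_of_mul_le_mul_left this h3

/-! ### The second moment matrix of a policy -/

/-- A measurable map into the probability simplex. -/
structure IsPolicy {𝒳 : Type*} [MeasurableSpace 𝒳] {K : ℕ} (p : 𝒳 → Fin K → ℝ) : Prop where
  measurable : Measurable p
  mem : ∀ x, p x ∈ stdSimplex ℝ (Fin K)

section SecondMoment

variable {𝒳 : Type*} [MeasurableSpace 𝒳] {K d : ℕ} {G : Measure 𝒳}
  {φ : Fin K → 𝒳 → Fin d → ℝ} {𝒵 : Set (Fin d → ℝ)} {p : 𝒳 → Fin K → ℝ}

theorem integrable_secondMoment_term (hφ : FeatureMap G φ 𝒵) (hp : IsPolicy p) (a : Fin K)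
    (i j : Fin d) : Integrable (fun x => p x a * (φ a x i * φ a x j)) G := by
  refine Integrable.bdd_mul (c := 1) ((hφ.memLp a i).integrable_mul (hφ.memLp a j))
    ((measurable_pi_apply a).comp hp.measurable).aestronglyMeasurable
    (Filter.Eventually.of_forall fun x => ?_)
  rw [Real.norm_of_nonneg ((hp.mem x).1 a)]
  exact le_one_of_mem_stdSimplex (hp.mem x) a

theorem sum_mul_dotProduct_eq (w : Fin K → ℝ) (f : Fin K → Fin d → ℝ) (u v : Fin d → ℝ) :
    ∑ a, w a * ((f a ⬝ᵥ u) * (f a ⬝ᵥ v))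
      = ∑ i, ∑ j, u i * v j * ∑ a, w a * (f a i * f a j) := by
  have : ∀ a, w a * ((f a ⬝ᵥ u) * (f a ⬝ᵥ v))
      = ∑ i, ∑ j, u i * v j * (w a * (f a i * f a j)) := by
    intro a
    rw [dotProduct, dotProduct, Finset.sum_mul_sum, Finset.mul_sum]
    refine Finset.sum_congr rfl fun i _ => ?_
    rw [Finset.mul_sum]
    exact Finset.sum_congr rfl fun j _ => by ring
  simp only [this, Finset.mul_sum]
  rw [Finset.sum_comm]
  refine Finset.sum_congr rfl fun i _ => ?_
  rw [Finset.sum_comm]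

theorem integrable_secondMoment_entry (hφ : FeatureMap G φ 𝒵) (hp : IsPolicy p)
    (i j : Fin d) : Integrable (fun x => ∑ a, p x a * (φ a x i * φ a x j)) G :=
  integrable_finsetSum _ fun a _ => integrable_secondMoment_term hφ hp a i j

theorem integrable_sum_mul_dotProduct (hφ : FeatureMap G φ 𝒵) (hp : IsPolicy p)
    (u v : Fin d → ℝ) :
    Integrable (fun x => ∑ a, p x a * ((φ a x ⬝ᵥ u) * (φ a x ⬝ᵥ v))) G := by
  simp only [sum_mul_dotProduct_eq]
  exact integrable_finsetSum _ fun i _ => integrable_finsetSum _ fun j _ =>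
    (integrable_secondMoment_entry hφ hp i j).const_mul _

theorem dotProduct_secondMoment_mulVec (hφ : FeatureMap G φ 𝒵) (hp : IsPolicy p)
    (u v : Fin d → ℝ) : u ⬝ᵥ secondMoment G φ p *ᵥ v
      = ∫ x, ∑ a, p x a * ((φ a x ⬝ᵥ u) * (φ a x ⬝ᵥ v)) ∂G := by
  simp only [sum_mul_dotProduct_eq]
  rw [integral_finsetSum _ fun i _ => integrable_finsetSum _ fun j _ =>
    (integrable_secondMoment_entry hφ hp i j).const_mul _, dotProduct]
  refine Finset.sum_congr rfl fun i _ => ?_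
  rw [integral_finsetSum _ fun j _ => (integrable_secondMoment_entry hφ hp i j).const_mul _,
    Matrix.mulVec, dotProduct, Finset.mul_sum]
  refine Finset.sum_congr rfl fun j _ => ?_
  rw [integral_const_mul]
  simp only [secondMoment, Matrix.of_apply]
  ring

theorem secondMoment_transpose : (secondMoment G φ p)ᵀ = secondMoment G φ p := by
  ext i j
  simp only [secondMoment, Matrix.transpose_apply, Matrix.of_apply]
  congr 1
  funext x
  exact Finset.sum_congr rfl fun a _ => by ring

theorem secondMoment_nonneg (hφ : FeatureMap G φ 𝒵) (hp : IsPolicy p) (u : Fin d → ℝ) :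
    0 ≤ u ⬝ᵥ secondMoment G φ p *ᵥ u := by
  rw [dotProduct_secondMoment_mulVec hφ hp]
  exact integral_nonneg fun x => Finset.sum_nonneg fun a _ =>
    mul_nonneg ((hp.mem x).1 a) (mul_self_nonneg _)

theorem integral_quadratic (hφ : FeatureMap G φ 𝒵) (hp : IsPolicy p) (N : Fin d → Fin d → ℝ) :
    ∫ x, ∑ i, ∑ j, N i j * ∑ a, p x a * (φ a x i * φ a x j) ∂G
      = ∑ i, ∑ j, N i j * secondMoment G φ p i j := by
  rw [integral_finsetSum _ fun i _ => integrable_finsetSum _ fun j _ =>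
    (integrable_secondMoment_entry hφ hp i j).const_mul _]
  refine Finset.sum_congr rfl fun i _ => ?_
  rw [integral_finsetSum _ fun j _ => (integrable_secondMoment_entry hφ hp i j).const_mul _]
  refine Finset.sum_congr rfl fun j _ => ?_
  rw [integral_const_mul]
  rfl

/-- The left-hand side is the trace of Σ(p)⁻¹Σ(p). This is the source of the factor `d` in the
regret. -/
theorem integral_sum_mul_dotProduct_inv (hφ : FeatureMap G φ 𝒵) (hp : IsPolicy p)
    (hu : IsUnit (secondMoment G φ p)) :
    ∫ x, ∑ a, p x a * (φ a x ⬝ᵥ (secondMoment G φ p)⁻¹ *ᵥ φ a x) ∂G = d := by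
  set M := secondMoment G φ p with hM
  have e : ∀ x, ∑ a, p x a * (φ a x ⬝ᵥ M⁻¹ *ᵥ φ a x)
      = ∑ i, ∑ j, M⁻¹ i j * ∑ a, p x a * (φ a x i * φ a x j) := by
    intro x
    simp only [dotProduct, Matrix.mulVec, Finset.mul_sum]
    rw [Finset.sum_comm]
    refine Finset.sum_congr rfl fun i _ => ?_
    rw [Finset.sum_comm]
    exact Finset.sum_congr rfl fun j _ => Finset.sum_congr rfl fun a _ => by ring
  simp only [e]
  refine (integral_quadratic hφ hp (fun i j => M⁻¹ i j)).trans ?_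
  have e2 : ∀ i, ∑ j, M⁻¹ i j * secondMoment G φ p i j = (M⁻¹ * M) i i := by
    intro i
    rw [Matrix.mul_apply]
    refine Finset.sum_congr rfl fun j _ => ?_
    rw [← Matrix.transpose_apply M i j, hM, secondMoment_transpose]
  simp only [e2]
  rw [Matrix.nonsing_inv_mul _ ((Matrix.isUnit_iff_isUnit_det _).1 hu)]
  simp

theorem ExplorationPolicy.isPolicy {lam : ℝ} (h : ExplorationPolicy G φ 𝒵 p lam) : IsPolicy p :=
  ⟨h.measurable, h.mem_simplex⟩

/-- Averaging zᵀΣ(e*)⁻¹z ≤ 1/λ under e* gives d ≤ 1/λ. It serves to absorb an additive constant into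
√(KL/λ). -/
theorem ExplorationPolicy.le_one [IsProbabilityMeasure G] [NeZero d] {lam : ℝ}
    (hφ : FeatureMap G φ 𝒵) (h : ExplorationPolicy G φ 𝒵 p lam) : lam ≤ 1 := by
  have h1 := integral_sum_mul_dotProduct_inv hφ h.isPolicy h.isUnit
  have h2 : ∫ x, ∑ a, p x a * (φ a x ⬝ᵥ (secondMoment G φ p)⁻¹ *ᵥ φ a x) ∂G
      ≤ ∫ _, 1 / lam ∂G := by
    refine integral_mono_of_nonneg (Filter.Eventually.of_forall fun x => ?_)
      (integrable_const _) (Filter.Eventually.of_forall fun x => ?_)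
    · exact Finset.sum_nonneg fun a _ => mul_nonneg ((h.mem_simplex x).1 a)
        (dotProduct_inv_mulVec_nonneg h.isUnit secondMoment_transpose
          (secondMoment_nonneg hφ h.isPolicy) _)
    · calc _ ≤ ∑ a, p x a * (1 / lam) := Finset.sum_le_sum fun a _ =>
            mul_le_mul_of_nonneg_left (h.le _ (hφ.mem a x)) ((h.mem_simplex x).1 a)
        _ = 1 / lam := by rw [← Finset.sum_mul, (h.mem_simplex x).2, one_mul]
  rw [h1] at h2
  simp only [integral_const, probReal_univ, smul_eq_mul, one_mul] at h2
  have h3 : (1 : ℝ) ≤ d := by exact_mod_cast NeZero.one_le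
  have h4 : 1 ≤ 1 / lam := h3.trans h2
  rwa [le_div_iff₀ h.pos, one_mul] at h4

end SecondMoment

/-! ### Learners -/

namespace Learner

variable {𝒳 : Type*} [MeasurableSpace 𝒳] {K d : ℕ} [NeZero K]

/-- The assumptions on the features, the exploration policy and the rates which make the
estimates of a learner well behaved. -/
structure Tuned (𝒜 : Learner 𝒳 K d) (𝒵 : Set (Fin d → ℝ)) (lam : ℝ) : Prop where
  feature : FeatureMap 𝒜.G 𝒜.φ 𝒵
  explore : ExplorationPolicy 𝒜.G 𝒜.φ 𝒵 𝒜.eStar lam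
  η_pos : ∀ t, 0 < 𝒜.η t
  γ_pos : ∀ t, 0 < 𝒜.γ t
  γ_le : ∀ t, 𝒜.γ t ≤ 1 / 2

/-- The matrix `Σ_t` when the estimates of the rounds before `t` add up to `S`. -/
def sigmaOf (𝒜 : Learner 𝒳 K d) (t : ℕ) (S : Fin d → ℝ) : Matrix (Fin d) (Fin d) ℝ :=
  secondMoment 𝒜.G 𝒜.φ (𝒜.piOf t S)

namespace Tuned

variable {𝒜 : Learner 𝒳 K d} {𝒵 : Set (Fin d → ℝ)} {lam : ℝ}

theorem measurable_qOf (h : 𝒜.Tuned 𝒵 lam) (t : ℕ) :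
    Measurable fun z : (Fin d → ℝ) × 𝒳 => 𝒜.qOf t z.1 z.2 := by
  refine (continuous_ftrl (h.η_pos (t - 1))).measurable.comp (measurable_pi_lambda _ fun a => ?_)
  have := h.feature.measurable a
  simp only [dotProduct]
  fun_prop

theorem measurable_piOf (h : 𝒜.Tuned 𝒵 lam) (t : ℕ) (a : Fin K) :
    Measurable fun z : (Fin d → ℝ) × 𝒳 => 𝒜.piOf t z.1 z.2 a := by
  have h1 := (measurable_pi_apply a).comp (h.measurable_qOf t)
  have h2 := (measurable_pi_apply a).comp h.explore.measurable
  exact (h1.const_mul _).add ((h2.comp measurable_snd).const_mul _)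

theorem isPolicy_qOf (h : 𝒜.Tuned 𝒵 lam) (t : ℕ) (S : Fin d → ℝ) : IsPolicy (𝒜.qOf t S) where
  measurable := by
    have := h.measurable_qOf t
    fun_prop
  mem x := by
    rw [qOf]
    exact ftrl_mem _ _

theorem isPolicy_piOf (h : 𝒜.Tuned 𝒵 lam) (t : ℕ) (S : Fin d → ℝ) : IsPolicy (𝒜.piOf t S) where
  measurable := by
    have h1 := h.measurable_piOf t
    have h2 : ∀ a, Measurable fun x => 𝒜.piOf t S x a := fun a => by
      have := h1 a
      fun_prop
    exact measurable_pi_lambda _ h2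
  mem x := by
    have := h.γ_le t
    exact lineMap_single_mem_stdSimplex ((h.isPolicy_qOf t S).mem x) (h.explore.mem_simplex x)
      (h.γ_pos t).le (by linarith)

theorem sigmaOf_transpose (t : ℕ) (S : Fin d → ℝ) : (𝒜.sigmaOf t S)ᵀ = 𝒜.sigmaOf t S :=
  secondMoment_transpose

theorem sigmaOf_nonneg (h : 𝒜.Tuned 𝒵 lam) (t : ℕ) (S u : Fin d → ℝ) :
    0 ≤ u ⬝ᵥ 𝒜.sigmaOf t S *ᵥ u :=
  secondMoment_nonneg h.feature (h.isPolicy_piOf t S) u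

theorem dotProduct_sigmaOf_mulVec (h : 𝒜.Tuned 𝒵 lam) (t : ℕ) (S u : Fin d → ℝ) :
    u ⬝ᵥ 𝒜.sigmaOf t S *ᵥ u
      = (1 - 𝒜.γ t) * (u ⬝ᵥ secondMoment 𝒜.G 𝒜.φ (𝒜.qOf t S) *ᵥ u)
        + 𝒜.γ t * (u ⬝ᵥ secondMoment 𝒜.G 𝒜.φ 𝒜.eStar *ᵥ u) := by
  rw [sigmaOf, dotProduct_secondMoment_mulVec h.feature (h.isPolicy_piOf t S),
    dotProduct_secondMoment_mulVec h.feature (h.isPolicy_qOf t S),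
    dotProduct_secondMoment_mulVec h.feature h.explore.isPolicy, ← integral_const_mul,
    ← integral_const_mul, ← integral_add
      ((integrable_sum_mul_dotProduct h.feature (h.isPolicy_qOf t S) u u).const_mul _)
      ((integrable_sum_mul_dotProduct h.feature h.explore.isPolicy u u).const_mul _)]
  congr 1
  funext x
  rw [Finset.mul_sum, Finset.mul_sum, ← Finset.sum_add_distrib]
  exact Finset.sum_congr rfl fun a _ => by rw [piOf]; ring

theorem mul_eStar_le_sigmaOf (h : 𝒜.Tuned 𝒵 lam) (t : ℕ) (S u : Fin d → ℝ) :
    𝒜.γ t * (u ⬝ᵥ secondMoment 𝒜.G 𝒜.φ 𝒜.eStar *ᵥ u) ≤ u ⬝ᵥ 𝒜.sigmaOf t S *ᵥ u := by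
  rw [h.dotProduct_sigmaOf_mulVec]
  have h1 := secondMoment_nonneg h.feature (h.isPolicy_qOf t S) u
  have h2 : 0 ≤ 1 - 𝒜.γ t := by linarith [h.γ_le t]
  have := mul_nonneg h2 h1
  linarith

/-- At least half of π_t is q_t, because γ_t ≤ 1/2. -/
theorem qOf_le_two_mul_sigmaOf (h : 𝒜.Tuned 𝒵 lam) (t : ℕ) (S u : Fin d → ℝ) :
    u ⬝ᵥ secondMoment 𝒜.G 𝒜.φ (𝒜.qOf t S) *ᵥ u ≤ 2 * (u ⬝ᵥ 𝒜.sigmaOf t S *ᵥ u) := by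
  rw [h.dotProduct_sigmaOf_mulVec]
  have h1 := secondMoment_nonneg h.feature (h.isPolicy_qOf t S) u
  have h2 := mul_nonneg (h.γ_pos t).le (secondMoment_nonneg h.feature h.explore.isPolicy u)
  have h3 : 1 / 2 ≤ 1 - 𝒜.γ t := by linarith [h.γ_le t]
  nlinarith

theorem isUnit_sigmaOf (h : 𝒜.Tuned 𝒵 lam) (t : ℕ) (S : Fin d → ℝ) :
    IsUnit (𝒜.sigmaOf t S) :=
  isUnit_of_mul_le h.explore.isUnit secondMoment_transpose
    (secondMoment_nonneg h.feature h.explore.isPolicy) (h.γ_pos t) (h.mul_eStar_le_sigmaOf t S)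

theorem dotProduct_inv_sigmaOf_self_nonneg (h : 𝒜.Tuned 𝒵 lam) (t : ℕ) (S z : Fin d → ℝ) :
    0 ≤ z ⬝ᵥ (𝒜.sigmaOf t S)⁻¹ *ᵥ z :=
  dotProduct_inv_mulVec_nonneg (h.isUnit_sigmaOf t S) (sigmaOf_transpose t S)
    (h.sigmaOf_nonneg t S) z

theorem dotProduct_inv_sigmaOf_self_le (h : 𝒜.Tuned 𝒵 lam) (t : ℕ) (S : Fin d → ℝ) (a : Fin K)
    (x : 𝒳) : 𝒜.φ a x ⬝ᵥ (𝒜.sigmaOf t S)⁻¹ *ᵥ 𝒜.φ a x ≤ 1 / lam / 𝒜.γ t :=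
  dotProduct_inv_mulVec_le h.explore.isUnit secondMoment_transpose
    (secondMoment_nonneg h.feature h.explore.isPolicy) (sigmaOf_transpose t S) (h.γ_pos t)
    (h.mul_eStar_le_sigmaOf t S) _ (h.explore.le _ (h.feature.mem a x))

theorem sq_dotProduct_inv_sigmaOf_le (h : 𝒜.Tuned 𝒵 lam) (t : ℕ) (S : Fin d → ℝ) (a b : Fin K)
    (x y : 𝒳) : (𝒜.φ a x ⬝ᵥ (𝒜.sigmaOf t S)⁻¹ *ᵥ 𝒜.φ b y) ^ 2
      ≤ (𝒜.φ a x ⬝ᵥ (𝒜.sigmaOf t S)⁻¹ *ᵥ 𝒜.φ a x) * (1 / lam / 𝒜.γ t) :=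
  (sq_dotProduct_inv_mulVec_le (h.isUnit_sigmaOf t S) (sigmaOf_transpose t S)
    (h.sigmaOf_nonneg t S) _ _).trans (mul_le_mul_of_nonneg_left
      (h.dotProduct_inv_sigmaOf_self_le t S b y) (h.dotProduct_inv_sigmaOf_self_nonneg t S _))

theorem abs_dotProduct_inv_sigmaOf_le (h : 𝒜.Tuned 𝒵 lam) (t : ℕ) (S : Fin d → ℝ) (a b : Fin K)
    (x y : 𝒳) : |𝒜.φ a x ⬝ᵥ (𝒜.sigmaOf t S)⁻¹ *ᵥ 𝒜.φ b y| ≤ 1 / lam / 𝒜.γ t := by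
  have h0 : 0 ≤ 1 / lam / 𝒜.γ t :=
    div_nonneg (one_div_nonneg.2 h.explore.pos.le) (h.γ_pos t).le
  refine abs_le_of_sq_le_sq ((h.sq_dotProduct_inv_sigmaOf_le t S a b x y).trans ?_) h0
  rw [sq]
  exact mul_le_mul_of_nonneg_right (h.dotProduct_inv_sigmaOf_self_le t S a x) h0

theorem integral_sum_piOf_mul_dotProduct_inv (h : 𝒜.Tuned 𝒵 lam) (t : ℕ) (S : Fin d → ℝ) :
    ∫ x, ∑ a, 𝒜.piOf t S x a * (𝒜.φ a x ⬝ᵥ (𝒜.sigmaOf t S)⁻¹ *ᵥ 𝒜.φ a x) ∂𝒜.G = d :=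
  integral_sum_mul_dotProduct_inv h.feature (h.isPolicy_piOf t S) (h.isUnit_sigmaOf t S)

/-- The atom at `x` together with arm `a` contributes to Σ_t at least the rank-one form φφᵀ with
weight (1/L)(q/2). A likely arm therefore cannot have a large norm φᵀΣ_t⁻¹φ, and this is the only
place where the finite support gains over the general case. -/
theorem qOf_mul_dotProduct_inv_sigmaOf_le (h : 𝒜.Tuned 𝒵 lam) [IsProbabilityMeasure 𝒜.G]
    {L : ℝ} (hL : FiniteSupport 𝒜.G L) (t : ℕ) (S : Fin d → ℝ) (a : Fin K) (x : 𝒳) :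
    𝒜.qOf t S x a * (𝒜.φ a x ⬝ᵥ (𝒜.sigmaOf t S)⁻¹ *ᵥ 𝒜.φ a x) ≤ 2 * L := by
  have hL0 : 0 < L := by
    have := hL.finite
    have : Nonempty 𝒳 := ⟨x⟩
    have h1 : (0 : ℝ) < Nat.card 𝒳 := by exact_mod_cast Nat.card_pos
    exact h1.trans_le hL.card_le
  have hq := (h.isPolicy_qOf t S).mem x
  have key : ∀ u, 𝒜.qOf t S x a / (2 * L) * (𝒜.φ a x ⬝ᵥ u) ^ 2
      ≤ u ⬝ᵥ 𝒜.sigmaOf t S *ᵥ u := by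
    intro u
    have hpi := h.isPolicy_piOf t S
    have hint := integrable_sum_mul_dotProduct h.feature hpi u u
    have hnn : ∀ y b, 0 ≤ 𝒜.piOf t S y b * ((𝒜.φ b y ⬝ᵥ u) * (𝒜.φ b y ⬝ᵥ u)) := fun y b =>
      mul_nonneg ((hpi.mem y).1 b) (mul_self_nonneg _)
    rw [sigmaOf, dotProduct_secondMoment_mulVec h.feature hpi]
    have h1 := setIntegral_le_integral (s := {x}) hint
      (Filter.Eventually.of_forall fun y => Finset.sum_nonneg fun b _ => hnn y b)
    have : MeasurableSingletonClass 𝒳 := ⟨hL.measurableSet_singleton⟩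
    rw [integral_singleton, smul_eq_mul] at h1
    refine le_trans ?_ h1
    have h2 : 𝒜.piOf t S x a * ((𝒜.φ a x ⬝ᵥ u) * (𝒜.φ a x ⬝ᵥ u))
        ≤ ∑ b, 𝒜.piOf t S x b * ((𝒜.φ b x ⬝ᵥ u) * (𝒜.φ b x ⬝ᵥ u)) :=
      Finset.single_le_sum (f := fun b => 𝒜.piOf t S x b * ((𝒜.φ b x ⬝ᵥ u) * (𝒜.φ b x ⬝ᵥ u)))
        (fun b _ => hnn x b) (Finset.mem_univ a)
    have h3 : 𝒜.qOf t S x a / 2 ≤ 𝒜.piOf t S x a := by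
      rw [piOf]
      have := mul_nonneg (h.γ_pos t).le ((h.explore.mem_simplex x).1 a)
      nlinarith [h.γ_le t, hq.1 a]
    have h4 : 𝒜.qOf t S x a / 2 * (𝒜.φ a x ⬝ᵥ u) ^ 2
        ≤ 𝒜.piOf t S x a * ((𝒜.φ a x ⬝ᵥ u) * (𝒜.φ a x ⬝ᵥ u)) := by
      rw [sq]
      exact mul_le_mul_of_nonneg_right h3 (mul_self_nonneg _)
    calc 𝒜.qOf t S x a / (2 * L) * (𝒜.φ a x ⬝ᵥ u) ^ 2
        = 1 / L * (𝒜.qOf t S x a / 2 * (𝒜.φ a x ⬝ᵥ u) ^ 2) := by field_simp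
      _ ≤ 𝒜.G.real {x} * _ := mul_le_mul (hL.le_prob x) (h4.trans h2)
          (mul_nonneg (div_nonneg (hq.1 a) (by norm_num)) (sq_nonneg _)) measureReal_nonneg
  have := mul_dotProduct_inv_mulVec_le_one (h.isUnit_sigmaOf t S) (sigmaOf_transpose t S)
    (h.sigmaOf_nonneg t S) (𝒜.φ a x) key
  rw [div_mul_eq_mul_div, div_le_iff₀ (by positivity), one_mul] at this
  exact this

end Tuned

end Learner

/-! ### Measurability -/

/-- By the adjugate formula, which for real matrices also holds in the singular case, where both
sides are 0. -/
theorem measurable_inv_apply {α : Type*} [MeasurableSpace α] {d : ℕ}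
    {M : α → Matrix (Fin d) (Fin d) ℝ} (hM : ∀ i j, Measurable fun z => M z i j) (i j : Fin d) :
    Measurable fun z => (M z)⁻¹ i j := by
  have h1 : Measurable fun z => (fun i j => M z i j : Fin d → Fin d → ℝ) :=
    measurable_pi_lambda _ fun i => measurable_pi_lambda _ fun j => hM i j
  have h2 : Measurable fun N : Fin d → Fin d → ℝ => (Matrix.of N).det := by
    refine Continuous.measurable ?_
    exact Continuous.matrix_det continuous_id
  have h3 : Measurable fun N : Fin d → Fin d → ℝ => (Matrix.of N).adjugate i j := by
    refine Continuous.measurable ?_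
    exact (Continuous.matrix_adjugate continuous_id).matrix_elem i j
  have e : (fun z => (M z)⁻¹ i j)
      = fun z => ((Matrix.of fun i j => M z i j).det)⁻¹
        * (Matrix.of fun i j => M z i j).adjugate i j := by
    funext z
    rw [Matrix.inv_def, Ring.inverse_eq_inv]
    rfl
  rw [e]
  exact (h2.comp h1).inv.mul (h3.comp h1)

namespace Learner

variable {𝒳 : Type*} [MeasurableSpace 𝒳] {K d : ℕ} [NeZero K]

/-- The value of `ω_t` when the estimates of the rounds before `t` add up to `S`. -/
def omegaOf (𝒜 : Learner 𝒳 K d) (t : ℕ) (S : Fin d → ℝ) : ℝ :=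
  ⨆ x, ⨅ a, (1 - 𝒜.qOf t S x a)

namespace Tuned

variable {𝒜 : Learner 𝒳 K d} {𝒵 : Set (Fin d → ℝ)} {lam : ℝ}

theorem measurable_sigmaOf [SFinite 𝒜.G] (h : 𝒜.Tuned 𝒵 lam) (t : ℕ) (i j : Fin d) :
    Measurable fun S => 𝒜.sigmaOf t S i j := by
  have h1 : ∀ a i, Measurable fun x => 𝒜.φ a x i := fun a i =>
    (measurable_pi_apply i).comp (h.feature.measurable a)
  have h2 : StronglyMeasurable (Function.uncurry fun (S : Fin d → ℝ) (x : 𝒳) =>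
      ∑ a, 𝒜.piOf t S x a * (𝒜.φ a x i * 𝒜.φ a x j)) := by
    refine Measurable.stronglyMeasurable ?_
    refine Finset.measurable_sum _ fun a _ => (h.measurable_piOf t a).mul ?_
    exact ((h1 a i).comp measurable_snd).mul ((h1 a j).comp measurable_snd)
  exact (h2.integral_prod_right (ν := 𝒜.G)).measurable

theorem measurable_inv_sigmaOf [SFinite 𝒜.G] (h : 𝒜.Tuned 𝒵 lam) (t : ℕ) (i j : Fin d) :
    Measurable fun S => (𝒜.sigmaOf t S)⁻¹ i j :=
  measurable_inv_apply (h.measurable_sigmaOf t) i j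

theorem measurable_inv_sigmaOf_mulVec [SFinite 𝒜.G] (h : 𝒜.Tuned 𝒵 lam) (t : ℕ) (a : Fin K) :
    Measurable fun z : (Fin d → ℝ) × 𝒳 => (𝒜.sigmaOf t z.1)⁻¹ *ᵥ 𝒜.φ a z.2 := by
  refine measurable_pi_lambda _ fun i => ?_
  simp only [Matrix.mulVec, dotProduct]
  refine Finset.measurable_sum _ fun j _ => ?_
  exact ((h.measurable_inv_sigmaOf t i j).comp measurable_fst).mul
    (((measurable_pi_apply j).comp (h.feature.measurable a)).comp measurable_snd)

theorem measurable_estimateOf [SFinite 𝒜.G] (h : 𝒜.Tuned 𝒵 lam) (t : ℕ) :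
    Measurable fun z : (Fin d → ℝ) × 𝒳 × Fin K × ℝ => 𝒜.estimateOf t z.1 z.2 := by
  have h1 : Measurable fun z : ((Fin d → ℝ) × 𝒳) × Fin K =>
      (𝒜.sigmaOf t z.1.1)⁻¹ *ᵥ 𝒜.φ z.2 z.1.2 :=
    measurable_from_prod_countable_left fun a => h.measurable_inv_sigmaOf_mulVec t a
  have h2 : Measurable fun z : (Fin d → ℝ) × 𝒳 × Fin K × ℝ => ((z.1, z.2.1), z.2.2.1) := by
    fun_prop
  have h3 : Measurable fun z : (Fin d → ℝ) × 𝒳 × Fin K × ℝ => z.2.2.2 := by fun_prop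
  have h4 := h1.comp h2
  simp only [Function.comp_def] at h4
  have e : ∀ z : (Fin d → ℝ) × 𝒳 × Fin K × ℝ, 𝒜.estimateOf t z.1 z.2
      = z.2.2.2 • ((𝒜.sigmaOf t z.1)⁻¹ *ᵥ 𝒜.φ z.2.2.1 z.2.1) := fun _ => rfl
  simp only [e]
  exact h3.smul h4

theorem measurable_cumEst [SFinite 𝒜.G] (h : 𝒜.Tuned 𝒵 lam) {Ω : Type*} [MeasurableSpace Ω]
    {O : Ω → ℕ → 𝒳 × Fin K × ℝ} (t : ℕ)
    (hO : ∀ s ∈ Finset.Ico 1 (t + 1), Measurable fun w => O w s) :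
    Measurable fun w => 𝒜.cumEst (O w) t := by
  induction t with
  | zero => exact measurable_const
  | succ t ih =>
    have h1 := ih fun s hs => hO s (by simp only [Finset.mem_Ico] at hs ⊢; omega)
    have h2 := hO (t + 1) (by simp)
    exact h1.add ((h.measurable_estimateOf (t + 1)).comp (h1.prodMk h2))

theorem continuous_iInf_one_sub_qOf (h : 𝒜.Tuned 𝒵 lam) (t : ℕ) (x : 𝒳) :
    Continuous fun S => ⨅ a, (1 - 𝒜.qOf t S x a) := by
  have h1 : ∀ a, Continuous fun S => 1 - 𝒜.qOf t S x a := by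
    intro a
    have h2 : Continuous fun (S : Fin d → ℝ) (a : Fin K) => S ⬝ᵥ 𝒜.φ a x := by
      simp only [dotProduct]
      fun_prop
    have h3 := (continuous_apply a).comp ((continuous_ftrl (h.η_pos (t - 1))).comp h2)
    exact continuous_const.sub h3
  simp only [← Finset.inf'_univ_eq_ciInf]
  exact Continuous.finset_inf'_apply _ fun a _ => h1 a

theorem iInf_one_sub_qOf_mem_Icc (t : ℕ) (S : Fin d → ℝ) (x : 𝒳) :
    ⨅ a, (1 - 𝒜.qOf t S x a) ∈ Set.Icc (0 : ℝ) 1 := by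
  rw [qOf]
  exact iInf_one_sub_mem_Icc (ftrl_mem _ _)

theorem bddAbove_range_iInf_one_sub_qOf (t : ℕ) (S : Fin d → ℝ) :
    BddAbove (Set.range fun x => ⨅ a, (1 - 𝒜.qOf t S x a)) :=
  ⟨1, by rintro _ ⟨x, rfl⟩; exact (iInf_one_sub_qOf_mem_Icc t S x).2⟩

theorem le_omegaOf (t : ℕ) (S : Fin d → ℝ) (x : 𝒳) :
    ⨅ a, (1 - 𝒜.qOf t S x a) ≤ 𝒜.omegaOf t S :=
  le_ciSup (bddAbove_range_iInf_one_sub_qOf t S) x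

theorem omegaOf_le_one (t : ℕ) (S : Fin d → ℝ) : 𝒜.omegaOf t S ≤ 1 :=
  Real.iSup_le (fun x => (iInf_one_sub_qOf_mem_Icc t S x).2) zero_le_one

/-- The supremum may run over uncountably many contexts; it is measurable as a lower semicontinuous
function, being a bounded supremum of functions continuous in `S`. -/
theorem measurable_omegaOf (h : 𝒜.Tuned 𝒵 lam) (t : ℕ) : Measurable (𝒜.omegaOf t) :=
  (lowerSemicontinuous_ciSup (bddAbove_range_iInf_one_sub_qOf t)
    fun x => (h.continuous_iInf_one_sub_qOf t x).lowerSemicontinuous).measurable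

end Tuned

end Learner

namespace Rounds

variable {Ω 𝒳 : Type*} [MeasurableSpace 𝒳] {K d : ℕ} {P : Rounds Ω 𝒳 K d}
  {φ : Fin K → 𝒳 → Fin d → ℝ}

theorem measurable_obs_past {s t : ℕ} (hs : s ∈ Finset.Ico 1 t) :
    Measurable[P.past φ t] fun w => P.obs φ w s := by
  have h1 : MeasurableSpace.comap (fun w => P.obs φ w s) inferInstance ≤ P.past φ t :=
    le_iSup₂ (f := fun s (_ : s ∈ Finset.Ico 1 t) =>
      MeasurableSpace.comap (fun w => P.obs φ w s) inferInstance) s hs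
  exact (comap_measurable _).mono h1 le_rfl

theorem measurable_cumEst_past [NeZero K] {𝒜 : Learner 𝒳 K d} {𝒵 : Set (Fin d → ℝ)} {lam : ℝ}
    [SFinite 𝒜.G] (h : 𝒜.Tuned 𝒵 lam) (P : Rounds Ω 𝒳 K d) (t : ℕ) :
    Measurable[P.past 𝒜.φ (t + 1)] fun w => 𝒜.cumEst (P.obs 𝒜.φ w) t := by
  let : MeasurableSpace Ω := P.past 𝒜.φ (t + 1)
  exact h.measurable_cumEst t fun s hs => measurable_obs_past hs

theorem measurable_obs [MeasurableSpace Ω] (hφ : ∀ a, Measurable (φ a)) {t : ℕ}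
    (hX : Measurable (P.X t)) (hA : Measurable (P.A t)) (hε : ∀ a, Measurable (P.ε t a))
    (hθ : Measurable (P.θ t)) : Measurable fun w => P.obs φ w t := by
  have h1 : Measurable fun z : Ω × Fin K => P.loss φ t z.2 (P.X t z.1) z.1 := by
    refine measurable_from_prod_countable_left fun a => ?_
    have h2 := (hφ a).comp hX
    simp only [loss, dotProduct]
    refine (Finset.measurable_sum _ fun i _ => ?_).add (hε a)
    exact ((measurable_pi_apply i).comp h2).mul ((measurable_pi_apply i).comp hθ)
  exact hX.prodMk (hA.prodMk (h1.comp (measurable_id.prodMk hA)))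

namespace IsPlayedBy

variable [MeasurableSpace Ω] [NeZero K] {μ : Measure Ω} {𝒜 : Learner 𝒳 K d} {T : ℕ}

/-- The observation of round `s` involves θ_s, which is only known to be measurable with respect to
the past of `s`; hence strong induction on the round. -/
theorem past_le (hP : P.IsPlayedBy μ 𝒜 T) (hφ : ∀ a, Measurable (𝒜.φ a)) (t : ℕ)
    (ht : t ≤ T + 1) : P.past 𝒜.φ t ≤ ‹MeasurableSpace Ω› := by
  induction t using Nat.strong_induction_on with
  | _ t ih =>
    refine iSup₂_le fun s hs => ?_
    rw [Finset.mem_Ico] at hs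
    have hs' : s ∈ Finset.Icc 1 T := by rw [Finset.mem_Icc]; omega
    refine Measurable.comap_le ?_
    exact measurable_obs hφ (hP.measurable_context s hs') (hP.measurable_arm s hs')
      (hP.measurable_noise s hs') ((hP.nature s hs').mono (ih s hs.2 (by omega)) le_rfl)

end IsPlayedBy

end Rounds

/-! ### Conditioning -/

/-- By independence the law of (H, X) is a product, and Fubini applies. Boundedness is required only
along the values of `H`, since bounds such as |⟨z, θ⟩| ≤ 1 fail for arbitrary θ. -/
theorem integral_comp_of_indep {Ω 𝒳 β : Type*} {m : MeasurableSpace Ω} [mΩ : MeasurableSpace Ω]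
    [MeasurableSpace 𝒳] [MeasurableSpace β] {μ : Measure Ω} [IsProbabilityMeasure μ]
    {G : Measure 𝒳} (hm : m ≤ mΩ) {X : Ω → 𝒳} (hX : Measurable X) (hG : μ.map X = G)
    (hind : Indep m (MeasurableSpace.comap X inferInstance) μ) {H : Ω → β}
    (hH : Measurable[m] H) {f : β × 𝒳 → ℝ} (hf : Measurable f) {C : ℝ}
    (hC : ∀ w x, |f (H w, x)| ≤ C) :
    ∫ w, f (H w, X w) ∂μ = ∫ w, ∫ x, f (H w, x) ∂G ∂μ := by
  subst hG
  have hH' : Measurable H := hH.mono hm le_rfl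
  have h1 : IndepFun H X μ := indep_of_indep_of_le_left hind hH.comap_le
  have h2 := h1.map_prod_eq_prod_map_map hH'.aemeasurable hX.aemeasurable
  have hHX : Measurable fun w => (H w, X w) := hH'.prodMk hX
  have : IsProbabilityMeasure (μ.map X) := Measure.isProbabilityMeasure_map hX.aemeasurable
  have : IsProbabilityMeasure (μ.map H) := Measure.isProbabilityMeasure_map hH'.aemeasurable
  have hint : Integrable f ((μ.map H).prod (μ.map X)) := by
    rw [← h2, integrable_map_measure hf.aestronglyMeasurable hHX.aemeasurable]
    exact Integrable.of_bound (hf.comp hHX).aestronglyMeasurable C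
      (Filter.Eventually.of_forall fun w => hC w (X w))
  calc ∫ w, f (H w, X w) ∂μ = ∫ z, f z ∂(μ.map fun w => (H w, X w)) :=
        (integral_map hHX.aemeasurable hf.aestronglyMeasurable).symm
    _ = ∫ b, ∫ x, f (b, x) ∂(μ.map X) ∂(μ.map H) := by rw [h2, integral_prod _ hint]
    _ = _ := integral_map hH'.aemeasurable
      hf.stronglyMeasurable.integral_prod_right'.aestronglyMeasurable

theorem integral_mul_of_condExp_eq {Ω : Type*} {m : MeasurableSpace Ω} [mΩ : MeasurableSpace Ω]
    {μ : Measure Ω} [IsFiniteMeasure μ] (hm : m ≤ mΩ) {f g p : Ω → ℝ}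
    (hg : Measurable[m] g) {C : ℝ} (hC : ∀ᵐ w ∂μ, ‖g w‖ ≤ C) (hf : Integrable f μ)
    (hp : μ[f | m] =ᵐ[μ] p) : ∫ w, g w * f w ∂μ = ∫ w, g w * p w ∂μ := by
  rw [← integral_condExp (f := fun w => g w * f w) hm]
  refine integral_congr_ae ?_
  have h1 := condExp_stronglyMeasurable_mul_of_bound hm
    (Measurable.stronglyMeasurable hg) hf C hC
  filter_upwards [h1, hp] with w h2 h3
  change (μ[g * f | m]) w = _
  rw [h2, Pi.mul_apply, h3]

theorem abs_sum_mul_le {K : ℕ} {p f : Fin K → ℝ} (hp : p ∈ stdSimplex ℝ (Fin K)) {C : ℝ}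
    (hf : ∀ a, |f a| ≤ C) : |∑ a, p a * f a| ≤ C := by
  calc |∑ a, p a * f a| ≤ ∑ a, |p a * f a| := Finset.abs_sum_le_sum_abs _ _
    _ ≤ ∑ a, p a * C := Finset.sum_le_sum fun a _ => by
        rw [abs_mul, abs_of_nonneg (hp.1 a)]
        exact mul_le_mul_of_nonneg_left (hf a) (hp.1 a)
    _ = C := by rw [← Finset.sum_mul, hp.2, one_mul]

theorem sum_single_mul {K : ℕ} (b : Fin K) (f : Fin K → ℝ) :
    ∑ a, (Pi.single b 1 : Fin K → ℝ) a * f a = f b := by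
  simp [Pi.single_apply]

/-! ### Expectations within one round -/

namespace Rounds

variable {Ω 𝒳 : Type*} [MeasurableSpace 𝒳] {K d : ℕ} {P : Rounds Ω 𝒳 K d}

/-- What the past determines before round `t + 1`: the sum of the estimates, and the parameter
chosen by nature. -/
def state [NeZero K] (P : Rounds Ω 𝒳 K d) (𝒜 : Learner 𝒳 K d) (t : ℕ) (w : Ω) :
    (Fin d → ℝ) × (Fin d → ℝ) :=
  (𝒜.cumEst (P.obs 𝒜.φ w) t, P.θ (t + 1) w)

section

variable [MeasurableSpace Ω] {μ : Measure Ω} {φ : Fin K → 𝒳 → Fin d → ℝ}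
  {𝒵 Θ : Set (Fin d → ℝ)} {T : ℕ}

theorem Bounded.abs_dotProduct_le {G : Measure 𝒳} (hB : P.Bounded μ φ 𝒵 Θ T)
    (hφ : FeatureMap G φ 𝒵) {t : ℕ} (ht : t < T) (a : Fin K) (x : 𝒳) (w : Ω) :
    |φ a x ⬝ᵥ P.θ (t + 1) w| ≤ 1 :=
  hB.inner_le _ (hφ.mem a x) _ (hB.mem (t + 1) (by simp; omega) w)

theorem Bounded.ae_abs_loss_le (hB : P.Bounded μ φ 𝒵 Θ T) {t : ℕ} (ht : t < T) :
    ∀ᵐ w ∂μ, ∀ a x, |P.loss φ (t + 1) a x w| ≤ 1 := by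
  filter_upwards [hB.loss_le] with w hw
  exact hw (t + 1) (by simp; omega)

theorem Bounded.ae_abs_noise_le {G : Measure 𝒳} (hB : P.Bounded μ φ 𝒵 Θ T)
    (hφ : FeatureMap G φ 𝒵) {t : ℕ} (ht : t < T) :
    ∀ᵐ w ∂μ, ∀ a, |P.ε (t + 1) a w| ≤ 2 := by
  filter_upwards [hB.ae_abs_loss_le ht] with w hw a
  have h1 := abs_le.1 (hw a (P.X (t + 1) w))
  have h2 := abs_le.1 (hB.abs_dotProduct_le hφ ht a (P.X (t + 1) w) w)
  rw [loss] at h1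
  exact abs_le.2 ⟨by linarith, by linarith⟩

end

namespace IsPlayedBy

variable [MeasurableSpace Ω] [NeZero K] {μ : Measure Ω} [IsProbabilityMeasure μ]
  {𝒜 : Learner 𝒳 K d} [IsProbabilityMeasure 𝒜.G] {𝒵 Θ : Set (Fin d → ℝ)} {lam : ℝ} {T t : ℕ}

theorem mem_Icc_of_lt (ht : t < T) : t + 1 ∈ Finset.Icc 1 T := by simp; omega

theorem pastContext_le (hP : P.IsPlayedBy μ 𝒜 T) (hφ : ∀ a, Measurable (𝒜.φ a)) (ht : t < T) :
    P.pastContext 𝒜.φ (t + 1) ≤ ‹MeasurableSpace Ω› :=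
  sup_le (hP.past_le hφ (t + 1) (by omega))
    (hP.measurable_context (t + 1) (mem_Icc_of_lt ht)).comap_le

theorem pastContextNoise_le (hP : P.IsPlayedBy μ 𝒜 T) (hφ : ∀ a, Measurable (𝒜.φ a))
    (ht : t < T) : P.pastContextNoise 𝒜.φ (t + 1) ≤ ‹MeasurableSpace Ω› :=
  sup_le (hP.pastContext_le hφ ht)
    (iSup_le fun a => (hP.measurable_noise (t + 1) (mem_Icc_of_lt ht) a).comap_le)

theorem measurable_state (hP : P.IsPlayedBy μ 𝒜 T) (h : 𝒜.Tuned 𝒵 lam) (ht : t < T) :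
    Measurable[P.past 𝒜.φ (t + 1)] (P.state 𝒜 t) := by
  have h1 := measurable_cumEst_past h P t
  have h2 := hP.nature (t + 1) (mem_Icc_of_lt ht)
  let : MeasurableSpace Ω := P.past 𝒜.φ (t + 1)
  exact h1.prodMk h2

theorem measurable_comp_state_context (hP : P.IsPlayedBy μ 𝒜 T) (h : 𝒜.Tuned 𝒵 lam)
    (ht : t < T) {f : ((Fin d → ℝ) × (Fin d → ℝ)) × 𝒳 → ℝ} (hf : Measurable f) :
    Measurable[P.pastContext 𝒜.φ (t + 1)] fun w => f (P.state 𝒜 t w, P.X (t + 1) w) := by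
  have h1 : Measurable[P.pastContext 𝒜.φ (t + 1)] (P.state 𝒜 t) :=
    (hP.measurable_state h ht).mono le_sup_left le_rfl
  have h2 : Measurable[P.pastContext 𝒜.φ (t + 1)] (P.X (t + 1)) :=
    (comap_measurable (P.X (t + 1))).mono le_sup_right le_rfl
  let : MeasurableSpace Ω := P.pastContext 𝒜.φ (t + 1)
  exact hf.comp (h1.prodMk h2)

theorem integrable_noise (hP : P.IsPlayedBy μ 𝒜 T) (h : 𝒜.Tuned 𝒵 lam)
    (hB : P.Bounded μ 𝒜.φ 𝒵 Θ T) (ht : t < T) (a : Fin K) : Integrable (P.ε (t + 1) a) μ := by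
  refine Integrable.of_bound
    (hP.measurable_noise (t + 1) (mem_Icc_of_lt ht) a).aestronglyMeasurable 2 ?_
  filter_upwards [hB.ae_abs_noise_le h.feature ht] with w hw
  exact hw a

theorem integral_mul_noise (hP : P.IsPlayedBy μ 𝒜 T) (h : 𝒜.Tuned 𝒵 lam)
    (hB : P.Bounded μ 𝒜.φ 𝒵 Θ T) (ht : t < T) (a : Fin K) {g : Ω → ℝ}
    (hg : Measurable[P.pastContext 𝒜.φ (t + 1)] g) {C : ℝ} (hC : ∀ w, |g w| ≤ C) :
    ∫ w, g w * P.ε (t + 1) a w ∂μ = 0 := by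
  rw [integral_mul_of_condExp_eq (hP.pastContext_le h.feature.measurable ht) hg
    (Filter.Eventually.of_forall hC) (hP.integrable_noise h hB ht a)
    (hP.noise_centred (t + 1) (mem_Icc_of_lt ht) a)]
  simp

/-- The drawn arm is expanded into indicators, which are replaced by their conditional
probabilities. The weights `g` may involve the noise of the round, because the arm law also
conditions on it. -/
theorem integral_arm (hP : P.IsPlayedBy μ 𝒜 T) (h : 𝒜.Tuned 𝒵 lam) (ht : t < T)
    {g : Fin K → Ω → ℝ} (hg : ∀ a, Measurable[P.pastContextNoise 𝒜.φ (t + 1)] (g a)) {C : ℝ}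
    (hC : ∀ᵐ w ∂μ, ∀ a, |g a w| ≤ C) :
    ∫ w, g (P.A (t + 1) w) w ∂μ
      = ∑ a, ∫ w, g a w * 𝒜.piOf (t + 1) (P.state 𝒜 t w).1 (P.X (t + 1) w) a ∂μ := by
  have hle := hP.pastContextNoise_le h.feature.measurable ht
  have hA : ∀ a, MeasurableSet {w | P.A (t + 1) w = a} := fun a =>
    hP.measurable_arm (t + 1) (mem_Icc_of_lt ht) (measurableSet_singleton a)
  have hI : ∀ a, Integrable (Set.indicator {w | P.A (t + 1) w = a} fun _ => (1 : ℝ)) μ :=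
    fun a => (integrable_const 1).indicator (hA a)
  have e : ∀ w, g (P.A (t + 1) w) w
      = ∑ a, g a w * Set.indicator {w | P.A (t + 1) w = a} (fun _ => (1 : ℝ)) w := by
    intro w
    simp [Set.indicator_apply]
  simp only [e]
  rw [integral_finsetSum]
  · refine Finset.sum_congr rfl fun a _ => ?_
    refine integral_mul_of_condExp_eq hle (hg a) (C := C) ?_ (hI a)
      (hP.arm_law (t + 1) (mem_Icc_of_lt ht) a)
    filter_upwards [hC] with w hw
    exact hw a
  · intro a _
    refine Integrable.bdd_mul (c := C) (hI a)
      ((hg a).mono hle le_rfl).aestronglyMeasurable ?_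
    filter_upwards [hC] with w hw
    exact hw a

theorem integral_comp_context (hP : P.IsPlayedBy μ 𝒜 T) (h : 𝒜.Tuned 𝒵 lam) (ht : t < T)
    {f : ((Fin d → ℝ) × (Fin d → ℝ)) × 𝒳 → ℝ} (hf : Measurable f) {C : ℝ}
    (hC : ∀ w x, |f (P.state 𝒜 t w, x)| ≤ C) :
    ∫ w, f (P.state 𝒜 t w, P.X (t + 1) w) ∂μ = ∫ w, ∫ x, f (P.state 𝒜 t w, x) ∂𝒜.G ∂μ :=
  integral_comp_of_indep (hP.past_le h.feature.measurable (t + 1) (by omega))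
    (hP.measurable_context (t + 1) (mem_Icc_of_lt ht))
    (hP.context_law (t + 1) (mem_Icc_of_lt ht)) (hP.context_indep (t + 1) (mem_Icc_of_lt ht))
    (hP.measurable_state h ht) hf hC

theorem measurable_piOf_state (h : 𝒜.Tuned 𝒵 lam) (t : ℕ) (a : Fin K) :
    Measurable fun z : ((Fin d → ℝ) × (Fin d → ℝ)) × 𝒳 => 𝒜.piOf t z.1.1 z.2 a := by
  have h1 := h.measurable_piOf t a
  fun_prop

/-- The expectation of a function of the state, the context and the arm of a round. -/
theorem integral_comp_arm (hP : P.IsPlayedBy μ 𝒜 T) (h : 𝒜.Tuned 𝒵 lam) (ht : t < T)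
    {f : Fin K → ((Fin d → ℝ) × (Fin d → ℝ)) × 𝒳 → ℝ} (hf : ∀ a, Measurable (f a)) {C : ℝ}
    (hC : ∀ a w x, |f a (P.state 𝒜 t w, x)| ≤ C) :
    ∫ w, f (P.A (t + 1) w) (P.state 𝒜 t w, P.X (t + 1) w) ∂μ
      = ∫ w, ∫ x, ∑ a, 𝒜.piOf (t + 1) (P.state 𝒜 t w).1 x a * f a (P.state 𝒜 t w, x) ∂𝒜.G ∂μ := by
  have hm : ∀ a, Measurable[P.pastContextNoise 𝒜.φ (t + 1)]
      fun w => f a (P.state 𝒜 t w, P.X (t + 1) w) := fun a =>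
    (hP.measurable_comp_state_context h ht (hf a)).mono le_sup_left le_rfl
  have hpi := measurable_piOf_state h (t + 1)
  have hF : ∀ a, Measurable fun z : ((Fin d → ℝ) × (Fin d → ℝ)) × 𝒳 =>
      𝒜.piOf (t + 1) z.1.1 z.2 a * f a z := fun a => (hpi a).mul (hf a)
  have h1 := hP.integral_arm h ht hm (C := C)
    (Filter.Eventually.of_forall fun w a => hC a w _)
  rw [h1]
  have h2 := hP.integral_comp_context h ht
    (f := fun z => ∑ a, 𝒜.piOf (t + 1) z.1.1 z.2 a * f a z)
    (Finset.measurable_sum _ fun a _ => hF a) (C := C)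
    (fun w x => abs_sum_mul_le ((h.isPolicy_piOf (t + 1) _).mem x) fun a => hC a w x)
  rw [← h2, integral_finsetSum]
  · simp only [mul_comm]
  · intro a _
    refine Integrable.of_bound ?_ C (Filter.Eventually.of_forall fun w => ?_)
    · exact ((hP.measurable_comp_state_context h ht (hF a)).mono
        (hP.pastContext_le h.feature.measurable ht) le_rfl).aestronglyMeasurable
    · have h3 := ((h.isPolicy_piOf (t + 1) (P.state 𝒜 t w).1).mem (P.X (t + 1) w))
      rw [norm_mul, Real.norm_of_nonneg (h3.1 a), Real.norm_eq_abs]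
      have h4 := hC a w (P.X (t + 1) w)
      have h5 := mul_le_mul (le_one_of_mem_stdSimplex h3 a) h4 (abs_nonneg _) zero_le_one
      rwa [one_mul] at h5

/-- The noise at the drawn arm is centred: averaging over the arm first leaves weights that depend
only on the past and the context, and against those each noise has mean zero. -/
theorem integral_comp_arm_mul_noise (hP : P.IsPlayedBy μ 𝒜 T) (h : 𝒜.Tuned 𝒵 lam)
    (hB : P.Bounded μ 𝒜.φ 𝒵 Θ T) (ht : t < T)
    {f : Fin K → ((Fin d → ℝ) × (Fin d → ℝ)) × 𝒳 → ℝ} (hf : ∀ a, Measurable (f a)) {C : ℝ}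
    (hC : ∀ a w x, |f a (P.state 𝒜 t w, x)| ≤ C) :
    ∫ w, f (P.A (t + 1) w) (P.state 𝒜 t w, P.X (t + 1) w) * P.ε (t + 1) (P.A (t + 1) w) w ∂μ
      = 0 := by
  have hm := fun a => hP.measurable_comp_state_context h ht (hf a)
  have hpi := fun a => hP.measurable_comp_state_context h ht (measurable_piOf_state h (t + 1) a)
  have hε : ∀ a, Measurable[P.pastContextNoise 𝒜.φ (t + 1)] (P.ε (t + 1) a) := fun a =>
    (comap_measurable (P.ε (t + 1) a)).mono
      ((le_iSup (fun a => MeasurableSpace.comap (P.ε (t + 1) a) inferInstance) a).trans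
        le_sup_right) le_rfl
  have hC0 : ∀ a w, |f a (P.state 𝒜 t w, P.X (t + 1) w)
      * 𝒜.piOf (t + 1) (P.state 𝒜 t w).1 (P.X (t + 1) w) a| ≤ C := by
    intro a w
    have h3 := ((h.isPolicy_piOf (t + 1) (P.state 𝒜 t w).1).mem (P.X (t + 1) w))
    have h4 := hC a w (P.X (t + 1) w)
    rw [abs_mul, abs_of_nonneg (h3.1 a)]
    exact (mul_le_of_le_one_right (abs_nonneg _) (le_one_of_mem_stdSimplex h3 a)).trans h4
  have h1 := hP.integral_arm h ht
    (g := fun a w => f a (P.state 𝒜 t w, P.X (t + 1) w) * P.ε (t + 1) a w) (C := C * 2)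
    (fun a => ((hm a).mono le_sup_left le_rfl).mul (hε a)) (by
      filter_upwards [hB.ae_abs_noise_le h.feature ht] with w hw a
      rw [abs_mul]
      have h4 := hC a w (P.X (t + 1) w)
      exact mul_le_mul h4 (hw a) (abs_nonneg _) ((abs_nonneg _).trans h4))
  rw [h1]
  refine Finset.sum_eq_zero fun a _ => ?_
  rw [← hP.integral_mul_noise h hB ht a ((hm a).mul (hpi a)) (hC0 a)]
  simp only [Pi.mul_apply]
  congr 1
  funext w
  ring

theorem measurable_dotProduct_state (h : 𝒜.Tuned 𝒵 lam) (a : Fin K) :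
    Measurable fun z : ((Fin d → ℝ) × (Fin d → ℝ)) × 𝒳 => 𝒜.φ a z.2 ⬝ᵥ z.1.2 := by
  have h1 : ∀ i, Measurable fun x => 𝒜.φ a x i := fun i =>
    (measurable_pi_apply i).comp (h.feature.measurable a)
  simp only [dotProduct]
  refine Finset.measurable_sum _ fun i _ => ?_
  have := h1 i
  fun_prop

theorem measurable_dotProduct_state_comp (h : 𝒜.Tuned 𝒵 lam) {ρ : 𝒳 → Fin K}
    (hρ : Measurable ρ) :
    Measurable fun z : ((Fin d → ℝ) × (Fin d → ℝ)) × 𝒳 => 𝒜.φ (ρ z.2) z.2 ⬝ᵥ z.1.2 := by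
  have h2 : Measurable fun z : (((Fin d → ℝ) × (Fin d → ℝ)) × 𝒳) × Fin K =>
      𝒜.φ z.2 z.1.2 ⬝ᵥ z.1.1.2 :=
    measurable_from_prod_countable_left fun a => measurable_dotProduct_state h a
  have h3 : Measurable fun z : ((Fin d → ℝ) × (Fin d → ℝ)) × 𝒳 => (z, ρ z.2) := by fun_prop
  exact h2.comp h3

theorem integrable_comp_of_le (hP : P.IsPlayedBy μ 𝒜 T) (hφ : ∀ a, Measurable (𝒜.φ a))
    (ht : t < T) {f : Fin K → Ω → ℝ} (hf : ∀ a, Measurable[P.pastContextNoise 𝒜.φ (t + 1)] (f a))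
    {C : ℝ} (hC : ∀ᵐ w ∂μ, ∀ a, |f a w| ≤ C) :
    Integrable (fun w => f (P.A (t + 1) w) w) μ := by
  have h1 : Measurable fun z : Ω × Fin K => f z.2 z.1 :=
    measurable_from_prod_countable_left fun a =>
      (hf a).mono (hP.pastContextNoise_le hφ ht) le_rfl
  have h2 := hP.measurable_arm (t + 1) (mem_Icc_of_lt ht)
  have h3 : Measurable fun w => (w, P.A (t + 1) w) := measurable_id.prodMk h2
  have h4 := h1.comp h3
  refine Integrable.of_bound h4.aestronglyMeasurable C ?_
  filter_upwards [hC] with w hw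
  exact hw _

/-- The expectation of the observed loss of a round, multiplied by a function of the state, the
context and the arm of that round. -/
theorem integral_comp_arm_mul_loss (hP : P.IsPlayedBy μ 𝒜 T) (h : 𝒜.Tuned 𝒵 lam)
    (hB : P.Bounded μ 𝒜.φ 𝒵 Θ T) (ht : t < T)
    {f : Fin K → ((Fin d → ℝ) × (Fin d → ℝ)) × 𝒳 → ℝ} (hf : ∀ a, Measurable (f a)) {C : ℝ}
    (hC : ∀ a w x, |f a (P.state 𝒜 t w, x)| ≤ C) :
    Integrable (fun w => f (P.A (t + 1) w) (P.state 𝒜 t w, P.X (t + 1) w)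
        * P.loss 𝒜.φ (t + 1) (P.A (t + 1) w) (P.X (t + 1) w) w) μ ∧
    ∫ w, f (P.A (t + 1) w) (P.state 𝒜 t w, P.X (t + 1) w)
        * P.loss 𝒜.φ (t + 1) (P.A (t + 1) w) (P.X (t + 1) w) w ∂μ
      = ∫ w, ∫ x, ∑ a, 𝒜.piOf (t + 1) (P.state 𝒜 t w).1 x a
          * (f a (P.state 𝒜 t w, x) * (𝒜.φ a x ⬝ᵥ P.θ (t + 1) w)) ∂𝒜.G ∂μ := by
  have hε : ∀ a, Measurable[P.pastContextNoise 𝒜.φ (t + 1)] (P.ε (t + 1) a) := fun a =>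
    (comap_measurable (P.ε (t + 1) a)).mono
      ((le_iSup (fun a => MeasurableSpace.comap (P.ε (t + 1) a) inferInstance) a).trans
        le_sup_right) le_rfl
  have hm : ∀ a, Measurable[P.pastContextNoise 𝒜.φ (t + 1)]
      fun w => f a (P.state 𝒜 t w, P.X (t + 1) w) := fun a =>
    (hP.measurable_comp_state_context h ht (hf a)).mono le_sup_left le_rfl
  have hg : ∀ a, Measurable fun z : ((Fin d → ℝ) × (Fin d → ℝ)) × 𝒳 =>
      f a z * (𝒜.φ a z.2 ⬝ᵥ z.1.2) := fun a => (hf a).mul (measurable_dotProduct_state h a)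
  have hgC : ∀ a w x, |f a (P.state 𝒜 t w, x) * (𝒜.φ a x ⬝ᵥ P.θ (t + 1) w)| ≤ C := by
    intro a w x
    rw [abs_mul]
    exact (mul_le_of_le_one_right (abs_nonneg _)
      (hB.abs_dotProduct_le h.feature ht a x w)).trans (hC a w x)
  have i1 : Integrable (fun w => f (P.A (t + 1) w) (P.state 𝒜 t w, P.X (t + 1) w)
      * (𝒜.φ (P.A (t + 1) w) (P.X (t + 1) w) ⬝ᵥ P.θ (t + 1) w)) μ :=
    hP.integrable_comp_of_le h.feature.measurable ht
      (f := fun a w => f a (P.state 𝒜 t w, P.X (t + 1) w)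
        * (𝒜.φ a (P.X (t + 1) w) ⬝ᵥ P.θ (t + 1) w))
      (fun a => (hP.measurable_comp_state_context h ht (hg a)).mono le_sup_left le_rfl)
      (Filter.Eventually.of_forall fun w a => hgC a w _)
  have i2 : Integrable (fun w => f (P.A (t + 1) w) (P.state 𝒜 t w, P.X (t + 1) w)
      * P.ε (t + 1) (P.A (t + 1) w) w) μ :=
    hP.integrable_comp_of_le h.feature.measurable ht
      (f := fun a w => f a (P.state 𝒜 t w, P.X (t + 1) w) * P.ε (t + 1) a w) (C := C * 2)
      (fun a => (hm a).mul (hε a)) (by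
        filter_upwards [hB.ae_abs_noise_le h.feature ht] with w hw a
        rw [abs_mul]
        have h4 := hC a w (P.X (t + 1) w)
        exact mul_le_mul h4 (hw a) (abs_nonneg _) ((abs_nonneg _).trans h4))
  have e := hP.integral_comp_arm h ht hg hgC
  have e' := hP.integral_comp_arm_mul_noise h hB ht hf hC
  simp only [loss, mul_add]
  refine ⟨i1.add i2, ?_⟩
  rw [integral_add i1 i2, e']
  rw [add_zero]
  exact e

/-- The expected loss of a fixed map from contexts to arms in one round. -/
theorem integral_loss_comp (hP : P.IsPlayedBy μ 𝒜 T) (h : 𝒜.Tuned 𝒵 lam)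
    (hB : P.Bounded μ 𝒜.φ 𝒵 Θ T) (ht : t < T) {ρ : 𝒳 → Fin K} (hρ : Measurable ρ) :
    Integrable (fun w => P.loss 𝒜.φ (t + 1) (ρ (P.X (t + 1) w)) (P.X (t + 1) w) w) μ ∧
    ∫ w, P.loss 𝒜.φ (t + 1) (ρ (P.X (t + 1) w)) (P.X (t + 1) w) w ∂μ
      = ∫ w, ∫ x, 𝒜.φ (ρ x) x ⬝ᵥ P.θ (t + 1) w ∂𝒜.G ∂μ := by
  have h1 := measurable_dotProduct_state_comp h hρ
  have hC : ∀ w x, |𝒜.φ (ρ x) x ⬝ᵥ P.θ (t + 1) w| ≤ 1 := fun w x =>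
    hB.abs_dotProduct_le h.feature ht (ρ x) x w
  have e1 := hP.integral_comp_context h ht h1 (C := 1) hC
  have i1 : Integrable (fun w => 𝒜.φ (ρ (P.X (t + 1) w)) (P.X (t + 1) w) ⬝ᵥ P.θ (t + 1) w) μ :=
    Integrable.of_bound ((hP.measurable_comp_state_context h ht h1).mono
      (hP.pastContext_le h.feature.measurable ht) le_rfl).aestronglyMeasurable 1
      (Filter.Eventually.of_forall fun w => hC w _)
  have hs : ∀ a, Measurable fun x => (Pi.single (ρ x) 1 : Fin K → ℝ) a := by
    intro a
    have : Measurable fun b : Fin K => (Pi.single b 1 : Fin K → ℝ) a := measurable_of_finite _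
    exact this.comp hρ
  have hs1 : ∀ a x, |(Pi.single (ρ x) 1 : Fin K → ℝ) a| ≤ 1 := by
    intro a x
    have := single_mem_stdSimplex ℝ (ρ x)
    rw [abs_of_nonneg (this.1 a)]
    exact le_one_of_mem_stdSimplex this a
  have hsm := fun a => hP.measurable_comp_state_context h ht
    (f := fun z => (Pi.single (ρ z.2) 1 : Fin K → ℝ) a) ((hs a).comp measurable_snd)
  -- Noise is centred for each fixed arm, so the arm ρ(X_t) is expanded into indicator weights that
  -- depend on the context alone.
  have e : ∀ w, P.ε (t + 1) (ρ (P.X (t + 1) w)) w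
      = ∑ a, (Pi.single (ρ (P.X (t + 1) w)) 1 : Fin K → ℝ) a * P.ε (t + 1) a w :=
    fun w => (sum_single_mul _ fun a => P.ε (t + 1) a w).symm
  have i2 : ∀ a, Integrable (fun w => (Pi.single (ρ (P.X (t + 1) w)) 1 : Fin K → ℝ) a
      * P.ε (t + 1) a w) μ := fun a =>
    (hP.integrable_noise h hB ht a).bdd_mul (c := 1)
      ((hsm a).mono (hP.pastContext_le h.feature.measurable ht) le_rfl).aestronglyMeasurable
      (Filter.Eventually.of_forall fun w => hs1 a _)
  have i3 : Integrable (fun w => P.ε (t + 1) (ρ (P.X (t + 1) w)) w) μ := by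
    simp only [e]
    exact integrable_finsetSum _ fun a _ => i2 a
  have e2 : ∫ w, P.ε (t + 1) (ρ (P.X (t + 1) w)) w ∂μ = 0 := by
    simp only [e]
    rw [integral_finsetSum _ fun a _ => i2 a]
    exact Finset.sum_eq_zero fun a _ =>
      hP.integral_mul_noise h hB ht a (hsm a) (fun w => hs1 a _)
  simp only [loss]
  refine ⟨i1.add i3, ?_⟩
  rw [integral_add i1 i3, e2, add_zero]
  exact e1

end IsPlayedBy

end Rounds

/-! ### The regret of a learner -/

namespace Learner

variable {𝒳 : Type*} [MeasurableSpace 𝒳] {K d : ℕ} [NeZero K]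

/-- `E_{X₀ ∼ G}[∑ₐ (q_t(a | X₀) - 1{a = ρ(X₀)}) φ(a, X₀)]`, when the estimates of the rounds
before `t` add up to `S`. -/
def direction (𝒜 : Learner 𝒳 K d) (ρ : 𝒳 → Fin K) (t : ℕ) (S : Fin d → ℝ) : Fin d → ℝ :=
  fun i => ∫ x, ∑ a, (𝒜.qOf t S x a - (Pi.single (ρ x) 1 : Fin K → ℝ) a) * 𝒜.φ a x i ∂𝒜.G

theorem abs_sum_sub_mul_le {p p' f : Fin K → ℝ} (hp : p ∈ stdSimplex ℝ (Fin K))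
    (hp' : p' ∈ stdSimplex ℝ (Fin K)) {C : ℝ} (hf : ∀ a, |f a| ≤ C) :
    |∑ a, (p a - p' a) * f a| ≤ 2 * C := by
  have h1 := abs_le.1 (abs_sum_mul_le hp hf)
  have h2 := abs_le.1 (abs_sum_mul_le hp' hf)
  simp only [sub_mul, Finset.sum_sub_distrib]
  exact abs_le.2 ⟨by linarith, by linarith⟩

namespace Tuned

variable {𝒜 : Learner 𝒳 K d} {𝒵 : Set (Fin d → ℝ)} {lam : ℝ} {ρ : 𝒳 → Fin K}

theorem measurable_qOf_sub (h : 𝒜.Tuned 𝒵 lam) (hρ : Measurable ρ) (t : ℕ) (a : Fin K) :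
    Measurable fun z : (Fin d → ℝ) × 𝒳 =>
      𝒜.qOf t z.1 z.2 a - (Pi.single (ρ z.2) 1 : Fin K → ℝ) a := by
  have h1 : Measurable fun b : Fin K => (Pi.single b 1 : Fin K → ℝ) a := measurable_of_finite _
  have h2 := h.measurable_qOf t
  fun_prop

theorem integrable_qOf_sub_mul (h : 𝒜.Tuned 𝒵 lam) [IsProbabilityMeasure 𝒜.G]
    (hρ : Measurable ρ) (t : ℕ) (S : Fin d → ℝ) (i : Fin d) :
    Integrable (fun x => ∑ a, (𝒜.qOf t S x a - (Pi.single (ρ x) 1 : Fin K → ℝ) a)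
      * 𝒜.φ a x i) 𝒜.G := by
  refine integrable_finsetSum _ fun a _ => ?_
  refine Integrable.bdd_mul (c := 1) ((h.feature.memLp a i).integrable one_le_two) ?_
    (Filter.Eventually.of_forall fun x => ?_)
  · have h1 : Measurable fun b : Fin K => (Pi.single b 1 : Fin K → ℝ) a := measurable_of_finite _
    exact (((measurable_pi_apply a).comp (h.isPolicy_qOf t S).measurable).sub
      (h1.comp hρ)).aestronglyMeasurable
  · have h1 := (h.isPolicy_qOf t S).mem x
    have h2 := single_mem_stdSimplex ℝ (ρ x)
    have h3 := h1.1 a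
    have h4 := h2.1 a
    have h5 := le_one_of_mem_stdSimplex h1 a
    have h6 := le_one_of_mem_stdSimplex h2 a
    exact abs_le.2 ⟨by linarith, by linarith⟩

theorem sum_sub_mul_dotProduct (w : Fin K → ℝ) (f : Fin K → Fin d → ℝ) (u : Fin d → ℝ) :
    ∑ a, w a * (f a ⬝ᵥ u) = ∑ i, (∑ a, w a * f a i) * u i := by
  simp only [dotProduct, Finset.mul_sum, Finset.sum_mul]
  rw [Finset.sum_comm]
  exact Finset.sum_congr rfl fun i _ => Finset.sum_congr rfl fun a _ => by ring

theorem direction_dotProduct (h : 𝒜.Tuned 𝒵 lam) [IsProbabilityMeasure 𝒜.G]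
    (hρ : Measurable ρ) (t : ℕ) (S u : Fin d → ℝ) :
    Integrable (fun x => ∑ a, (𝒜.qOf t S x a - (Pi.single (ρ x) 1 : Fin K → ℝ) a)
      * (𝒜.φ a x ⬝ᵥ u)) 𝒜.G ∧
    𝒜.direction ρ t S ⬝ᵥ u = ∫ x, ∑ a, (𝒜.qOf t S x a - (Pi.single (ρ x) 1 : Fin K → ℝ) a)
      * (𝒜.φ a x ⬝ᵥ u) ∂𝒜.G := by
  have e : ∀ x, ∑ a, (𝒜.qOf t S x a - (Pi.single (ρ x) 1 : Fin K → ℝ) a) * (𝒜.φ a x ⬝ᵥ u)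
      = ∑ i, (∑ a, (𝒜.qOf t S x a - (Pi.single (ρ x) 1 : Fin K → ℝ) a) * 𝒜.φ a x i) * u i :=
    fun x => sum_sub_mul_dotProduct (fun a => 𝒜.qOf t S x a - (Pi.single (ρ x) 1 : Fin K → ℝ) a)
      (fun a => 𝒜.φ a x) u
  have hi := fun i => (h.integrable_qOf_sub_mul hρ t S i).mul_const (u i)
  simp only [e]
  refine ⟨integrable_finsetSum _ fun i _ => hi i, ?_⟩
  rw [integral_finsetSum _ fun i _ => hi i, dotProduct]
  exact Finset.sum_congr rfl fun i _ => (integral_mul_const _ _).symm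

theorem measurable_direction (h : 𝒜.Tuned 𝒵 lam) [IsProbabilityMeasure 𝒜.G]
    (hρ : Measurable ρ) (t : ℕ) : Measurable (𝒜.direction ρ t) := by
  refine measurable_pi_lambda _ fun i => ?_
  have h1 : ∀ a, Measurable fun x => 𝒜.φ a x i := fun a =>
    (measurable_pi_apply i).comp (h.feature.measurable a)
  have h2 : StronglyMeasurable (Function.uncurry fun (S : Fin d → ℝ) (x : 𝒳) =>
      ∑ a, (𝒜.qOf t S x a - (Pi.single (ρ x) 1 : Fin K → ℝ) a) * 𝒜.φ a x i) := by
    refine Measurable.stronglyMeasurable ?_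
    exact Finset.measurable_sum _ fun a _ => (h.measurable_qOf_sub hρ t a).mul
      ((h1 a).comp measurable_snd)
  exact (h2.integral_prod_right (ν := 𝒜.G)).measurable

theorem abs_direction_dotProduct_le (h : 𝒜.Tuned 𝒵 lam) [IsProbabilityMeasure 𝒜.G]
    (hρ : Measurable ρ) (t : ℕ) (S : Fin d → ℝ) {u : Fin d → ℝ} {C : ℝ}
    (hC : ∀ a x, |𝒜.φ a x ⬝ᵥ u| ≤ C) : |𝒜.direction ρ t S ⬝ᵥ u| ≤ 2 * C := by
  rw [(h.direction_dotProduct hρ t S u).2, ← Real.norm_eq_abs]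
  refine (norm_integral_le_of_norm_le_const (C := 2 * C)
    (Filter.Eventually.of_forall fun x => ?_)).trans (by simp)
  exact abs_sum_sub_mul_le ((h.isPolicy_qOf t S).mem x) (single_mem_stdSimplex ℝ (ρ x))
    fun a => hC a x

/-- For the observed loss y, the form equals y² φᵀΣ_t⁻¹φ. -/
theorem estimateOf_sigmaOf_estimateOf_le (h : 𝒜.Tuned 𝒵 lam) (t : ℕ) (S : Fin d → ℝ)
    (o : 𝒳 × Fin K × ℝ) (ho : |o.2.2| ≤ 1) :
    𝒜.estimateOf t S o ⬝ᵥ 𝒜.sigmaOf t S *ᵥ 𝒜.estimateOf t S o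
      ≤ 𝒜.φ o.2.1 o.1 ⬝ᵥ (𝒜.sigmaOf t S)⁻¹ *ᵥ 𝒜.φ o.2.1 o.1 := by
  have e : 𝒜.estimateOf t S o = o.2.2 • ((𝒜.sigmaOf t S)⁻¹ *ᵥ 𝒜.φ o.2.1 o.1) := rfl
  rw [e, Matrix.mulVec_smul, smul_dotProduct, dotProduct_smul,
    ← dotProduct_inv_mulVec_eq (h.isUnit_sigmaOf t S) (sigmaOf_transpose t S), smul_eq_mul,
    smul_eq_mul, ← mul_assoc]
  refine mul_le_of_le_one_left (h.dotProduct_inv_sigmaOf_self_nonneg t S _) ?_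
  rw [← sq, ← sq_abs]
  exact pow_le_one₀ (abs_nonneg _) ho

/-- The regret of the regularized leader on the estimated losses, averaged over the contexts, along
a fixed sequence of observations. -/
theorem sum_direction_dotProduct_le (h : 𝒜.Tuned 𝒵 lam) [IsProbabilityMeasure 𝒜.G]
    (hρ : Measurable ρ) (O : ℕ → 𝒳 × Fin K × ℝ) {T : ℕ} (hO : ∀ t < T, |(O (t + 1)).2.2| ≤ 1)
    (hsmall : ∀ t < T, ∀ S a b x y, 𝒜.η t * √(𝒜.qOf (t + 1) S x a)
      * |𝒜.φ a x ⬝ᵥ (𝒜.sigmaOf (t + 1) S)⁻¹ *ᵥ 𝒜.φ b y| ≤ 1 / 4)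
    {pen : ℕ → ℝ} (hpen : ∀ t < T, penaltyFactor 𝒜.η t ≤ pen t) (hpen0 : ∀ t < T, 0 ≤ pen t) :
    ∑ t ∈ Finset.range T, 𝒜.direction ρ (t + 1) (𝒜.cumEst O t) ⬝ᵥ 𝒜.thetaHat O (t + 1)
      ≤ ∑ t ∈ Finset.range T, (8 * 𝒜.η t * √(𝒜.omegaOf (t + 1) (𝒜.cumEst O t))
          * (𝒜.φ (O (t + 1)).2.1 (O (t + 1)).1 ⬝ᵥ (𝒜.sigmaOf (t + 1) (𝒜.cumEst O t))⁻¹ *ᵥ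
              𝒜.φ (O (t + 1)).2.1 (O (t + 1)).1)
        + pen t * (2 * √(K * 𝒜.omegaOf (t + 1) (𝒜.cumEst O t)))) := by
  set S := 𝒜.cumEst O with hS
  set ω : ℕ → ℝ := fun t => 𝒜.omegaOf (t + 1) (S t) with hω
  set u : ℕ → Fin d → ℝ := fun t => 𝒜.thetaHat O (t + 1) with hu
  have hstep : ∀ t, S (t + 1) = S t + u t := fun t => rfl
  have hcum : ∀ t a x, S (t + 1) ⬝ᵥ 𝒜.φ a x - S t ⬝ᵥ 𝒜.φ a x = 𝒜.φ a x ⬝ᵥ u t := by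
    intro t a x
    rw [hstep, add_dotProduct, add_sub_cancel_left, dotProduct_comm]
  have hη := h.η_pos
  -- The regret bound of the leader at each context `x`, against the vertex ρ(x). Index `t` stands
  -- for round `t + 1`, whose iterate uses η_t.
  have hpt : ∀ x, ∑ t ∈ Finset.range T, ∑ a,
        (𝒜.qOf (t + 1) (S t) x a - (Pi.single (ρ x) 1 : Fin K → ℝ) a) * (𝒜.φ a x ⬝ᵥ u t)
      ≤ ∑ t ∈ Finset.range T, (4 * 𝒜.η t * √(ω t)
          * (∑ a, 𝒜.qOf (t + 1) (S t) x a * ((𝒜.φ a x ⬝ᵥ u t) * (𝒜.φ a x ⬝ᵥ u t)))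
        + pen t * (2 * √(K * ω t))) := by
    intro x
    have hq : ∀ t, 𝒜.qOf (t + 1) (S t) x = ftrl (𝒜.η t) fun a => S t ⬝ᵥ 𝒜.φ a x := fun t => rfl
    have h1 := ftrl_regret_le hη (fun t a => S t ⬝ᵥ 𝒜.φ a x) (by
      funext a
      change (0 : Fin d → ℝ) ⬝ᵥ _ = 0
      exact zero_dotProduct _) T (by
      intro t ht a
      rw [hcum, ← hq]
      have e : 𝒜.φ a x ⬝ᵥ u t = (O (t + 1)).2.2 * (𝒜.φ a x ⬝ᵥ
          (𝒜.sigmaOf (t + 1) (S t))⁻¹ *ᵥ 𝒜.φ (O (t + 1)).2.1 (O (t + 1)).1) :=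
        dotProduct_smul _ _ _
      rw [e, abs_mul]
      refine le_trans ?_ (hsmall t ht (S t) a (O (t + 1)).2.1 x (O (t + 1)).1)
      have := hη t
      gcongr
      exact mul_le_of_le_one_left (abs_nonneg _) (hO t ht)) (ρ x)
    simp only [hcum, ← hq] at h1
    refine (Finset.sum_le_sum fun t _ => ?_).trans (h1.trans (Finset.sum_le_sum fun t ht => ?_))
    · simp only [mul_comm]
      exact le_rfl
    · have ht := Finset.mem_range.1 ht
      have h2 : ⨅ a, (1 - 𝒜.qOf (t + 1) (S t) x a) ≤ ω t := le_omegaOf (t + 1) (S t) x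
      have hqm := (h.isPolicy_qOf (t + 1) (S t)).mem x
      have h3 : -tsallis (1 / 2) (𝒜.qOf (t + 1) (S t) x) ≤ 2 * √(K * ω t) :=
        (neg_tsallis_le hqm).trans (by gcongr)
      have h4 := neg_tsallis_nonneg hqm
      have h5 : penaltyFactor 𝒜.η t * -tsallis (1 / 2) (𝒜.qOf (t + 1) (S t) x)
          ≤ pen t * (2 * √(K * ω t)) := mul_le_mul (hpen t ht) h3 h4 (hpen0 t ht)
      have h6 : 0 ≤ ∑ a, 𝒜.qOf (t + 1) (S t) x a * (𝒜.φ a x ⬝ᵥ u t) ^ 2 :=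
        Finset.sum_nonneg fun a _ => mul_nonneg (hqm.1 a) (sq_nonneg _)
      have := hη t
      simp only [← sq]
      gcongr
  have hi1 := fun t => h.direction_dotProduct hρ (t + 1) (S t) (u t)
  have hi2 := fun t => integrable_sum_mul_dotProduct h.feature
    (h.isPolicy_qOf (t + 1) (S t)) (u t) (u t)
  have hi3 : ∀ t, Integrable (fun x => 4 * 𝒜.η t * √(ω t)
      * (∑ a, 𝒜.qOf (t + 1) (S t) x a * ((𝒜.φ a x ⬝ᵥ u t) * (𝒜.φ a x ⬝ᵥ u t)))
        + pen t * (2 * √(K * ω t))) 𝒜.G := fun t =>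
    ((hi2 t).const_mul _).add (integrable_const _)
  have h7 := integral_mono (integrable_finsetSum _ fun t _ => (hi1 t).1)
    (integrable_finsetSum _ fun t _ => hi3 t) hpt
  rw [integral_finsetSum _ fun t _ => (hi1 t).1, integral_finsetSum _ fun t _ => hi3 t] at h7
  simp only [← (hi1 _).2] at h7
  refine h7.trans (Finset.sum_le_sum fun t ht => ?_)
  have ht := Finset.mem_range.1 ht
  rw [integral_add ((hi2 t).const_mul _) (integrable_const _), integral_const_mul,
    ← dotProduct_secondMoment_mulVec h.feature (h.isPolicy_qOf (t + 1) (S t))]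
  simp only [integral_const, probReal_univ, one_smul]
  -- Integration over `x` has produced the form of Σ(q_t) at the estimate; domination by 2Σ_t turns
  -- the constant 4 into 8.
  have h8 := (h.qOf_le_two_mul_sigmaOf (t + 1) (S t) (u t)).trans
    (mul_le_mul_of_nonneg_left (h.estimateOf_sigmaOf_estimateOf_le (t + 1) (S t) (O (t + 1))
      (hO t ht)) zero_le_two)
  have h9 : 0 ≤ 4 * 𝒜.η t * √(ω t) := by
    have := hη t
    positivity
  have h10 := mul_le_mul_of_nonneg_left h8 h9
  linarith

end Tuned

end Learner

/-! ### Unbiasedness and the expected regret of one round -/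

namespace Rounds

namespace IsPlayedBy

variable {Ω 𝒳 : Type*} [MeasurableSpace 𝒳] {K d : ℕ} {P : Rounds Ω 𝒳 K d}
  [MeasurableSpace Ω] [NeZero K] {μ : Measure Ω} [IsProbabilityMeasure μ]
  {𝒜 : Learner 𝒳 K d} [IsProbabilityMeasure 𝒜.G] {𝒵 Θ : Set (Fin d → ℝ)} {lam : ℝ} {T t : ℕ}
  {ρ : 𝒳 → Fin K}

theorem integrable_integral_state (hP : P.IsPlayedBy μ 𝒜 T) (h : 𝒜.Tuned 𝒵 lam) (ht : t < T)
    {f : ((Fin d → ℝ) × (Fin d → ℝ)) × 𝒳 → ℝ} (hf : Measurable f) {C : ℝ}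
    (hC : ∀ w x, |f (P.state 𝒜 t w, x)| ≤ C) :
    Integrable (fun w => ∫ x, f (P.state 𝒜 t w, x) ∂𝒜.G) μ := by
  have h1 : Measurable fun z => ∫ x, f (z, x) ∂𝒜.G :=
    hf.stronglyMeasurable.integral_prod_right'.measurable
  have h2 := (hP.measurable_state h ht).mono
    (hP.past_le h.feature.measurable (t + 1) (by omega)) le_rfl
  have h3 := h1.comp h2
  refine Integrable.of_bound h3.aestronglyMeasurable C (Filter.Eventually.of_forall fun w => ?_)
  exact (norm_integral_le_of_norm_le_const (Filter.Eventually.of_forall (hC w))).trans (by simp)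

theorem integrable_comp_state (hP : P.IsPlayedBy μ 𝒜 T) (h : 𝒜.Tuned 𝒵 lam) (ht : t < T)
    {f : (Fin d → ℝ) × (Fin d → ℝ) → ℝ} (hf : Measurable f) {C : ℝ}
    (hC : ∀ w, |f (P.state 𝒜 t w)| ≤ C) :
    Integrable (fun w => f (P.state 𝒜 t w)) μ := by
  have h2 := (hP.measurable_state h ht).mono
    (hP.past_le h.feature.measurable (t + 1) (by omega)) le_rfl
  have h3 := hf.comp h2
  exact Integrable.of_bound h3.aestronglyMeasurable C (Filter.Eventually.of_forall fun w => hC w)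

theorem integrable_direction_dotProduct (hP : P.IsPlayedBy μ 𝒜 T) (h : 𝒜.Tuned 𝒵 lam)
    (hB : P.Bounded μ 𝒜.φ 𝒵 Θ T) (ht : t < T) (hρ : Measurable ρ) :
    Integrable (fun w => 𝒜.direction ρ (t + 1) (P.state 𝒜 t w).1 ⬝ᵥ P.θ (t + 1) w) μ := by
  have hv := h.measurable_direction hρ (t + 1)
  refine hP.integrable_comp_state h ht
    (f := fun z => 𝒜.direction ρ (t + 1) z.1 ⬝ᵥ z.2) (C := 2 * 1) ?_ fun w => ?_
  · simp only [dotProduct]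
    refine Finset.measurable_sum _ fun i _ => ?_
    exact ((measurable_pi_apply i).comp (hv.comp measurable_fst)).mul
      ((measurable_pi_apply i).comp measurable_snd)
  · exact h.abs_direction_dotProduct_le hρ _ _ fun a x =>
      hB.abs_dotProduct_le h.feature ht a x w

/-- The estimates are unbiased in the direction in which they are used. -/
theorem integral_direction_dotProduct_thetaHat (hP : P.IsPlayedBy μ 𝒜 T) (h : 𝒜.Tuned 𝒵 lam)
    (hB : P.Bounded μ 𝒜.φ 𝒵 Θ T) (ht : t < T) (hρ : Measurable ρ) :
    Integrable (fun w => 𝒜.direction ρ (t + 1) (P.state 𝒜 t w).1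
      ⬝ᵥ 𝒜.thetaHat (P.obs 𝒜.φ w) (t + 1)) μ ∧
    ∫ w, 𝒜.direction ρ (t + 1) (P.state 𝒜 t w).1 ⬝ᵥ 𝒜.thetaHat (P.obs 𝒜.φ w) (t + 1) ∂μ
      = ∫ w, 𝒜.direction ρ (t + 1) (P.state 𝒜 t w).1 ⬝ᵥ P.θ (t + 1) w ∂μ := by
  set f : Fin K → ((Fin d → ℝ) × (Fin d → ℝ)) × 𝒳 → ℝ := fun a z =>
    𝒜.direction ρ (t + 1) z.1.1 ⬝ᵥ (𝒜.sigmaOf (t + 1) z.1.1)⁻¹ *ᵥ 𝒜.φ a z.2 with hf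
  have hfm : ∀ a, Measurable (f a) := by
    intro a
    have h1 := h.measurable_direction hρ (t + 1)
    have h2 := h.measurable_inv_sigmaOf_mulVec (t + 1) a
    have h3 : Measurable fun z : ((Fin d → ℝ) × (Fin d → ℝ)) × 𝒳 => (z.1.1, z.2) := by fun_prop
    have h4 := h2.comp h3
    have h5 : Measurable fun z : ((Fin d → ℝ) × (Fin d → ℝ)) × 𝒳 =>
      𝒜.direction ρ (t + 1) z.1.1 := h1.comp (measurable_fst.comp measurable_fst)
    simp only [hf, dotProduct]
    exact Finset.measurable_sum _ fun i _ =>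
      ((measurable_pi_apply i).comp h5).mul ((measurable_pi_apply i).comp h4)
  have hC : ∀ a w x, |f a (P.state 𝒜 t w, x)| ≤ 2 * (1 / lam / 𝒜.γ (t + 1)) := fun a w x =>
    h.abs_direction_dotProduct_le hρ _ _ fun b y =>
      h.abs_dotProduct_inv_sigmaOf_le _ _ b a y x
  have h1 := hP.integral_comp_arm_mul_loss h hB ht hfm hC
  have e : ∀ w, 𝒜.direction ρ (t + 1) (P.state 𝒜 t w).1
        ⬝ᵥ 𝒜.thetaHat (P.obs 𝒜.φ w) (t + 1)
      = f (P.A (t + 1) w) (P.state 𝒜 t w, P.X (t + 1) w)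
        * P.loss 𝒜.φ (t + 1) (P.A (t + 1) w) (P.X (t + 1) w) w := by
    intro w
    rw [mul_comm]
    exact dotProduct_smul _ _ _
  simp only [e]
  refine ⟨h1.1, h1.2.trans ?_⟩
  congr 1
  funext w
  set S := (P.state 𝒜 t w).1
  set v := 𝒜.direction ρ (t + 1) S
  have hu := h.isUnit_sigmaOf (t + 1) S
  -- By symmetry Σ_t⁻¹ moves onto the direction, so averaging over π_t yields the bilinear form of
  -- Σ_t at Σ_t⁻¹v and θ_t, which collapses to v·θ_t.
  have e1 : ∀ a x, f a (P.state 𝒜 t w, x) = 𝒜.φ a x ⬝ᵥ (𝒜.sigmaOf (t + 1) S)⁻¹ *ᵥ v := by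
    intro a x
    change v ⬝ᵥ (𝒜.sigmaOf (t + 1) S)⁻¹ *ᵥ 𝒜.φ a x = _
    rw [Matrix.dotProduct_mulVec, ← Matrix.mulVec_transpose, Matrix.transpose_nonsing_inv,
      Learner.Tuned.sigmaOf_transpose, dotProduct_comm]
  simp only [e1]
  rw [← dotProduct_secondMoment_mulVec h.feature (h.isPolicy_piOf (t + 1) S)]
  change (𝒜.sigmaOf (t + 1) S)⁻¹ *ᵥ v ⬝ᵥ 𝒜.sigmaOf (t + 1) S *ᵥ P.θ (t + 1) w = _
  rw [Matrix.dotProduct_mulVec, ← Matrix.mulVec_transpose, Learner.Tuned.sigmaOf_transpose,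
    mulVec_inv_mulVec hu]

/-- The policies π_t and q_t differ by γ_t(e* - q_t), which changes the mean loss by at most 2γ_t.
The remaining regret of q_t is linear in θ_t, and unbiasedness puts the estimate in its place. -/
theorem integral_regret_le (hP : P.IsPlayedBy μ 𝒜 T) (h : 𝒜.Tuned 𝒵 lam)
    (hB : P.Bounded μ 𝒜.φ 𝒵 Θ T) (ht : t < T) (hρ : Measurable ρ) :
    Integrable (fun w => P.loss 𝒜.φ (t + 1) (P.A (t + 1) w) (P.X (t + 1) w) w
      - P.loss 𝒜.φ (t + 1) (ρ (P.X (t + 1) w)) (P.X (t + 1) w) w) μ ∧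
    ∫ w, (P.loss 𝒜.φ (t + 1) (P.A (t + 1) w) (P.X (t + 1) w) w
      - P.loss 𝒜.φ (t + 1) (ρ (P.X (t + 1) w)) (P.X (t + 1) w) w) ∂μ
      ≤ ∫ w, 𝒜.direction ρ (t + 1) (P.state 𝒜 t w).1 ⬝ᵥ 𝒜.thetaHat (P.obs 𝒜.φ w) (t + 1) ∂μ
        + 2 * 𝒜.γ (t + 1) := by
  have h1 := hP.integral_comp_arm_mul_loss h hB ht (f := fun _ _ => 1) (C := 1)
    (fun _ => measurable_const) (by simp)
  simp only [one_mul] at h1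
  have h2 := hP.integral_loss_comp h hB ht hρ
  refine ⟨h1.1.sub h2.1, ?_⟩
  rw [integral_sub h1.1 h2.1, h1.2, h2.2,
    (hP.integral_direction_dotProduct_thetaHat h hB ht hρ).2]
  have hb := fun a x w => hB.abs_dotProduct_le h.feature ht a x w
  have hφθ := measurable_dotProduct_state h
  have hpm := measurable_piOf_state h (t + 1)
  have hm1 : Measurable fun z : ((Fin d → ℝ) × (Fin d → ℝ)) × 𝒳 =>
      ∑ a, 𝒜.piOf (t + 1) z.1.1 z.2 a * (𝒜.φ a z.2 ⬝ᵥ z.1.2) :=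
    Finset.measurable_sum _ fun a _ => (hpm a).mul (hφθ a)
  have hm2 := measurable_dotProduct_state_comp h hρ
  have i1 : Integrable (fun w => ∫ x, ∑ a, 𝒜.piOf (t + 1) (P.state 𝒜 t w).1 x a
      * (𝒜.φ a x ⬝ᵥ P.θ (t + 1) w) ∂𝒜.G) μ :=
    hP.integrable_integral_state h ht hm1 (C := 1) fun w x =>
    abs_sum_mul_le ((h.isPolicy_piOf (t + 1) _).mem x) fun a => hb a x w
  have i2 : Integrable (fun w => ∫ x, 𝒜.φ (ρ x) x ⬝ᵥ P.θ (t + 1) w ∂𝒜.G) μ :=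
    hP.integrable_integral_state h ht hm2 (C := 1) fun w x => hb (ρ x) x w
  have i3 := hP.integrable_direction_dotProduct h hB ht hρ
  rw [← integral_sub i1 i2]
  have key : ∀ w, ∫ x, ∑ a, 𝒜.piOf (t + 1) (P.state 𝒜 t w).1 x a * (𝒜.φ a x ⬝ᵥ P.θ (t + 1) w) ∂𝒜.G
      - ∫ x, 𝒜.φ (ρ x) x ⬝ᵥ P.θ (t + 1) w ∂𝒜.G
      ≤ 𝒜.direction ρ (t + 1) (P.state 𝒜 t w).1 ⬝ᵥ P.θ (t + 1) w + 2 * 𝒜.γ (t + 1) := by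
    intro w
    have hd := h.direction_dotProduct hρ (t + 1) (P.state 𝒜 t w).1 (P.θ (t + 1) w)
    have hw : Measurable fun x : 𝒳 => (P.state 𝒜 t w, x) := measurable_prodMk_left
    have hm3 := hm2.comp hw
    have j1 : Integrable (fun x => 𝒜.φ (ρ x) x ⬝ᵥ P.θ (t + 1) w) 𝒜.G :=
      Integrable.of_bound hm3.aestronglyMeasurable 1
        (Filter.Eventually.of_forall fun x => hb (ρ x) x w)
    have hm4 := hm1.comp hw
    have j2 : Integrable (fun x => ∑ a, 𝒜.piOf (t + 1) (P.state 𝒜 t w).1 x a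
        * (𝒜.φ a x ⬝ᵥ P.θ (t + 1) w)) 𝒜.G :=
      Integrable.of_bound hm4.aestronglyMeasurable 1
        (Filter.Eventually.of_forall fun x =>
          abs_sum_mul_le ((h.isPolicy_piOf (t + 1) _).mem x) fun a => hb a x w)
    rw [hd.2, ← integral_sub j2 j1]
    have h4 := integral_mono (j2.sub j1) (hd.1.add (integrable_const (2 * 𝒜.γ (t + 1))))
      (fun x => ?_)
    · have h5 := integral_add hd.1 (integrable_const (μ := 𝒜.G) (2 * 𝒜.γ (t + 1)))
      simp only [integral_const, probReal_univ, one_smul] at h5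
      exact h4.trans h5.le
    · have hq := (h.isPolicy_qOf (t + 1) (P.state 𝒜 t w).1).mem x
      have he := h.explore.mem_simplex x
      have h6 := (abs_le.1 (Learner.abs_sum_sub_mul_le he hq fun a => hb a x w)).2
      have h7 : ∑ a, 𝒜.piOf (t + 1) (P.state 𝒜 t w).1 x a * (𝒜.φ a x ⬝ᵥ P.θ (t + 1) w)
          = ∑ a, 𝒜.qOf (t + 1) (P.state 𝒜 t w).1 x a * (𝒜.φ a x ⬝ᵥ P.θ (t + 1) w)
            + 𝒜.γ (t + 1) * ∑ a, (𝒜.eStar x a - 𝒜.qOf (t + 1) (P.state 𝒜 t w).1 x a)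
              * (𝒜.φ a x ⬝ᵥ P.θ (t + 1) w) := by
        rw [Finset.mul_sum, ← Finset.sum_add_distrib]
        exact Finset.sum_congr rfl fun a _ => by rw [Learner.piOf]; ring
      have h8 := mul_le_mul_of_nonneg_left h6 (h.γ_pos (t + 1)).le
      simp only [Pi.sub_apply, Pi.add_apply, sub_mul, Finset.sum_sub_distrib, sum_single_mul]
        at h8 h7 ⊢
      linarith
  have h9 := integral_mono (i1.sub i2) (i3.add (integrable_const (2 * 𝒜.γ (t + 1)))) key
  have h10 := integral_add i3 (integrable_const (μ := μ) (2 * 𝒜.γ (t + 1)))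
  simp only [integral_const, probReal_univ, one_smul] at h10
  exact h9.trans h10.le

/-- The weighted second moment of the estimates. -/
theorem integral_sqrt_omegaOf_mul (hP : P.IsPlayedBy μ 𝒜 T) (h : 𝒜.Tuned 𝒵 lam) (ht : t < T) :
    Integrable (fun w => √(𝒜.omegaOf (t + 1) (P.state 𝒜 t w).1)
      * (𝒜.φ (P.A (t + 1) w) (P.X (t + 1) w) ⬝ᵥ (𝒜.sigmaOf (t + 1) (P.state 𝒜 t w).1)⁻¹ *ᵥ
        𝒜.φ (P.A (t + 1) w) (P.X (t + 1) w))) μ ∧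
    ∫ w, √(𝒜.omegaOf (t + 1) (P.state 𝒜 t w).1)
      * (𝒜.φ (P.A (t + 1) w) (P.X (t + 1) w) ⬝ᵥ (𝒜.sigmaOf (t + 1) (P.state 𝒜 t w).1)⁻¹ *ᵥ
        𝒜.φ (P.A (t + 1) w) (P.X (t + 1) w)) ∂μ
      = ∫ w, √(𝒜.omegaOf (t + 1) (P.state 𝒜 t w).1) * d ∂μ := by
  set f : Fin K → ((Fin d → ℝ) × (Fin d → ℝ)) × 𝒳 → ℝ := fun a z =>
    √(𝒜.omegaOf (t + 1) z.1.1) * (𝒜.φ a z.2 ⬝ᵥ (𝒜.sigmaOf (t + 1) z.1.1)⁻¹ *ᵥ 𝒜.φ a z.2) with hf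
  have hfm : ∀ a, Measurable (f a) := by
    intro a
    have h1 := h.measurable_omegaOf (t + 1)
    have h2 := h.measurable_inv_sigmaOf_mulVec (t + 1) a
    have h3 : Measurable fun z : ((Fin d → ℝ) × (Fin d → ℝ)) × 𝒳 => (z.1.1, z.2) := by fun_prop
    have h4 := h2.comp h3
    have h5 : Measurable fun z : ((Fin d → ℝ) × (Fin d → ℝ)) × 𝒳 =>
      √(𝒜.omegaOf (t + 1) z.1.1) := (h1.comp (measurable_fst.comp measurable_fst)).sqrt
    have h6 : ∀ i, Measurable fun z : ((Fin d → ℝ) × (Fin d → ℝ)) × 𝒳 => 𝒜.φ a z.2 i := fun i =>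
      (measurable_pi_apply i).comp ((h.feature.measurable a).comp measurable_snd)
    simp only [hf, dotProduct]
    exact h5.mul (Finset.measurable_sum _ fun i _ =>
      (h6 i).mul ((measurable_pi_apply i).comp h4))
  have hC : ∀ a w x, |f a (P.state 𝒜 t w, x)| ≤ 1 / lam / 𝒜.γ (t + 1) := by
    intro a w x
    have h1 := h.abs_dotProduct_inv_sigmaOf_le (t + 1) (P.state 𝒜 t w).1 a a x x
    have h2 : √(𝒜.omegaOf (t + 1) (P.state 𝒜 t w).1) ≤ 1 :=
      Real.sqrt_le_one.2 (Learner.Tuned.omegaOf_le_one _ _)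
    simp only [hf, abs_mul, abs_of_nonneg (Real.sqrt_nonneg _)]
    exact (mul_le_of_le_one_left (abs_nonneg _) h2).trans h1
  refine ⟨hP.integrable_comp_of_le h.feature.measurable ht
    (f := fun a w => f a (P.state 𝒜 t w, P.X (t + 1) w))
    (fun a => (hP.measurable_comp_state_context h ht (hfm a)).mono le_sup_left le_rfl)
    (Filter.Eventually.of_forall fun w a => hC a w _),
    (hP.integral_comp_arm h ht hfm hC).trans ?_⟩
  congr 1
  funext w
  rw [← h.integral_sum_piOf_mul_dotProduct_inv (t + 1) (P.state 𝒜 t w).1, ← integral_const_mul]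
  congr 1
  funext x
  rw [Finset.mul_sum]
  exact Finset.sum_congr rfl fun a _ => by simp only [hf]; ring

end IsPlayedBy

end Rounds

/-! ### Assembling the rounds -/

theorem sum_Icc_one_eq_sum_range (f : ℕ → ℝ) (T : ℕ) :
    ∑ t ∈ Finset.Icc 1 T, f t = ∑ t ∈ Finset.range T, f (t + 1) := by
  induction T with
  | zero => simp
  | succ T ih => rw [Finset.sum_Icc_succ_top (by omega), ih, Finset.sum_range_succ]

theorem sq_rpow_quarter (K : ℕ) : ((K : ℝ) ^ (1 / 4 : ℝ)) ^ 2 = √(K : ℝ) := by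
  rw [Real.sqrt_eq_rpow, ← Real.rpow_natCast, ← Real.rpow_mul (Nat.cast_nonneg K)]
  norm_num

theorem rpow_quarter_pos (K : ℕ) [NeZero K] : 0 < (K : ℝ) ^ (1 / 4 : ℝ) :=
  Real.rpow_pos_of_pos (Nat.cast_pos.2 (NeZero.pos K)) _

theorem sqrt_sqrt_natCast (K : ℕ) : √√(K : ℝ) = (K : ℝ) ^ (1 / 4 : ℝ) := by
  rw [← sq_rpow_quarter, Real.sqrt_sq (Real.rpow_nonneg (Nat.cast_nonneg K) _)]

theorem Rounds.omegaSum_nonneg {Ω 𝒳 : Type*} [MeasurableSpace 𝒳] {K d : ℕ}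
    (P : Rounds Ω 𝒳 K d) [MeasurableSpace Ω] [NeZero K] (μ : Measure Ω) (𝒜 : Learner 𝒳 K d)
    (T : ℕ) : 0 ≤ P.omegaSum μ 𝒜 T :=
  integral_nonneg fun _ => Finset.sum_nonneg fun _ _ => by positivity

/-- Used with κ = K^{1/4}, δ = √d, n = √(t+1) and the square root of ω_t in the role of `ω`. The
constant 20 is 16 from stability plus 4 from the penalty. -/
theorem per_round_bound {κ η δ n ω p c : ℝ} (hκ : 0 < κ) (hδ : 0 < δ) (hn : 0 < n)
    (hω0 : 0 ≤ ω) (hω1 : ω ≤ 1) (hc : 0 ≤ c) (hη : η ≤ 2 * κ / (δ * n))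
    (hp : p ≤ 2 * δ / (κ * n) + c) :
    8 * η * (ω * δ ^ 2) + p * (2 * (κ ^ 2 * ω)) ≤ 20 * (δ * κ * ω / n) + 2 * κ ^ 2 * c := by
  have h1 : 8 * η * (ω * δ ^ 2) ≤ 8 * (2 * κ / (δ * n)) * (ω * δ ^ 2) := by gcongr
  have h2 : p * (2 * (κ ^ 2 * ω)) ≤ (2 * δ / (κ * n) + c) * (2 * (κ ^ 2 * ω)) := by gcongr
  have e1 : 8 * (2 * κ / (δ * n)) * (ω * δ ^ 2) = 16 * (δ * κ * ω / n) := by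
    field_simp
    ring
  have e2 : (2 * δ / (κ * n) + c) * (2 * (κ ^ 2 * ω))
      = 4 * (δ * κ * ω / n) + 2 * κ ^ 2 * c * ω := by
    field_simp
    ring
  have h3 : 2 * κ ^ 2 * c * ω ≤ 2 * κ ^ 2 * c := mul_le_of_le_one_right (by positivity) hω1
  linarith

namespace Rounds.IsPlayedBy

variable {Ω 𝒳 : Type*} [MeasurableSpace 𝒳] {K d : ℕ} {P : Rounds Ω 𝒳 K d}
  [MeasurableSpace Ω] [NeZero K] {μ : Measure Ω} [IsProbabilityMeasure μ]
  {𝒜 : Learner 𝒳 K d} [IsProbabilityMeasure 𝒜.G] {𝒵 Θ : Set (Fin d → ℝ)} {lam : ℝ} {T : ℕ}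

/-- The regret of a learner whose learning rates are of the order `K^{1/4} / √(d t)` or smaller,
and whose estimates are small compared to the inverse learning rates. -/
theorem regret_le [NeZero d] (hP : P.IsPlayedBy μ 𝒜 T) (h : 𝒜.Tuned 𝒵 lam)
    (hB : P.Bounded μ 𝒜.φ 𝒵 Θ T)
    (hsmall : ∀ t S a b x y, 𝒜.η t * √(𝒜.qOf (t + 1) S x a)
      * |𝒜.φ a x ⬝ᵥ (𝒜.sigmaOf (t + 1) S)⁻¹ *ᵥ 𝒜.φ b y| ≤ 1 / 4)
    (hη : ∀ t : ℕ, 𝒜.η t ≤ 2 * (K : ℝ) ^ (1 / 4 : ℝ) / (√(d : ℝ) * √((t + 1 : ℕ) : ℝ)))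
    {c : ℝ} (hc : 0 ≤ c)
    (hpen : ∀ t : ℕ, penaltyFactor 𝒜.η t
      ≤ 2 * √(d : ℝ) / ((K : ℝ) ^ (1 / 4 : ℝ) * √((t + 1 : ℕ) : ℝ)) + if t = 0 then c else 0) :
    P.regret μ 𝒜.φ T ≤ 20 * P.omegaSum μ 𝒜 T + 2 * √(K : ℝ) * c
      + 2 * ∑ t ∈ Finset.range T, 𝒜.γ (t + 1) := by
  have hκ := rpow_quarter_pos K
  have hκ2 := sq_rpow_quarter K
  set κ := (K : ℝ) ^ (1 / 4 : ℝ)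
  have hδ : 0 < √(d : ℝ) := Real.sqrt_pos.2 (Nat.cast_pos.2 (NeZero.pos d))
  have hn : ∀ t : ℕ, 0 < √((t + 1 : ℕ) : ℝ) := fun t =>
    Real.sqrt_pos.2 (Nat.cast_pos.2 t.succ_pos)
  have : Nonempty {ρ : 𝒳 → Fin K // Measurable ρ} := ⟨⟨fun _ => 0, measurable_const⟩⟩
  refine ciSup_le fun ⟨ρ, hρ⟩ => ?_
  simp only [sum_Icc_one_eq_sum_range]
  have hreg := fun t (ht : t ∈ Finset.range T) =>
    hP.integral_regret_le h hB (Finset.mem_range.1 ht) hρ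
  have hdir := fun t (ht : t ∈ Finset.range T) =>
    (hP.integral_direction_dotProduct_thetaHat h hB (Finset.mem_range.1 ht) hρ).1
  rw [integral_finsetSum _ fun t ht => (hreg t ht).1]
  refine (Finset.sum_le_sum fun t ht => (hreg t ht).2).trans ?_
  rw [Finset.sum_add_distrib, ← Finset.mul_sum, ← integral_finsetSum _ hdir]
  gcongr
  set W : ℕ → Ω → ℝ := fun t w => √(𝒜.omegaOf (t + 1) (P.state 𝒜 t w).1) with hW
  have hW0 : ∀ t w, 0 ≤ W t w := fun t w => Real.sqrt_nonneg _
  have hW1 : ∀ t w, W t w ≤ 1 := fun t w => Real.sqrt_le_one.2 (Learner.Tuned.omegaOf_le_one _ _)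
  have iW : ∀ t ∈ Finset.range T, Integrable (W t) μ := by
    intro t ht
    have h1 := (h.measurable_omegaOf (t + 1)).sqrt
    refine hP.integrable_comp_state h (Finset.mem_range.1 ht)
      (f := fun z => √(𝒜.omegaOf (t + 1) z.1)) (h1.comp measurable_fst) (C := 1) fun w => ?_
    rw [abs_of_nonneg (Real.sqrt_nonneg _)]
    exact hW1 t w
  have hsq := fun t (ht : t ∈ Finset.range T) =>
    hP.integral_sqrt_omegaOf_mul h (Finset.mem_range.1 ht)
  set pen : ℕ → ℝ := fun t => 2 * √(d : ℝ) / (κ * √((t + 1 : ℕ) : ℝ)) + if t = 0 then c else 0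
    with hpendef
  have hpen0 : ∀ t, 0 ≤ pen t := by
    intro t
    have := hn t
    simp only [hpendef]
    split_ifs <;> positivity
  have hKW : ∀ t w, √(K * 𝒜.omegaOf (t + 1) (P.state 𝒜 t w).1) = κ ^ 2 * W t w := by
    intro t w
    rw [Real.sqrt_mul (Nat.cast_nonneg K), hκ2]
  have iR : ∀ t ∈ Finset.range T, Integrable (fun w => 8 * 𝒜.η t * (W t w
      * (𝒜.φ (P.A (t + 1) w) (P.X (t + 1) w) ⬝ᵥ (𝒜.sigmaOf (t + 1) (P.state 𝒜 t w).1)⁻¹ *ᵥ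
        𝒜.φ (P.A (t + 1) w) (P.X (t + 1) w))) + pen t * (2 * (κ ^ 2 * W t w))) μ := fun t ht =>
    ((hsq t ht).1.const_mul _).add ((((iW t ht).const_mul _).const_mul _).const_mul _)
  -- Only almost surely, because the losses are bounded only almost surely.
  have hpath : ∀ᵐ w ∂μ, ∑ t ∈ Finset.range T, 𝒜.direction ρ (t + 1) (P.state 𝒜 t w).1
        ⬝ᵥ 𝒜.thetaHat (P.obs 𝒜.φ w) (t + 1)
      ≤ ∑ t ∈ Finset.range T, (8 * 𝒜.η t * (W t w
      * (𝒜.φ (P.A (t + 1) w) (P.X (t + 1) w) ⬝ᵥ (𝒜.sigmaOf (t + 1) (P.state 𝒜 t w).1)⁻¹ *ᵥ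
        𝒜.φ (P.A (t + 1) w) (P.X (t + 1) w))) + pen t * (2 * (κ ^ 2 * W t w))) := by
    filter_upwards [hB.loss_le] with w hw
    have h1 := h.sum_direction_dotProduct_le hρ (P.obs 𝒜.φ w) (T := T)
      (fun t ht => hw (t + 1) (mem_Icc_of_lt ht) _ _) (fun t _ => hsmall t)
      (fun t _ => hpen t) (fun t _ => hpen0 t)
    refine h1.trans (Finset.sum_le_sum fun t _ => ?_)
    rw [← hKW, mul_assoc (8 * 𝒜.η t)]
    exact le_rfl
  refine (integral_mono_ae (integrable_finsetSum _ hdir) (integrable_finsetSum _ iR) hpath).trans ?_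
  have hU : ∀ t w, √(d * √(K : ℝ) * 𝒜.omega (P.obs 𝒜.φ w) (t + 1)) / √((t + 1 : ℕ) : ℝ)
      = √(d : ℝ) * κ * W t w / √((t + 1 : ℕ) : ℝ) := by
    intro t w
    rw [Real.sqrt_mul (by positivity), Real.sqrt_mul (Nat.cast_nonneg d), sqrt_sqrt_natCast]
    rfl
  simp only [omegaSum, sum_Icc_one_eq_sum_range, hU]
  have iU : ∀ t ∈ Finset.range T, Integrable
      (fun w => √(d : ℝ) * κ * W t w / √((t + 1 : ℕ) : ℝ)) μ := fun t ht =>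
    ((iW t ht).const_mul _).div_const _
  rw [integral_finsetSum _ iR, integral_finsetSum _ iU, Finset.mul_sum]
  -- In expectation φᵀΣ_t⁻¹φ becomes `d`, even weighted by √ω_t, which the past determines.
  have hround : ∀ t ∈ Finset.range T, ∫ w, (8 * 𝒜.η t * (W t w
      * (𝒜.φ (P.A (t + 1) w) (P.X (t + 1) w) ⬝ᵥ (𝒜.sigmaOf (t + 1) (P.state 𝒜 t w).1)⁻¹ *ᵥ
        𝒜.φ (P.A (t + 1) w) (P.X (t + 1) w))) + pen t * (2 * (κ ^ 2 * W t w))) ∂μ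
      ≤ 20 * ∫ w, √(d : ℝ) * κ * W t w / √((t + 1 : ℕ) : ℝ) ∂μ
        + 2 * κ ^ 2 * if t = 0 then c else 0 := by
    intro t ht
    have i1 : Integrable (fun w => 8 * 𝒜.η t * (W t w * d)) μ :=
      ((iW t ht).mul_const _).const_mul _
    have i2 : Integrable (fun w => pen t * (2 * (κ ^ 2 * W t w))) μ :=
      (((iW t ht).const_mul _).const_mul _).const_mul _
    rw [integral_add ((hsq t ht).1.const_mul _) i2, integral_const_mul, (hsq t ht).2,
      ← integral_const_mul, ← integral_add i1 i2, ← integral_const_mul]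
    have h1 := integral_mono (i1.add i2)
      (((iU t ht).const_mul 20).add (integrable_const (2 * κ ^ 2 * if t = 0 then c else 0)))
      (fun w => ?_)
    · have h2 := integral_add ((iU t ht).const_mul 20)
        (integrable_const (μ := μ) (2 * κ ^ 2 * if t = 0 then c else 0))
      simp only [integral_const, probReal_univ, one_smul] at h2
      exact h1.trans h2.le
    · have h3 := per_round_bound hκ hδ (hn t) (hW0 t w) (hW1 t w)
        (c := if t = 0 then c else 0) (by split_ifs <;> simp [hc]) (hη t) (le_refl (pen t))
      rw [Real.sq_sqrt (Nat.cast_nonneg d)] at h3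
      exact h3
  refine (Finset.sum_le_sum hround).trans ?_
  rw [Finset.sum_add_distrib, ← Finset.mul_sum, ← Finset.mul_sum]
  have h4 : ∑ t ∈ Finset.range T, (if t = 0 then c else 0) ≤ c := by
    rw [Finset.sum_ite_eq']
    split_ifs <;> simp [hc]
  rw [← hκ2]
  gcongr

end Rounds.IsPlayedBy

/-! ### Tuning -/

/-- For T = 1 the logarithm vanishes, so the first term is bounded separately; later ones satisfy
1/(t+1) ≤ log((t+1)/t). -/
theorem sum_le_half_add_mul_log {g : ℕ → ℝ} {B : ℝ} (h0 : g 0 ≤ 1 / 2)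
    (h : ∀ t, g t ≤ B / (t + 1 : ℕ)) (hB : 0 ≤ B) (T : ℕ) :
    ∑ t ∈ Finset.range T, g t ≤ 1 / 2 + B * Real.log T := by
  rcases T with _ | T
  · simp
  induction T with
  | zero => simpa using h0
  | succ T ih =>
    rw [Finset.sum_range_succ]
    have h1 : (0 : ℝ) < (T + 1 : ℕ) := Nat.cast_pos.2 T.succ_pos
    have h2 : (0 : ℝ) < (T + 1 + 1 : ℕ) := Nat.cast_pos.2 (Nat.succ_pos _)
    have h3 := Real.one_sub_inv_le_log_of_pos (div_pos h2 h1)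
    rw [Real.log_div h2.ne' h1.ne', inv_div] at h3
    have h4 : 1 - ((T + 1 : ℕ) : ℝ) / (T + 1 + 1 : ℕ) = 1 / (T + 1 + 1 : ℕ) := by
      field_simp
      push_cast
      ring
    rw [h4] at h3
    have h5 := mul_le_mul_of_nonneg_left h3 hB
    have h6 := h (T + 1)
    rw [div_eq_mul_one_div] at h6
    linarith

theorem sum_one_div_sqrt_le (T : ℕ) :
    ∑ t ∈ Finset.range T, 1 / √((t + 1 : ℕ) : ℝ) ≤ 2 * √(T : ℝ) := by
  induction T with
  | zero => simp
  | succ T ih =>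
    rw [Finset.sum_range_succ]
    have h1 : (0 : ℝ) < (T + 1 : ℕ) := Nat.cast_pos.2 T.succ_pos
    have h2 := Real.sq_sqrt h1.le
    have h3 := Real.sq_sqrt (Nat.cast_nonneg (α := ℝ) T)
    have h4 := Real.sqrt_pos.2 h1
    have h5 := Real.sqrt_nonneg (T : ℝ)
    push_cast at *
    generalize √((T : ℝ) + 1) = r at *
    generalize √(T : ℝ) = s at *
    have h6 : 1 / r ≤ 2 * (r - s) := by
      rw [div_le_iff₀ h4]
      nlinarith [sq_nonneg (r - s)]
    linarith

/-- The learning rates `min (η̃_t) b`. -/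
def etaMin (K d : ℕ) (b : ℝ) (t : ℕ) : ℝ := min (etaTilde K d (max t 1)) b

section EtaMin

variable {K d : ℕ} [NeZero K] [NeZero d] {b : ℝ}

theorem etaTilde_eq (K d t : ℕ) :
    etaTilde K d t = (K : ℝ) ^ (1 / 4 : ℝ) / (√(d : ℝ) * √(t : ℝ)) := by
  rw [etaTilde, Real.sqrt_mul (Nat.cast_nonneg d)]

theorem sqrt_natCast_pos (d : ℕ) [NeZero d] : 0 < √(d : ℝ) :=
  Real.sqrt_pos.2 (Nat.cast_pos.2 (NeZero.pos d))

theorem sqrt_max_one_pos (t : ℕ) : 0 < √((max t 1 : ℕ) : ℝ) :=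
  Real.sqrt_pos.2 (Nat.cast_pos.2 (by omega))

theorem sqrt_succ_le (t : ℕ) : √((t + 1 : ℕ) : ℝ) ≤ 2 * √((max t 1 : ℕ) : ℝ) := by
  rw [Real.sqrt_le_left (by positivity), mul_pow, Real.sq_sqrt (Nat.cast_nonneg _)]
  have : t + 1 ≤ 4 * max t 1 := by omega
  norm_num
  exact_mod_cast this

theorem etaTilde_pos (t : ℕ) : 0 < etaTilde K d (max t 1) := by
  rw [etaTilde_eq]
  have := rpow_quarter_pos K
  have := sqrt_natCast_pos d
  have := sqrt_max_one_pos t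
  positivity

/-- Round `t + 1` uses η_t in the leader but η_{t+1} in the exploration rate; the mismatch costs a
factor 2. -/
theorem etaTilde_max_le (t : ℕ) :
    etaTilde K d (max t 1) ≤ 2 * etaTilde K d (max (t + 1) 1) := by
  have h0 : max (t + 1) 1 = t + 1 := by omega
  rw [etaTilde_eq, etaTilde_eq, h0]
  have h1 := rpow_quarter_pos K
  have h2 := sqrt_natCast_pos d
  have h3 := sqrt_max_one_pos t
  have h4 := sqrt_succ_le t
  have h5 : 0 < √((t + 1 : ℕ) : ℝ) := Real.sqrt_pos.2 (Nat.cast_pos.2 t.succ_pos)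
  rw [mul_div_assoc', div_le_div_iff₀ (by positivity) (by positivity)]
  generalize √((t + 1 : ℕ) : ℝ) = r at *
  generalize √((max t 1 : ℕ) : ℝ) = s at *
  calc (K : ℝ) ^ (1 / 4 : ℝ) * (√(d : ℝ) * r) ≤ (K : ℝ) ^ (1 / 4 : ℝ) * (√(d : ℝ) * (2 * s)) := by
        gcongr
    _ = _ := by ring

theorem etaMin_pos (hb : 0 < b) (t : ℕ) : 0 < etaMin K d b t := lt_min (etaTilde_pos t) hb

theorem etaMin_le_two_mul (hb : 0 < b) (t : ℕ) : etaMin K d b t ≤ 2 * etaMin K d b (t + 1) := by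
  have h1 := etaTilde_max_le (K := K) (d := d) t
  rw [etaMin, etaMin, mul_min_of_nonneg _ _ zero_le_two]
  exact le_min ((min_le_left _ _).trans h1) ((min_le_right _ _).trans (by linarith))

theorem etaMin_succ_le (t : ℕ) : etaMin K d b (t + 1)
    ≤ (K : ℝ) ^ (1 / 4 : ℝ) / (√(d : ℝ) * √((t + 1 : ℕ) : ℝ)) := by
  have h0 : max (t + 1) 1 = t + 1 := by omega
  refine (min_le_left _ _).trans ?_
  rw [h0, etaTilde_eq]

theorem etaMin_le (hb : 0 < b) (t : ℕ) : etaMin K d b t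
    ≤ 2 * (K : ℝ) ^ (1 / 4 : ℝ) / (√(d : ℝ) * √((t + 1 : ℕ) : ℝ)) := by
  have h1 := etaMin_succ_le (K := K) (d := d) (b := b) t
  have h2 := etaMin_le_two_mul (K := K) (d := d) hb t
  rw [mul_div_assoc]
  linarith

theorem one_div_etaMin (hb : 0 < b) (t : ℕ) : 1 / etaMin K d b t
    = max (√(d : ℝ) * √((max t 1 : ℕ) : ℝ) / (K : ℝ) ^ (1 / 4 : ℝ)) (1 / b) := by
  have h1 := etaTilde_pos (K := K) (d := d) t
  have e : √(d : ℝ) * √((max t 1 : ℕ) : ℝ) / (K : ℝ) ^ (1 / 4 : ℝ)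
      = 1 / etaTilde K d (max t 1) := by
    rw [etaTilde_eq, one_div_div]
  rw [e, etaMin]
  rcases le_total (etaTilde K d (max t 1)) b with h | h
  · rw [min_eq_left h, max_eq_left (one_div_le_one_div_of_le h1 h)]
  · rw [min_eq_right h, max_eq_right (one_div_le_one_div_of_le hb h)]

/-- The inverse rate is the maximum of a multiple of √t and the constant 1/b. A maximum with a
constant grows no faster than its other argument, so 1/b is paid only at the start. -/
theorem penaltyFactor_etaMin_le (hb : 0 < b) (t : ℕ) : penaltyFactor (etaMin K d b) t
    ≤ 2 * √(d : ℝ) / ((K : ℝ) ^ (1 / 4 : ℝ) * √((t + 1 : ℕ) : ℝ)) + if t = 0 then 1 / b else 0 := by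
  have hκ := rpow_quarter_pos K
  have hδ := sqrt_natCast_pos d
  have hb' : 0 < 1 / b := one_div_pos.2 hb
  rcases t with _ | t
  · rw [penaltyFactor, one_div_etaMin hb]
    simp only [zero_le, sup_of_le_right, Nat.cast_one, Real.sqrt_one, mul_one, zero_add, if_true]
    have h1 : √(d : ℝ) / (K : ℝ) ^ (1 / 4 : ℝ) ≤ 2 * √(d : ℝ) / (K : ℝ) ^ (1 / 4 : ℝ) := by
      gcongr
      linarith
    have h2 : 0 ≤ √(d : ℝ) / (K : ℝ) ^ (1 / 4 : ℝ) := by positivity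
    exact max_le (by linarith) (by linarith)
  · rw [penaltyFactor, one_div_etaMin hb, one_div_etaMin hb]
    simp only [Nat.add_eq_zero_iff, one_ne_zero, and_false, if_false, add_zero]
    have h0 : max (t + 1) 1 = t + 1 := by omega
    rw [h0]
    have h1 : (0 : ℝ) < (t + 1 : ℕ) := Nat.cast_pos.2 t.succ_pos
    have h2 : (0 : ℝ) < (t + 1 + 1 : ℕ) := Nat.cast_pos.2 (Nat.succ_pos _)
    have h3 := Real.sqrt_pos.2 h1
    have h4 := Real.sqrt_pos.2 h2
    have h5 := sqrt_max_one_pos t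
    have h6 : √((max t 1 : ℕ) : ℝ) ≤ √((t + 1 : ℕ) : ℝ) :=
      Real.sqrt_le_sqrt (Nat.cast_le.2 (by omega))
    have h7 : √((t + 1 + 1 : ℕ) : ℝ) ≤ 2 * √((t + 1 : ℕ) : ℝ) := by
      have := sqrt_succ_le (t + 1)
      rwa [h0] at this
    have h8 : √((t + 1 : ℕ) : ℝ) ^ 2 - √((max t 1 : ℕ) : ℝ) ^ 2 ≤ 1 := by
      rw [Real.sq_sqrt h1.le, Real.sq_sqrt (Nat.cast_nonneg _)]
      have : t + 1 ≤ 1 + max t 1 := by omega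
      have : ((t + 1 : ℕ) : ℝ) ≤ 1 + (max t 1 : ℕ) := by exact_mod_cast this
      linarith
    generalize √((t + 1 : ℕ) : ℝ) = r at *
    generalize √((max t 1 : ℕ) : ℝ) = s at *
    generalize √((t + 1 + 1 : ℕ) : ℝ) = u at *
    -- Since u ≤ 2r and (r - s)(r + s) ≤ 1. The convention η_0 = η_1 makes `r = s` at the first
    -- increment.
    have h9 : r - s ≤ 2 / u := by
      rw [le_div_iff₀ h4]
      have : (r - s) * u ≤ (r - s) * (2 * r) :=
        mul_le_mul_of_nonneg_left h7 (by linarith)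
      nlinarith
    have h10 : √(d : ℝ) * r / (K : ℝ) ^ (1 / 4 : ℝ) - √(d : ℝ) * s / (K : ℝ) ^ (1 / 4 : ℝ)
        ≤ 2 * √(d : ℝ) / ((K : ℝ) ^ (1 / 4 : ℝ) * u) := by
      have e1 : √(d : ℝ) * r / (K : ℝ) ^ (1 / 4 : ℝ) - √(d : ℝ) * s / (K : ℝ) ^ (1 / 4 : ℝ)
        = √(d : ℝ) / (K : ℝ) ^ (1 / 4 : ℝ) * (r - s) := by ring
      have e2 : 2 * √(d : ℝ) / ((K : ℝ) ^ (1 / 4 : ℝ) * u)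
        = √(d : ℝ) / (K : ℝ) ^ (1 / 4 : ℝ) * (2 / u) := by
        field_simp
      rw [e1, e2]
      gcongr
    have h11 : 0 ≤ 2 * √(d : ℝ) / ((K : ℝ) ^ (1 / 4 : ℝ) * u) := by positivity
    have h12 := le_max_left (√(d : ℝ) * s / (K : ℝ) ^ (1 / 4 : ℝ)) (1 / b)
    have h13 := le_max_right (√(d : ℝ) * s / (K : ℝ) ^ (1 / 4 : ℝ)) (1 / b)
    rw [sub_le_iff_le_add]
    exact max_le (by linarith) (by linarith)

end EtaMin

/-! ### The two choices of parameters -/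

section Tuning

variable {𝒳 : Type*} [MeasurableSpace 𝒳] {G : Measure 𝒳} [IsProbabilityMeasure G] {K d : ℕ}
  [NeZero K] [NeZero d] {φ : Fin K → 𝒳 → Fin d → ℝ} {eStar : 𝒳 → Fin K → ℝ} {lam L : ℝ}
  {𝒵 : Set (Fin d → ℝ)}

theorem FiniteSupport.one_le (hL : FiniteSupport G L) : 1 ≤ L := by
  have := hL.finite
  have : Nonempty 𝒳 := nonempty_of_isProbabilityMeasure G
  have h1 : (1 : ℝ) ≤ Nat.card 𝒳 := by exact_mod_cast Nat.card_pos (α := 𝒳)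
  exact h1.trans hL.card_le

theorem tuned_learnerGeneral (hφ : FeatureMap G φ 𝒵) (he : ExplorationPolicy G φ 𝒵 eStar lam) :
    (learnerGeneral G φ eStar lam).Tuned 𝒵 lam where
  feature := hφ
  explore := he
  η_pos t := etaMin_pos (b := lam / 16) (div_pos he.pos (by norm_num)) t
  γ_pos t := by
    have h1 := etaMin_pos (K := K) (d := d) (b := lam / 16) (div_pos he.pos (by norm_num)) t
    have h2 := he.pos
    change 0 < 8 * etaMin K d (lam / 16) t / lam
    positivity
  γ_le t := by
    have h1 : etaMin K d (lam / 16) t ≤ lam / 16 := min_le_right _ _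
    change 8 * etaMin K d (lam / 16) t / lam ≤ 1 / 2
    rw [div_le_iff₀ he.pos]
    linarith

/-- Bounding √q by 1, the product is at most η_t/(λγ_{t+1}) = η_t/(8η_{t+1}) ≤ 2/8, whence the 8 in
γ_t. -/
theorem learnerGeneral_small (hφ : FeatureMap G φ 𝒵) (he : ExplorationPolicy G φ 𝒵 eStar lam)
    (t : ℕ) (S : Fin d → ℝ) (a b : Fin K) (x y : 𝒳) :
    (learnerGeneral G φ eStar lam).η t * √((learnerGeneral G φ eStar lam).qOf (t + 1) S x a)
      * |φ a x ⬝ᵥ ((learnerGeneral G φ eStar lam).sigmaOf (t + 1) S)⁻¹ *ᵥ φ b y| ≤ 1 / 4 := by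
  have h := tuned_learnerGeneral hφ he
  have hb : 0 < lam / 16 := div_pos he.pos (by norm_num)
  have h1 : |φ a x ⬝ᵥ ((learnerGeneral G φ eStar lam).sigmaOf (t + 1) S)⁻¹ *ᵥ φ b y|
      ≤ 1 / lam / (learnerGeneral G φ eStar lam).γ (t + 1) :=
    h.abs_dotProduct_inv_sigmaOf_le (t + 1) S a b x y
  have h2 : √((learnerGeneral G φ eStar lam).qOf (t + 1) S x a) ≤ 1 :=
    Real.sqrt_le_one.2 (le_one_of_mem_stdSimplex ((h.isPolicy_qOf (t + 1) S).mem x) a)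
  have h3 := etaMin_pos (K := K) (d := d) hb (t + 1)
  have h4 := etaMin_le_two_mul (K := K) (d := d) hb t
  have h5 := he.pos
  have e : 1 / lam / (learnerGeneral G φ eStar lam).γ (t + 1)
      = 1 / (8 * etaMin K d (lam / 16) (t + 1)) := by
    change 1 / lam / (8 * etaMin K d (lam / 16) (t + 1) / lam) = _
    field_simp
  rw [e] at h1
  have h6 := h.η_pos t
  calc _ ≤ (learnerGeneral G φ eStar lam).η t * 1
        * (1 / (8 * etaMin K d (lam / 16) (t + 1))) := by gcongr
    _ = etaMin K d (lam / 16) t / (8 * etaMin K d (lam / 16) (t + 1)) := by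
        rw [mul_one, mul_one_div]
        rfl
    _ ≤ 1 / 4 := by
        rw [div_le_iff₀ (by positivity)]
        linarith

theorem sum_gammaGeneral_le (hlam : 0 < lam) (T : ℕ) :
    ∑ t ∈ Finset.range T, gammaGeneral K d lam (t + 1)
      ≤ 16 * (1 / lam * (√(√(K : ℝ) * T) / √(d : ℝ))) := by
  have hκ := rpow_quarter_pos K
  have hδ := sqrt_natCast_pos d
  have h1 : ∀ t ∈ Finset.range T, gammaGeneral K d lam (t + 1)
      ≤ 8 / lam * ((K : ℝ) ^ (1 / 4 : ℝ) / √(d : ℝ)) * (1 / √((t + 1 : ℕ) : ℝ)) := by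
    intro t _
    have h2 := etaMin_succ_le (K := K) (d := d) (b := lam / 16) t
    change 8 * etaMin K d (lam / 16) (t + 1) / lam ≤ _
    calc _ ≤ 8 * ((K : ℝ) ^ (1 / 4 : ℝ) / (√(d : ℝ) * √((t + 1 : ℕ) : ℝ))) / lam := by gcongr
      _ = _ := by ring
  refine (Finset.sum_le_sum h1).trans ?_
  rw [← Finset.mul_sum, Real.sqrt_mul (Real.sqrt_nonneg _), sqrt_sqrt_natCast]
  calc _ ≤ 8 / lam * ((K : ℝ) ^ (1 / 4 : ℝ) / √(d : ℝ)) * (2 * √(T : ℝ)) := by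
        gcongr
        exact sum_one_div_sqrt_le T
    _ = _ := by ring

theorem div_sixteen_sqrt_pos (hlam : 0 < lam) (hL : 1 ≤ L) : 0 < 1 / 16 * √(lam / L) := by
  have : 0 < L := by linarith
  have := Real.sqrt_pos.2 (div_pos hlam this)
  positivity

theorem tuned_learnerFinite (hφ : FeatureMap G φ 𝒵) (he : ExplorationPolicy G φ 𝒵 eStar lam)
    (hL : FiniteSupport G L) : (learnerFinite G φ eStar lam L).Tuned 𝒵 lam where
  feature := hφ
  explore := he
  η_pos t := etaMin_pos (div_sixteen_sqrt_pos he.pos hL.one_le) t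
  γ_pos t := by
    have h1 := etaMin_pos (K := K) (d := d) (div_sixteen_sqrt_pos he.pos hL.one_le) t
    have h2 := he.pos
    have h3 : 0 < L := by linarith [hL.one_le]
    change 0 < 128 * L * etaMin K d (1 / 16 * √(lam / L)) t ^ 2 / lam
    positivity
  γ_le t := by
    have h1 := etaMin_pos (K := K) (d := d) (div_sixteen_sqrt_pos he.pos hL.one_le) t
    have h2 : etaMin K d (1 / 16 * √(lam / L)) t ≤ 1 / 16 * √(lam / L) := min_le_right _ _
    have h3 : 0 < L := by linarith [hL.one_le]
    have h4 := he.pos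
    have h5 : etaMin K d (1 / 16 * √(lam / L)) t ^ 2 ≤ 1 / 256 * (lam / L) := by
      refine (pow_le_pow_left₀ h1.le h2 2).trans (le_of_eq ?_)
      rw [mul_pow, Real.sq_sqrt (by positivity)]
      norm_num
    change 128 * L * etaMin K d (1 / 16 * √(lam / L)) t ^ 2 / lam ≤ 1 / 2
    rw [div_le_iff₀ h4]
    calc _ ≤ 128 * L * (1 / 256 * (lam / L)) := by gcongr
      _ = 1 / 2 * lam := by
        field_simp
        norm_num

/-- After squaring, q φᵀΣ_t⁻¹φ ≤ 2L and φ'ᵀΣ_t⁻¹φ' ≤ 1/(λγ_{t+1}) bound the product by η_t² ·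
2L/(128Lη_{t+1}²) ≤ 1/16, whence the 128 in γ_t. -/
theorem learnerFinite_small (hφ : FeatureMap G φ 𝒵) (he : ExplorationPolicy G φ 𝒵 eStar lam)
    (hL : FiniteSupport G L) (t : ℕ) (S : Fin d → ℝ) (a b : Fin K) (x y : 𝒳) :
    (learnerFinite G φ eStar lam L).η t * √((learnerFinite G φ eStar lam L).qOf (t + 1) S x a)
      * |φ a x ⬝ᵥ ((learnerFinite G φ eStar lam L).sigmaOf (t + 1) S)⁻¹ *ᵥ φ b y| ≤ 1 / 4 := by
  have h := tuned_learnerFinite hφ he hL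
  have hb := div_sixteen_sqrt_pos he.pos hL.one_le
  have : IsProbabilityMeasure (learnerFinite G φ eStar lam L).G := ‹IsProbabilityMeasure G›
  have h1 := h.sq_dotProduct_inv_sigmaOf_le (t + 1) S a b x y
  have h2 := h.qOf_mul_dotProduct_inv_sigmaOf_le hL (t + 1) S a x
  change (φ a x ⬝ᵥ ((learnerFinite G φ eStar lam L).sigmaOf (t + 1) S)⁻¹ *ᵥ φ b y) ^ 2
    ≤ (φ a x ⬝ᵥ ((learnerFinite G φ eStar lam L).sigmaOf (t + 1) S)⁻¹ *ᵥ φ a x)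
      * (1 / lam / (128 * L * etaMin K d (1 / 16 * √(lam / L)) (t + 1) ^ 2 / lam)) at h1
  change (learnerFinite G φ eStar lam L).qOf (t + 1) S x a
    * (φ a x ⬝ᵥ ((learnerFinite G φ eStar lam L).sigmaOf (t + 1) S)⁻¹ *ᵥ φ a x) ≤ 2 * L at h2
  change etaMin K d (1 / 16 * √(lam / L)) t * _ * _ ≤ _
  have h3 := ((h.isPolicy_qOf (t + 1) S).mem x).1 a
  have h4 := etaMin_pos (K := K) (d := d) hb (t + 1)
  have h5 := etaMin_pos (K := K) (d := d) hb t
  have h6 := etaMin_le_two_mul (K := K) (d := d) hb t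
  have hl := he.pos
  have hL0 : 0 < L := by linarith [hL.one_le]
  generalize etaMin K d (1 / 16 * √(lam / L)) (t + 1) = r at *
  generalize etaMin K d (1 / 16 * √(lam / L)) t = s at *
  generalize (learnerFinite G φ eStar lam L).qOf (t + 1) S x a = q at *
  generalize φ a x ⬝ᵥ ((learnerFinite G φ eStar lam L).sigmaOf (t + 1) S)⁻¹ *ᵥ φ b y = z at *
  generalize φ a x ⬝ᵥ ((learnerFinite G φ eStar lam L).sigmaOf (t + 1) S)⁻¹ *ᵥ φ a x = m at *
  have e : 1 / lam / (128 * L * r ^ 2 / lam) = 1 / (128 * L * r ^ 2) := by field_simp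
  rw [e] at h1
  refine le_of_sq_le_sq (le_trans (b := s ^ 2 * (2 * L * (1 / (128 * L * r ^ 2)))) ?_ ?_)
    (by norm_num)
  · rw [mul_pow, mul_pow, Real.sq_sqrt h3, sq_abs, mul_assoc]
    refine mul_le_mul_of_nonneg_left ?_ (sq_nonneg s)
    calc q * z ^ 2 ≤ q * (m * (1 / (128 * L * r ^ 2))) := by gcongr
      _ = q * m * (1 / (128 * L * r ^ 2)) := by ring
      _ ≤ _ := by gcongr
  · have e2 : s ^ 2 * (2 * L * (1 / (128 * L * r ^ 2))) = s ^ 2 / (64 * r ^ 2) := by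
      field_simp
      norm_num
    rw [e2, div_le_iff₀ (by positivity)]
    nlinarith

theorem sum_gammaFinite_le (hφ : FeatureMap G φ 𝒵) (he : ExplorationPolicy G φ 𝒵 eStar lam)
    (hL : FiniteSupport G L) (T : ℕ) :
    ∑ t ∈ Finset.range T, gammaFinite K d lam L (t + 1)
      ≤ 1 / 2 + 128 * (√(K : ℝ) * L * Real.log T / (lam * d)) := by
  have hl := he.pos
  have hL0 : 0 < L := by linarith [hL.one_le]
  have hd : (0 : ℝ) < d := Nat.cast_pos.2 (NeZero.pos d)
  have h1 := sum_le_half_add_mul_log (g := fun t => gammaFinite K d lam L (t + 1))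
    (B := 128 * L * √(K : ℝ) / (lam * d)) ((tuned_learnerFinite hφ he hL).γ_le 1) (fun t => ?_)
    (by positivity) T
  · refine h1.trans (le_of_eq ?_)
    ring
  · have h2 := etaMin_succ_le (K := K) (d := d) (b := 1 / 16 * √(lam / L)) t
    have h3 := etaMin_pos (K := K) (d := d) (div_sixteen_sqrt_pos hl hL.one_le) (t + 1)
    have h4 := pow_le_pow_left₀ h3.le h2 2
    rw [div_pow, mul_pow, sq_rpow_quarter, Real.sq_sqrt hd.le,
      Real.sq_sqrt (Nat.cast_nonneg _)] at h4
    change 128 * L * etaMin K d (1 / 16 * √(lam / L)) (t + 1) ^ 2 / lam ≤ _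
    calc _ ≤ 128 * L * (√(K : ℝ) / (d * (t + 1 : ℕ))) / lam := by gcongr
      _ = _ := by
        field_simp

end Tuning

end LinContextBandit

end

/-! ### The regret bounds -/

theorem theorem4p1 :
    ∃ C : ℝ, 0 < C ∧
      ∀ (𝒳 : Type*) [MeasurableSpace 𝒳] (Ω : Type*) [MeasurableSpace Ω]
        (μ : Measure Ω) [IsProbabilityMeasure μ] (G : Measure 𝒳) [IsProbabilityMeasure G]
        (K d T : ℕ) [NeZero K] [NeZero d]
        (φ : Fin K → 𝒳 → Fin d → ℝ) (eStar : 𝒳 → Fin K → ℝ) (lam : ℝ)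
        (𝒵 Θ : Set (Fin d → ℝ)) (P : LinContextBandit.Rounds Ω 𝒳 K d),
        LinContextBandit.FeatureMap G φ 𝒵 →
        LinContextBandit.ExplorationPolicy G φ 𝒵 eStar lam →
        P.Bounded μ φ 𝒵 Θ T →
        (∀ L : ℝ, LinContextBandit.FiniteSupport G L →
          P.IsPlayedBy μ (LinContextBandit.learnerFinite G φ eStar lam L) T →
          P.regret μ φ T ≤
            C * (P.omegaSum μ (LinContextBandit.learnerFinite G φ eStar lam L) T +
              (√(K * L / lam) + √(K : ℝ) * L * Real.log T / (lam * d)))) ∧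
        (P.IsPlayedBy μ (LinContextBandit.learnerGeneral G φ eStar lam) T →
          P.regret μ φ T ≤
            C * (P.omegaSum μ (LinContextBandit.learnerGeneral G φ eStar lam) T +
              1 / lam * (√(K : ℝ) + √(√(K : ℝ) * T) / √(d : ℝ)))) := by
  -- The largest constant is 2 · 128, from the logarithmic sum of exploration rates; the others are
  -- 20, 32 and 33.
  refine ⟨256, by norm_num, ?_⟩
  intro 𝒳 _ Ω _ μ _ G _ K d T _ _ φ eStar lam 𝒵 Θ P hφ he hB
  have hl := he.pos
  have hK : (1 : ℝ) ≤ K := by exact_mod_cast NeZero.one_le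
  have hd : (0 : ℝ) < d := Nat.cast_pos.2 (NeZero.pos d)
  refine ⟨fun L hL hP => ?_, fun hP => ?_⟩
  · have hL1 := hL.one_le
    have hL0 : 0 < L := by linarith
    have hb := LinContextBandit.div_sixteen_sqrt_pos hl hL1
    have : IsProbabilityMeasure (LinContextBandit.learnerFinite G φ eStar lam L).G :=
      ‹IsProbabilityMeasure G›
    have h1 : P.regret μ φ T ≤ _ := hP.regret_le (LinContextBandit.tuned_learnerFinite hφ he hL) hB
      (LinContextBandit.learnerFinite_small hφ he hL) (LinContextBandit.etaMin_le hb)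
      (one_div_pos.2 hb).le (LinContextBandit.penaltyFactor_etaMin_le hb)
    have h2 := LinContextBandit.sum_gammaFinite_le hφ he hL T
    have h3 := P.omegaSum_nonneg μ (LinContextBandit.learnerFinite G φ eStar lam L) T
    -- Absorbs the contribution 2 · 1/2 of the first exploration rate, using λ ≤ 1 ≤ KL.
    have h4 : 1 ≤ √(K * L / lam) := by
      rw [Real.one_le_sqrt, one_le_div hl]
      have := he.le_one hφ
      nlinarith
    -- The inverse of the cap on η_t, paid once, is the source of √(KL/λ).
    have h5 : √(K : ℝ) * (1 / (1 / 16 * √(lam / L))) = 16 * √(K * L / lam) := by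
      have e1 : (K : ℝ) * L / lam = K / (lam / L) := by field_simp
      rw [e1, Real.sqrt_div (Nat.cast_nonneg K)]
      field_simp
    have h6 : 0 ≤ √(K : ℝ) * L * Real.log T / (lam * d) := by
      have := Real.log_natCast_nonneg T
      positivity
    change _ ≤ _ + _ + 2 * ∑ t ∈ Finset.range T, LinContextBandit.gammaFinite K d lam L (t + 1)
      at h1
    rw [mul_assoc 2, h5] at h1
    linarith
  · have hb : 0 < lam / 16 := div_pos hl (by norm_num)
    have : IsProbabilityMeasure (LinContextBandit.learnerGeneral G φ eStar lam).G :=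
      ‹IsProbabilityMeasure G›
    have h1 : P.regret μ φ T ≤ _ := hP.regret_le (LinContextBandit.tuned_learnerGeneral hφ he) hB
      (LinContextBandit.learnerGeneral_small hφ he) (LinContextBandit.etaMin_le hb)
      (one_div_pos.2 hb).le (LinContextBandit.penaltyFactor_etaMin_le hb)
    have h2 := LinContextBandit.sum_gammaGeneral_le (K := K) (d := d) hl T
    have h3 := P.omegaSum_nonneg μ (LinContextBandit.learnerGeneral G φ eStar lam) T
    have h4 : √(K : ℝ) * (1 / (lam / 16)) = 16 * (1 / lam * √(K : ℝ)) := by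
      field_simp
    have h5 : 0 ≤ 1 / lam * √(K : ℝ) := by positivity
    have h6 : 0 ≤ 1 / lam * (√(√(K : ℝ) * T) / √(d : ℝ)) := by positivity
    change _ ≤ _ + _ + 2 * ∑ t ∈ Finset.range T, LinContextBandit.gammaGeneral K d lam (t + 1)
      at h1
    rw [mul_assoc 2, h4] at h1
    rw [mul_add (1 / lam)]
    linarith
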